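/- A \emph{series-parallel} graph is a finite simple graph $G$ with two terminals $s,t$ that is either the single edge $st$, or a parallel combination of at least two series-parallel graphs, all with terminals $s,t$ and otherwise disjoint, or a series combination of at least two series-parallel graphs $G_1,\dots,G_f$, where $G_i$ has terminals $s_i,t_i$, with $s_1=s$, $t_f=t$, $t_i=s_{i+1}$, and the $G_i$ are otherwise disjoint. An \emph{SPQ-tree} of $G$ records such a construction: a $Q$-node is a single edge, and a $P$-node (resp. $S$-node) is a parallel (resp. series) combination of the graphs of its children. It is \emph{reduced} if no $P$-node has a $P$-node child and no $S$-node has an $S$-node child. Let $\#(P^*)$ be the number of $P$-nodes of the tree with no $Q$-node child. An \emph{orthogonal drawing} of $G$ is a crossing-free drawing in the plane in which vertices are distinct points and edges are axis-aligned simple polylines. A \emph{segment} of it is a maximal set of straight pieces of edges, all horizontal or all vertical, any two of which are linked by a chain of such pieces with consecutive pieces sharing an end point. A set of segments \emph{covers} $G$ if every vertex lies on one of them. A graph is \emph{outerplanar} if its vertices can be placed on a circle such that its edges, drawn as chords, do not cross. (1) Sufficiency. If $G$ is series-parallel with maximum degree at most $3$, then for every SPQ-tree of $G$ there is an orthogonal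 drawing of $G$ in which $\#(P^*)+1$ segments suffice to cover all vertices of $G$. (2) Necessity. The bound is sometimes necessary, also for outerplanar graphs: (a) For every $k\ge 0$ there is an outerplanar series-parallel graph $G$ of maximum degree exactly $3$ with a reduced SPQ-tree for which $\#(P^*)=k$, such that in every orthogonal drawing of $G$ every set of segments covering all vertices has at least $k+1=\#(P^*)+1$ elements. (b) If $G$ is an outerplanar series-parallel graph of maximum degree at most $3$ whose terminals $s,t$ are adjacent, then for every reduced SPQ-tree of $G$ with terminals $s,t$ and every orthogonal drawing of $G$, every set of segments covering all vertices has at least $\#(P^*)+1$ elements. -/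

import Mathlib

/-! ### SPQ-trees of two-terminal series-parallel graphs -/

/-- Rooted trees with `Q`-, `S`- and `P`-nodes; the `n` children of an `S`- or `P`-node are
indexed by `Fin n`. -/
inductive SPQTree : Type
  | Q : SPQTree
  | S (n : ℕ) (child : Fin n → SPQTree) : SPQTree
  | P (n : ℕ) (child : Fin n → SPQTree) : SPQTree

namespace SPQTree

/-- The root is an `S`-node. -/
def IsS : SPQTree → Prop
  | S _ _ => True
  | _ => False

/-- The root is a `P`-node. -/
def IsP : SPQTree → Prop
  | P _ _ => True
  | _ => False

/-- The tree is reduced: no `S`-node has an `S`-node as a child and no `P`-node has a `P`-node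
as a child. -/
def Reduced : SPQTree → Prop
  | Q => True
  | S _ child => ∀ i, ¬ (child i).IsS ∧ (child i).Reduced
  | P _ child => ∀ i, ¬ (child i).IsP ∧ (child i).Reduced

open Classical in
/-- The number of `P`-nodes that have no `Q`-node as a child. -/
noncomputable def numPStar : SPQTree → ℕ
  | Q => 0
  | S _ child => ∑ i, (child i).numPStar
  | P _ child => (if ∃ i, child i = Q then 0 else 1) + ∑ i, (child i).numPStar

/-- `T.Decomposes H s t`: the subgraph `H` is a series-parallel graph with terminals `s`, `t`, and
`T` is an SPQ-tree recording a recursive construction of it.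
* A `Q`-node is a single edge joining the terminals.
* A `P`-node combines at least two series-parallel graphs that all have the terminals `s` and `t`
  and share nothing else (no other vertex and no edge).
* An `S`-node combines at least two series-parallel graphs `K 0, …, K (n - 1)` in series: the
  terminals of `K i` are `c i` and `c (i + 1)`, where `c 0 = s` and `c n = t`; consecutive graphs
  share only their common terminal, and all others are vertex-disjoint. -/
def Decomposes {V : Type*} {G : SimpleGraph V} : SPQTree → G.Subgraph → V → V → Prop
  | Q, H, s, t => ∃ h : G.Adj s t, H = G.subgraphOfAdj h
  | P n child, H, s, t => 2 ≤ n ∧ ∃ K : Fin n → G.Subgraph,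
      H = ⨆ i, K i ∧
      (∀ i, (child i).Decomposes (K i) s t) ∧
      ∀ i j, i ≠ j →
        (K i).verts ∩ (K j).verts = {s, t} ∧ Disjoint (K i).edgeSet (K j).edgeSet
  | S n child, H, s, t => 2 ≤ n ∧ ∃ (K : Fin n → G.Subgraph) (c : Fin (n + 1) → V),
      c 0 = s ∧ c (Fin.last n) = t ∧
      H = ⨆ i, K i ∧
      (∀ i, (child i).Decomposes (K i) (c i.castSucc) (c i.succ)) ∧
      (∀ i j : Fin n, (i : ℕ) + 1 = j → (K i).verts ∩ (K j).verts = {c j.castSucc}) ∧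
      (∀ i j : Fin n, (i : ℕ) + 1 < j → Disjoint (K i).verts (K j).verts)

/-- `T` is an SPQ-tree of the graph `G` with terminals `s` and `t`. (That some such `T` exists says
that `G` is series-parallel with terminals `s` and `t`.) -/
def IsTreeOf {V : Type*} (T : SPQTree) (G : SimpleGraph V) (s t : V) : Prop :=
  T.Decomposes (⊤ : G.Subgraph) s t

end SPQTree

/-! ### Orthogonal drawings -/

/-- Points of the plane. -/
abbrev Point : Type := ℝ × ℝ

/-- The line-segment between two points is horizontal. -/
def IsHorizontal (a b : Point) : Prop := a.2 = b.2

/-- The line-segment between two points is vertical. -/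
def IsVertical (a b : Point) : Prop := a.1 = b.1

/-- The point set of the polyline through the listed points. -/
def polylineCarrier : List Point → Set Point
  | [] => ∅
  | [a] => {a}
  | a :: b :: l => segment ℝ a b ∪ polylineCarrier (b :: l)

/-- The listed points are the successive corners of an orthogonal polyline that does not touch
itself: every piece is non-degenerate and axis-aligned, and it meets the rest of the polyline only
in the corner at which it ends. -/
def IsOrthogonalPath : List Point → Prop
  | [] => True
  | [_] => True
  | a :: b :: l => a ≠ b ∧ (IsHorizontal a b ∨ IsVertical a b) ∧
      segment ℝ a b ∩ polylineCarrier (b :: l) ⊆ {b} ∧ IsOrthogonalPath (b :: l)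

/-- A (planar) orthogonal drawing of `G`: vertices are distinct points, each edge is an
axis-aligned simple polyline joining its ends (listed by its corners, from one end to the other),
no edge passes through a vertex other than its ends, and two edges meet only in common ends. In
particular no two edges leave a vertex in the same direction. -/
structure OrthogonalDrawing {V : Type*} (G : SimpleGraph V) where
  pos : V → Point
  route : Sym2 V → List Point
  pos_injective : Function.Injective pos
  route_ends : ∀ e ∈ G.edgeSet, ∃ (u v : V) (bends : List Point),
    e = s(u, v) ∧ route e = pos u :: (bends ++ [pos v])
  route_orthogonal : ∀ e ∈ G.edgeSet, IsOrthogonalPath (route e)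
  vertex_on_route : ∀ e ∈ G.edgeSet, ∀ w : V, pos w ∈ polylineCarrier (route e) → w ∈ e
  routes_meet : ∀ e ∈ G.edgeSet, ∀ e' ∈ G.edgeSet, e ≠ e' →
    ∀ x, x ∈ polylineCarrier (route e) → x ∈ polylineCarrier (route e') →
      ∃ w : V, w ∈ e ∧ w ∈ e' ∧ x = pos w

namespace OrthogonalDrawing

variable {V : Type*} {G : SimpleGraph V}

/-- The straight pieces of the drawn edges, each given by its two end points. -/
def pieces (Γ : OrthogonalDrawing G) : Set (Point × Point) :=
  {p | ∃ e ∈ G.edgeSet, [p.1, p.2] <:+: Γ.route e}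

/-- Two pieces are both horizontal or both vertical, and they have a common end point. -/
def Continues (p q : Point × Point) : Prop :=
  ((IsHorizontal p.1 p.2 ∧ IsHorizontal q.1 q.2) ∨ (IsVertical p.1 p.2 ∧ IsVertical q.1 q.2)) ∧
  (p.1 = q.1 ∨ p.1 = q.2 ∨ p.2 = q.1 ∨ p.2 = q.2)

/-- A segment (maximal line-segment) of the drawing: all the pieces that can be reached from some
piece through a chain of pieces, all horizontal or all vertical, in which consecutive pieces have a
common end point. -/
def IsMaxSegment (Γ : OrthogonalDrawing G) (S : Set (Point × Point)) : Prop :=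
  ∃ p ∈ Γ.pieces,
    S = {q | Relation.ReflTransGen (fun a b => b ∈ Γ.pieces ∧ Continues a b) p q}

/-- The vertex `v` lies on the segment `S`. -/
def LiesOn (Γ : OrthogonalDrawing G) (v : V) (S : Set (Point × Point)) : Prop :=
  ∃ q ∈ S, Γ.pos v ∈ segment ℝ q.1 q.2

/-- All vertices can be covered with (at most) `k` segments of the drawing. -/
def CoveredBy (Γ : OrthogonalDrawing G) (k : ℕ) : Prop :=
  ∃ C : Finset (Set (Point × Point)), C.card ≤ k ∧ (∀ S ∈ C, Γ.IsMaxSegment S) ∧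
    ∀ v : V, ∃ S ∈ C, Γ.LiesOn v S

end OrthogonalDrawing

/-! ### Outerplanar graphs -/

/-- `G` is outerplanar: its vertices can be placed on a circle (here: listed along the circle by
real parameters) so that no two edges, drawn as chords, cross. -/
def IsOuterplanar {V : Type*} (G : SimpleGraph V) : Prop :=
  ∃ f : V → ℝ, Function.Injective f ∧
    ∀ a b c d : V, G.Adj a b → G.Adj c d → ¬ (f a < f c ∧ f c < f b ∧ f b < f d)

/-! Sufficiency. A drawing is encoded by integers: vertices have distinct abscissae, every edge runs
vertically, then horizontally at a prescribed height, then vertically, and consecutive vertices of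
equal height are joined by a straight edge. All vertices of one height then lie on one segment, so
it suffices to use few heights (`Layout.coveredBy`). By induction over binary compositions, height
`0` and at most one further height per counted parallel composition are enough
(`SeriesParallel.exists_isDrawn`). A series composition glues along height `0` and pushes the other
heights of the second graph out of the way. A parallel composition turns one graph upside down and
moves the other below it, so that only the base line of the lower graph is a new height; a single
edge has no inner vertex and costs nothing. Degree three enters at a shared terminal, where one of
the two graphs has only one edge; this leaves room for directions that do not overlap.

Degree three also makes SPQ-trees almost binary: only a `P`-node at the root can have three
children. Then each child has one edge at each terminal, and cutting off the last edge of one child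
turns the whole graph into a series combination closed by that edge, with new terminals and no
additional count (`SeriesParallel.exists_reroot`).

Necessity for every count. If each edge has exactly one end in a set `R` of vertices of degree at
most three, a segment can continue through a vertex of `R` in only one way. Counting the links that
join the vertices outside `R` along segments gives at least `|Rᶜ| - |R|` segments
(`OrthogonalDrawing.card_compl_le_of_coveredBy`). In a chain of `k` four-cycles joined by two-edge
paths this difference is `k + 1`.

Necessity for adjacent terminals. A `P`-node without `Q`-node child gives two paths with inner
vertices between its terminals, and the rest of the graph gives a third; such a theta graph is not
outerplanar (`NoncrossingPlacement.false_of_theta`). So the count is `0`, and covering a vertex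
takes one segment. -/

/-! ### Noncrossing circular placements and theta graphs -/

/-- A placement of the vertices on a line (a circle cut open) in which no two edges cross. -/
def NoncrossingPlacement {V : Type*} (G : SimpleGraph V) (f : V → ℝ) : Prop :=
  Function.Injective f ∧
    ∀ a b c d : V, G.Adj a b → G.Adj c d → ¬ (f a < f c ∧ f c < f b ∧ f b < f d)

namespace NoncrossingPlacement

variable {V : Type*} {G : SimpleGraph V} {f : V → ℝ}

/-- If `d` were to the right of `b`, the chords would cross in the order `a c b d`; to the left of
`a`, in the order `d a c b`. -/
lemma between_of_adj (hf : NoncrossingPlacement G f) {a b c d : V} (hab : G.Adj a b)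
    (hcd : G.Adj c d) (hda : d ≠ a) (hdb : d ≠ b) (h : f a < f c ∧ f c < f b) :
    f a < f d ∧ f d < f b := by
  have h1 := hf.2 a b c d hab hcd
  have h2 := hf.2 d c a b hcd.symm hab
  have h3 : f d ≠ f a := fun e => hda (hf.1 e)
  have h4 : f d ≠ f b := fun e => hdb (hf.1 e)
  constructor
  · by_contra h5
    exact h2 ⟨lt_of_le_of_ne (not_lt.1 h5) h3, h.1, h.2⟩
  · by_contra h5
    exact h1 ⟨h.1, h.2, lt_of_le_of_ne (not_lt.1 h5) h4.symm⟩

/-- The circle can be cut open just before any given vertex. -/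
lemma exists_min [Finite V] (hf : NoncrossingPlacement G f) (p : V) :
    ∃ g : V → ℝ, NoncrossingPlacement G g ∧ ∀ v, v ≠ p → g p < g v := by
  obtain ⟨B, hB⟩ : ∃ B, ∀ v, |f v| < B := by
    obtain ⟨B, hB⟩ := (Set.finite_range fun v => |f v|).bddAbove
    exact ⟨B + 1, fun v => lt_of_le_of_lt (hB ⟨v, rfl⟩) (lt_add_one B)⟩
  have hB1 : ∀ v, f v < B := fun v => (abs_lt.1 (hB v)).2
  have hB2 : ∀ v, -B < f v := fun v => (abs_lt.1 (hB v)).1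
  -- All positions lie in `(-B, B)`, so the shift by `2 * B` moves everything before `p` behind all
  -- other vertices: a rotation of the circle.
  refine ⟨fun v => if f v < f p then f v + 2 * B else f v, ⟨?_, ?_⟩, ?_⟩
  · intro u v huv
    have := hB1 u; have := hB2 u; have := hB1 v; have := hB2 v
    apply hf.1
    simp only at huv
    split_ifs at huv <;> linarith
  · intro a b c d hab hcd
    have := hB1 a; have := hB2 a; have := hB1 b; have := hB2 b
    have := hB1 c; have := hB2 c; have := hB1 d; have := hB2 d
    -- A rotation changes the order of four points only cyclically; these are the four orders that
    -- may have become `a c b d`.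
    have h1 := hf.2 a b c d hab hcd
    have h2 := hf.2 c d b a hcd hab.symm
    have h3 := hf.2 b a d c hab.symm hcd.symm
    have h4 := hf.2 d c a b hcd.symm hab
    rintro ⟨e1, e2, e3⟩
    simp only at e1 e2 e3
    split_ifs at e1 e2 e3 with k1 k2 k3 k4
    all_goals first
      | exact h1 ⟨by linarith, by linarith, by linarith⟩
      | exact h2 ⟨by linarith, by linarith, by linarith⟩
      | exact h3 ⟨by linarith, by linarith, by linarith⟩
      | exact h4 ⟨by linarith, by linarith, by linarith⟩
  · intro v hv
    have h1 : f v ≠ f p := fun e => hv (hf.1 e)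
    have := hB1 p; have := hB2 v
    simp only [lt_irrefl, if_false]
    split_ifs with h
    · linarith
    · exact lt_of_le_of_ne (not_lt.1 h) h1.symm

end NoncrossingPlacement

/-- A property that is preserved along the edges of a chain holds at all its vertices or at none. -/
lemma List.IsChain.of_adj {V : Type*} {G : SimpleGraph V} {L : List V} (hL : L.IsChain G.Adj)
    {P : V → Prop} (hP : ∀ u ∈ L, ∀ v ∈ L, G.Adj u v → P u → P v) :
    ∀ u ∈ L, ∀ v ∈ L, P u → P v := by
  induction L with
  | nil => simp
  | cons a L ih =>
    cases L with
    | nil => simp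
    | cons b L =>
      rw [List.isChain_cons_cons] at hL
      have ih := ih hL.2 fun u hu v hv =>
        hP u (List.mem_cons_of_mem _ hu) v (List.mem_cons_of_mem _ hv)
      have hab := hP a (by simp) b (by simp) hL.1
      have hba := hP b (by simp) a (by simp) hL.1.symm
      intro u hu v hv h
      rcases List.mem_cons.1 hu with rfl | hu'
      · rcases List.mem_cons.1 hv with rfl | hv'
        · exact h
        · exact ih b (by simp) v hv' (hab h)
      · rcases List.mem_cons.1 hv with rfl | hv'
        · exact hba (ih u hu' b (by simp) h)
        · exact ih u hu' v hv' h

namespace NoncrossingPlacement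

variable {V : Type*} {G : SimpleGraph V} {f : V → ℝ}

/-- An edge separates no two vertices of a chain that avoids its ends. -/
lemma between_of_chain (hf : NoncrossingPlacement G f) {a b : V} (hab : G.Adj a b) {L : List V}
    (hL : L.IsChain G.Adj) (ha : a ∉ L) (hb : b ∉ L) {u v : V} (hu : u ∈ L) (hv : v ∈ L)
    (h : f a < f u ∧ f u < f b) : f a < f v ∧ f v < f b :=
  hL.of_adj (P := fun w => f a < f w ∧ f w < f b)
    (fun _ _ _ hw' hww' => hf.between_of_adj hab hww' (fun e => ha (e ▸ hw'))
      (fun e => hb (e ▸ hw'))) u hu v hv h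

/-- A chain that has vertices before and after a given position has an edge across it. -/
lemma exists_edge_across {x : ℝ} {L : List V} (hL : L.IsChain G.Adj) {u v : V} (hu : u ∈ L)
    (hv : v ∈ L) (h1 : f u < x) (h2 : x < f v) (hx : ∀ w ∈ L, f w ≠ x) :
    ∃ a ∈ L, ∃ b ∈ L, G.Adj a b ∧ f a < x ∧ x < f b := by
  by_contra hcon
  push Not at hcon
  have := hL.of_adj (P := fun w => f w < x) (fun a ha b hb hab h =>
    lt_of_le_of_ne (hcon a ha b hb hab h) (hx b hb)) u hu v hv h1
  linarith

/-- Two disjoint chains inside the same arc of a circle cannot both join the ends of the arc. -/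
lemma false_of_same_arc (hf : NoncrossingPlacement G f) {l l' m m' : List V}
    (hm : m.IsChain G.Adj) (hm' : m'.IsChain G.Adj) {p q : V}
    (hl : ∀ x ∈ l, x ∈ m) (hl' : ∀ x ∈ l', x ∈ m') (hp : p ∈ m) (hq : q ∈ m')
    (hdisj : ∀ x ∈ m, x ∉ m') (hlow : ∀ x ∈ l', f p < f x)
    (hhigh : (∀ x ∈ m, f x < f q) ∨ (∀ x ∈ m, f q ≤ f x))
    {u x : V} (hu : u ∈ l) (hx : x ∈ l') (hxu : f x < f u) : False := by
  -- An edge `ab` of the first chain passes over `x`. The second chain avoids `a` and `b`, so its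
  -- vertex `q` is also under `ab`, while `hhigh` puts the first chain entirely on one side of `q`.
  obtain ⟨a, ha, b, hb, hab, h1, h2⟩ := exists_edge_across (f := f) hm hp (hl u hu) (hlow x hx) hxu
    (fun w hw e => hdisj w hw (hf.1 e ▸ hl' x hx))
  have := hf.between_of_chain hab hm' (hdisj a ha) (hdisj b hb) (hl' x hx) hq ⟨h1, h2⟩
  rcases hhigh with h | h
  · have := h b hb; linarith
  · have := h a ha; linarith

/-- A graph with a noncrossing placement contains no three internally disjoint paths with at least
two edges each that join the same two vertices. -/
theorem false_of_theta [Finite V] (hf : NoncrossingPlacement G f) {p q : V} (hpq : p ≠ q)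
    (l : Fin 3 → List V) (hne : ∀ i, l i ≠ [])
    (hc : ∀ i, (p :: (l i ++ [q])).IsChain G.Adj)
    (hdisj : ∀ i j, i ≠ j → ∀ x ∈ l i, x ∉ l j) (hp : ∀ i, p ∉ l i) (hq : ∀ i, q ∉ l i) :
    False := by
  obtain ⟨g, hg, hmin⟩ := hf.exists_min p
  have hcq : ∀ i, (l i ++ [q]).IsChain G.Adj := fun i => (hc i).tail
  have hcp : ∀ i, (p :: l i).IsChain G.Adj := fun i => by
    have := hc i
    rw [← List.cons_append] at this
    exact this.left_of_append
  have hcl : ∀ i, (l i).IsChain G.Adj := fun i => (hcp i).tail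
  have hpmin : ∀ i, ∀ x ∈ l i, g p < g x := fun i x hx => hmin x (fun e => hp i (e ▸ hx))
  have hqne : ∀ i, ∀ x ∈ l i, g x ≠ g q := fun i x hx e => hq i (hg.1 e ▸ hx)
  have hnext : ∀ i : Fin 3, i ≠ i + 1 := by decide
  -- The inner vertices of a path stay on one of the two arcs between `p` and `q`: an edge across
  -- `q` would separate `q` from `p`, but another path joins these and avoids that edge.
  have hside : ∀ i, (∀ x ∈ l i, g x < g q) ∨ ∀ x ∈ l i, g q < g x := by
    intro i
    by_contra hcon
    push Not at hcon
    obtain ⟨⟨v, hv, hvq⟩, ⟨u, hu, huq⟩⟩ := hcon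
    obtain ⟨a, ha, b, hb, hab, h1, h2⟩ := exists_edge_across (f := g) (hcl i) hu hv
      (lt_of_le_of_ne huq (hqne i u hu)) (lt_of_le_of_ne hvq (hqne i v hv).symm) (hqne i)
    have key : ∀ w ∈ l i, w ∉ p :: (l (i + 1) ++ [q]) := by
      intro w hw
      simp only [List.mem_cons, List.mem_append, List.not_mem_nil, or_false, not_or]
      exact ⟨fun e => hp i (e ▸ hw), hdisj _ _ (hnext i) w hw, fun e => hq i (e ▸ hw)⟩
    have := hg.between_of_chain hab (hc (i + 1)) (key a ha) (key b hb) (u := q) (v := p)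
      (by simp) (by simp) ⟨h1, h2⟩
    have := hpmin i a ha
    linarith
  -- On the arc before `q`, the first path is extended to `p` and the second to `q`; on the arc
  -- behind `q` the two terminals exchange roles, `p` being minimal.
  have hmain : ∀ i j, i ≠ j → ((∀ x ∈ l i, g x < g q) ∧ (∀ x ∈ l j, g x < g q) ∨
      (∀ x ∈ l i, g q < g x) ∧ (∀ x ∈ l j, g q < g x)) → ∀ u ∈ l i, ∀ x ∈ l j, g x < g u → False := by
    intro i j hij h u hu x hx hxu
    rcases h with h | h
    · refine hg.false_of_same_arc (hcp i) (hcq j) (l := l i) (l' := l j) (p := p) (q := q)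
        (fun x hx => by simp [hx]) (fun x hx => by simp [hx]) (by simp) (by simp) ?_ (hpmin j)
        (Or.inl ?_) hu hx hxu
      · intro w hw hw'
        rcases List.mem_cons.1 hw with rfl | hw
        · rcases List.mem_append.1 hw' with hw' | hw'
          · exact hp j hw'
          · exact hpq (by simpa using hw')
        · rcases List.mem_append.1 hw' with hw' | hw'
          · exact hdisj i j hij w hw hw'
          · exact hq i (by simp at hw'; exact hw' ▸ hw)
      · intro w hw
        rcases List.mem_cons.1 hw with rfl | hw
        · exact hmin q hpq.symm
        · exact h.1 w hw
    · refine hg.false_of_same_arc (hcq i) (hcp j) (l := l i) (l' := l j) (p := q) (q := p)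
        (fun x hx => by simp [hx]) (fun x hx => by simp [hx]) (by simp) (by simp) ?_ h.2
        (Or.inr ?_) hu hx hxu
      · intro w hw hw'
        rcases List.mem_cons.1 hw' with rfl | hw'
        · rcases List.mem_append.1 hw with hw | hw
          · exact hp i hw
          · exact hpq (by simpa using hw)
        · rcases List.mem_append.1 hw with hw | hw
          · exact hdisj i j hij w hw hw'
          · exact hq j (by simp at hw; exact hw ▸ hw')
      · intro w hw
        by_cases e : w = p
        · rw [e]
        · exact (hmin w e).le
  have hpair : ∀ i j, i ≠ j → ¬ ((∀ x ∈ l i, g x < g q) ∧ (∀ x ∈ l j, g x < g q) ∨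
      (∀ x ∈ l i, g q < g x) ∧ (∀ x ∈ l j, g q < g x)) := by
    intro i j hij h
    obtain ⟨u, hu⟩ := List.exists_mem_of_ne_nil _ (hne i)
    obtain ⟨x, hx⟩ := List.exists_mem_of_ne_nil _ (hne j)
    rcases lt_trichotomy (g x) (g u) with hlt | heq | hlt
    · exact hmain i j hij h u hu x hx hlt
    · exact hdisj i j hij u hu (hg.1 heq ▸ hx)
    · exact hmain j i hij.symm (by tauto) x hx u hu hlt
  -- Pigeonhole: two of the three paths share one of the two arcs.
  have h01 := hpair 0 1 (by decide)
  have h02 := hpair 0 2 (by decide)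
  have h12 := hpair 1 2 (by decide)
  have h0 := hside 0
  have h1 := hside 1
  have h2 := hside 2
  tauto

end NoncrossingPlacement

/-! ### Basic facts on decompositions -/

namespace SPQTree

variable {V : Type*} {G : SimpleGraph V}

/-- The side conditions on the parts of a series combination. -/
structure IsSeries {n : ℕ} (K : Fin n → G.Subgraph) (c : Fin (n + 1) → V) : Prop where
  left_mem : ∀ i, c i.castSucc ∈ (K i).verts
  right_mem : ∀ i, c i.succ ∈ (K i).verts
  ne : ∀ i : Fin n, c i.castSucc ≠ c i.succ
  inter : ∀ i j : Fin n, (i : ℕ) + 1 = j → (K i).verts ∩ (K j).verts = {c j.castSucc}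
  disj : ∀ i j : Fin n, (i : ℕ) + 1 < j → Disjoint (K i).verts (K j).verts

lemma IsSeries.eq_of_mem {n : ℕ} {K : Fin n → G.Subgraph} {c : Fin (n + 1) → V}
    (h : IsSeries K c) {i j : Fin n} (hij : i < j) {x : V} (hi : x ∈ (K i).verts)
    (hj : x ∈ (K j).verts) : (i : ℕ) + 1 = j ∧ x = c j.castSucc := by
  have hij' : (i : ℕ) < j := hij
  rcases (by omega : (i : ℕ) + 1 = j ∨ (i : ℕ) + 1 < j) with e | e
  · have : x ∈ (K i).verts ∩ (K j).verts := ⟨hi, hj⟩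
    rw [h.inter i j e] at this
    exact ⟨e, this⟩
  · exact absurd hj (Set.disjoint_left.1 (h.disj i j e) hi)

lemma IsSeries.castSucc_notMem {n : ℕ} {K : Fin n → G.Subgraph} {c : Fin (n + 1) → V}
    (h : IsSeries K c) {i j : Fin n} (hij : i < j) : c i.castSucc ∉ (K j).verts := by
  intro hj
  obtain ⟨e, e'⟩ := h.eq_of_mem hij (h.left_mem i) hj
  have : j.castSucc = i.succ := by ext; simp [e]
  exact h.ne i (e'.trans (by rw [this]))

lemma IsSeries.succ_notMem {n : ℕ} {K : Fin n → G.Subgraph} {c : Fin (n + 1) → V}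
    (h : IsSeries K c) {i j : Fin n} (hij : i < j) : c j.succ ∉ (K i).verts := by
  intro hi
  obtain ⟨e, e'⟩ := h.eq_of_mem hij hi (h.right_mem j)
  exact h.ne j e'.symm

lemma Decomposes.terminals {T : SPQTree} {H : G.Subgraph} {s t : V} (h : T.Decomposes H s t) :
    s ∈ H.verts ∧ t ∈ H.verts ∧ s ≠ t := by
  induction T generalizing H s t with
  | Q =>
    obtain ⟨h, rfl⟩ := h
    exact ⟨by simp, by simp, h.ne⟩
  | S n child ih =>
    obtain ⟨hn, K, c, rfl, rfl, rfl, hK, h1, h2⟩ := h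
    have hS : IsSeries K c := ⟨fun i => (ih i (hK i)).1, fun i => (ih i (hK i)).2.1,
      fun i => (ih i (hK i)).2.2, h1, h2⟩
    obtain ⟨n, rfl⟩ : ∃ m, n = m + 2 := ⟨n - 2, by omega⟩
    have ht : c (Fin.last (n + 2)) ∈ (K (Fin.last (n + 1))).verts := hS.right_mem (Fin.last (n + 1))
    refine ⟨?_, ?_, ?_⟩
    · simp only [SimpleGraph.Subgraph.verts_iSup, Set.mem_iUnion]
      exact ⟨0, hS.left_mem 0⟩
    · simp only [SimpleGraph.Subgraph.verts_iSup, Set.mem_iUnion]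
      exact ⟨Fin.last (n + 1), ht⟩
    · intro e
      exact hS.castSucc_notMem (i := 0) (j := Fin.last (n + 1)) (Fin.lt_def.2 (by simp)) (e ▸ ht)
  | P n child ih =>
    obtain ⟨hn, K, rfl, hK, h1⟩ := h
    have := ih ⟨0, by omega⟩ (hK ⟨0, by omega⟩)
    refine ⟨?_, ?_, this.2.2⟩
    · simp only [SimpleGraph.Subgraph.verts_iSup, Set.mem_iUnion]
      exact ⟨_, this.1⟩
    · simp only [SimpleGraph.Subgraph.verts_iSup, Set.mem_iUnion]
      exact ⟨_, this.2.1⟩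

lemma IsSeries.of_decomposes {n : ℕ} {child : Fin n → SPQTree} {K : Fin n → G.Subgraph}
    {c : Fin (n + 1) → V} (hK : ∀ i, (child i).Decomposes (K i) (c i.castSucc) (c i.succ))
    (h1 : ∀ i j : Fin n, (i : ℕ) + 1 = j → (K i).verts ∩ (K j).verts = {c j.castSucc})
    (h2 : ∀ i j : Fin n, (i : ℕ) + 1 < j → Disjoint (K i).verts (K j).verts) : IsSeries K c :=
  ⟨fun i => (hK i).terminals.1, fun i => (hK i).terminals.2.1, fun i => (hK i).terminals.2.2, h1, h2⟩

/-- The terminals of a series combination are not joined by one of its edges. -/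
lemma IsSeries.not_adj {n : ℕ} {K : Fin n → G.Subgraph} {c : Fin (n + 1) → V}
    (h : IsSeries K c) (hn : 2 ≤ n) : ¬ (⨆ i, K i).Adj (c 0) (c (Fin.last n)) := by
  obtain ⟨n, rfl⟩ : ∃ m, n = m + 2 := ⟨n - 2, by omega⟩
  simp only [SimpleGraph.Subgraph.iSup_adj, not_exists]
  intro i hi
  -- As there are at least two parts, part `0` misses the last terminal, and every other part misses
  -- the first one.
  by_cases h0 : i = 0
  · exact h.succ_notMem (i := i) (j := Fin.last (n + 1)) (h0 ▸ Fin.lt_def.2 (by simp))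
      (by simpa using hi.snd_mem)
  · exact h.castSucc_notMem (i := 0) (j := i) (Fin.pos_iff_ne_zero.2 h0) (by simpa using hi.fst_mem)

/-- Paths through consecutive parts of a series combination. -/
lemma IsSeries.exists_chain {n : ℕ} {K : Fin n → G.Subgraph} {c : Fin (n + 1) → V}
    (h : IsSeries K c)
    (hpath : ∀ i : Fin n, ∃ l : List V, (c i.castSucc :: (l ++ [c i.succ])).IsChain G.Adj ∧
      ∀ x ∈ l, x ∈ (K i).verts ∧ x ≠ c i.castSucc ∧ x ≠ c i.succ) (a : Fin n) (b : ℕ)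
    (hab : (a : ℕ) ≤ b) (hb : b < n) :
    c a.castSucc ≠ c (Fin.succ ⟨b, hb⟩) ∧
    ∃ l : List V, (c a.castSucc :: (l ++ [c (Fin.succ ⟨b, hb⟩)])).IsChain G.Adj ∧
      (∀ x ∈ l, x ≠ c a.castSucc ∧ x ≠ c (Fin.succ ⟨b, hb⟩) ∧
        ∃ i : Fin n, a ≤ i ∧ (i : ℕ) ≤ b ∧ x ∈ (K i).verts) ∧
      ((a : ℕ) < b → l ≠ []) := by
  induction b with
  | zero =>
    have : a = ⟨0, hb⟩ := by ext; simp only; omega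
    subst this
    obtain ⟨l, hl, hl'⟩ := hpath ⟨0, hb⟩
    exact ⟨h.ne _, l, hl, fun x hx => ⟨(hl' x hx).2.1, (hl' x hx).2.2, _, le_rfl, le_rfl,
      (hl' x hx).1⟩, fun h => absurd h (by simp)⟩
  | succ b ih =>
    by_cases e : (a : ℕ) = b + 1
    · have : a = ⟨b + 1, hb⟩ := by ext; simpa using e
      subst this
      obtain ⟨l, hl, hl'⟩ := hpath ⟨b + 1, hb⟩
      exact ⟨h.ne _, l, hl, fun x hx => ⟨(hl' x hx).2.1, (hl' x hx).2.2, _, le_rfl, le_rfl,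
        (hl' x hx).1⟩, fun h => absurd h (by simp)⟩
    · obtain ⟨h0, l, hl, hl', -⟩ := ih (by omega) (by omega)
      obtain ⟨m, hm, hm'⟩ := hpath ⟨b + 1, hb⟩
      have hlt : a < ⟨b + 1, hb⟩ := by rw [Fin.lt_def]; simp only; omega
      have hc : (Fin.castSucc ⟨b + 1, hb⟩ : Fin (n + 1)) = Fin.succ ⟨b, by omega⟩ := by
        ext; simp
      have ha := h.castSucc_notMem hlt
      refine ⟨fun e => ha (e ▸ h.right_mem _), l ++ c (Fin.succ ⟨b, by omega⟩) :: m, ?_, ?_,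
        by simp⟩
      · rw [hc] at hm
        have := (List.isChain_split (l₁ := c a.castSucc :: l)).2 ⟨by simpa using hl, hm⟩
        simpa using this
      · intro x hx
        rcases List.mem_append.1 hx with hx | hx
        · obtain ⟨q1, q2, i, q3, q4, q5⟩ := hl' x hx
          refine ⟨q1, ?_, i, q3, by omega, q5⟩
          rintro rfl
          exact h.succ_notMem (i := i) (j := ⟨b + 1, hb⟩) (by rw [Fin.lt_def]; simp only; omega) q5
        · rcases List.mem_cons.1 hx with rfl | hx
          · refine ⟨h0.symm, ?_, ⟨b, by omega⟩, by rw [Fin.le_def]; simp only; omega, by simp,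
              h.right_mem _⟩
            rw [← hc]
            exact h.ne _
          · obtain ⟨q1, q2, q3⟩ := hm' x hx
            exact ⟨fun e => ha (e ▸ q1), q3, _, hlt.le, le_rfl, q1⟩

/-- A series-parallel graph contains a path between its terminals. -/
lemma Decomposes.exists_chain {T : SPQTree} {H : G.Subgraph} {s t : V} (h : T.Decomposes H s t) :
    ∃ l : List V, (s :: (l ++ [t])).IsChain G.Adj ∧
      (∀ x ∈ l, x ∈ H.verts ∧ x ≠ s ∧ x ≠ t) ∧ (T.IsS → l ≠ []) := by
  induction T generalizing H s t with
  | Q =>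
    obtain ⟨h, rfl⟩ := h
    exact ⟨[], by simpa using h, by simp, fun h => h.elim⟩
  | S n child ih =>
    obtain ⟨hn, K, c, rfl, rfl, rfl, hK, h1, h2⟩ := h
    have hS := IsSeries.of_decomposes hK h1 h2
    obtain ⟨n, rfl⟩ : ∃ m, n = m + 2 := ⟨n - 2, by omega⟩
    obtain ⟨-, l, hl, hl', hne⟩ := hS.exists_chain (fun i => by
      obtain ⟨l, hl, hl', -⟩ := ih i (hK i)
      exact ⟨l, hl, hl'⟩) 0 (n + 1) (by simp) (by omega)
    refine ⟨l, hl, fun x hx => ?_, fun _ => hne (by simp)⟩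
    obtain ⟨q1, q2, i, -, -, q3⟩ := hl' x hx
    refine ⟨?_, q1, q2⟩
    simp only [SimpleGraph.Subgraph.verts_iSup, Set.mem_iUnion]
    exact ⟨i, q3⟩
  | P n child ih =>
    obtain ⟨hn, K, rfl, hK, h1⟩ := h
    obtain ⟨l, hl, hl', -⟩ := ih ⟨0, by omega⟩ (hK ⟨0, by omega⟩)
    refine ⟨l, hl, fun x hx => ⟨?_, (hl' x hx).2⟩, fun h => h.elim⟩
    simp only [SimpleGraph.Subgraph.verts_iSup, Set.mem_iUnion]
    exact ⟨_, (hl' x hx).1⟩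

/-- In an outerplanar graph, a reduced part that is closed to a cycle by an outer path contributes
no `P`-node without a `Q`-node child. -/
theorem Decomposes.numPStar_eq_zero [Finite V] {f : V → ℝ} (hf : NoncrossingPlacement G f)
    {T : SPQTree} {H : G.Subgraph} {s t : V} (h : T.Decomposes H s t) (hred : T.Reduced)
    {z : List V} (hz : (t :: (z ++ [s])).IsChain G.Adj) (hzH : ∀ x ∈ z, x ∉ H.verts)
    (hzP : T.IsP → z ≠ []) : T.numPStar = 0 := by
  induction T generalizing H s t z with
  | Q => rfl
  | S n child ih =>
    obtain ⟨hn, K, c, rfl, rfl, rfl, hK, h1, h2⟩ := h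
    have hS := IsSeries.of_decomposes hK h1 h2
    have hpath : ∀ i : Fin n, ∃ l : List V, (c i.castSucc :: (l ++ [c i.succ])).IsChain G.Adj ∧
        ∀ x ∈ l, x ∈ (K i).verts ∧ x ≠ c i.castSucc ∧ x ≠ c i.succ := fun i => by
      obtain ⟨l, hl, hl', -⟩ := (hK i).exists_chain
      exact ⟨l, hl, hl'⟩
    obtain ⟨n, rfl⟩ : ∃ m, n = m + 2 := ⟨n - 2, by omega⟩
    simp only [numPStar, Finset.sum_eq_zero_iff, Finset.mem_univ, forall_const]
    intro j
    -- `r` is the path through the parts behind part `j`. Writing the same list with its last vertex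
    -- split off exposes the place where `z` is attached. `B` and `l` below do this for the parts in
    -- front of `j`.
    obtain ⟨A, r, hAr, hA, hr, hrne⟩ : ∃ A r : List V, c j.succ :: r = A ++ [c (Fin.last (n + 2))] ∧
        (c j.succ :: r).IsChain G.Adj ∧ (∀ x ∈ r, x ∉ (K j).verts) ∧
        (j ≠ Fin.last (n + 1) → r ≠ []) := by
      by_cases hj : j = Fin.last (n + 1)
      · subst hj
        exact ⟨[], [], by simp, by simp, by simp, by simp⟩
      · have hj' : (j : ℕ) + 1 < n + 2 := by
          have := j.2
          have : (j : ℕ) ≠ n + 1 := fun e => hj (by ext; simpa using e)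
          omega
        obtain ⟨-, l, hl, hl', -⟩ := hS.exists_chain hpath ⟨j + 1, hj'⟩ (n + 1) (by simp; omega)
          (by omega)
        have e : c (Fin.castSucc ⟨j + 1, hj'⟩) = c j.succ := rfl
        have hjl : j < Fin.last (n + 1) := lt_of_le_of_ne (Fin.le_last j) hj
        rw [e] at hl hl'
        refine ⟨c j.succ :: l, l ++ [c (Fin.last (n + 2))], by simp, hl, ?_, by simp⟩
        intro x hx hxj
        rcases List.mem_append.1 hx with hx | hx
        · obtain ⟨q1, q2, i, q3, -, q4⟩ := hl' x hx
          have hji : j < i := lt_of_lt_of_le (by rw [Fin.lt_def]; simp) q3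
          obtain ⟨q5, q6⟩ := hS.eq_of_mem hji hxj q4
          apply q1
          rw [q6]
          congr 1
          ext
          simp [q5]
        · simp only [List.mem_singleton] at hx
          subst hx
          exact hS.succ_notMem hjl hxj
    obtain ⟨B, l, hBl, hB, hl, hlne⟩ : ∃ B l : List V, l ++ [c j.castSucc] = c 0 :: B ∧
        (l ++ [c j.castSucc]).IsChain G.Adj ∧ (∀ x ∈ l, x ∉ (K j).verts) ∧
        (j ≠ 0 → l ≠ []) := by
      by_cases hj : j = 0
      · subst hj
        exact ⟨[], [], by simp, by simp, by simp, by simp⟩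
      · have hj' : 0 < (j : ℕ) := Nat.pos_of_ne_zero fun e => hj (by ext; simpa using e)
        obtain ⟨-, l, hl, hl', -⟩ := hS.exists_chain hpath 0 (j - 1) (by simp) (by omega)
        have e : c (Fin.succ ⟨j - 1, by omega⟩) = c j.castSucc := by
          congr 1; ext; simp; omega
        rw [e] at hl hl'
        refine ⟨l ++ [c j.castSucc], c 0 :: l, by simp, by simpa using hl, ?_, by simp⟩
        intro x hx hxj
        rcases List.mem_cons.1 hx with rfl | hx
        · exact hS.castSucc_notMem (i := 0) (j := j) hj' hxj
        · obtain ⟨q1, q2, i, q3, q4, q5⟩ := hl' x hx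
          have hij : i < j := by rw [Fin.lt_def]; omega
          exact q2 (hS.eq_of_mem hij q5 hxj).2
    -- The outer path of part `j` passes the later parts, then `z`, then the earlier parts.
    have hz' : (c j.succ :: ((r ++ z ++ l) ++ [c j.castSucc])).IsChain G.Adj := by
      have e : c j.succ :: ((r ++ z ++ l) ++ [c j.castSucc]) =
          A ++ c (Fin.last (n + 2)) :: (z ++ c 0 :: B) := by
        calc _ = (c j.succ :: r) ++ z ++ (l ++ [c j.castSucc]) := by simp
          _ = _ := by rw [hAr, hBl]; simp
      rw [e]
      rw [hAr] at hA
      rw [hBl] at hB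
      refine List.isChain_split.2 ⟨hA, ?_⟩
      rw [← List.cons_append]
      exact List.isChain_split.2 ⟨by simpa using hz, hB⟩
    refine ih j (hK j) (hred j).2 hz' ?_ fun _ => ?_
    · intro x hx
      simp only [List.mem_append] at hx
      rcases hx with (hx | hx) | hx
      · exact hr x hx
      · intro hxj
        apply hzH x hx
        simp only [SimpleGraph.Subgraph.verts_iSup, Set.mem_iUnion]
        exact ⟨j, hxj⟩
      · exact hl x hx
    -- With at least two parts, a terminal of the whole series combination is an inner vertex of the
    -- new outer path, even if `z` is empty.
    · by_cases hj : j = 0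
      · have := hrne (by subst hj; intro e; simpa using congrArg Fin.val e)
        simp [this]
      · simp [hlne hj]
  | P n child ih =>
    have hst := h.terminals
    obtain ⟨hn, K, rfl, hK, h1⟩ := h
    have hsub : ∀ i, ∀ x ∈ (K i).verts, x ∈ (⨆ i, K i).verts := fun i x hx => by
      simp only [SimpleGraph.Subgraph.verts_iSup, Set.mem_iUnion]
      exact ⟨i, hx⟩
    have hzne := hzP trivial
    -- Otherwise reducedness makes all children `S`-nodes. The paths through two of them have inner
    -- vertices, and together with `z` they form a theta graph.
    have hQ : ∃ i, child i = Q := by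
      by_contra hcon
      push Not at hcon
      have hchildS : ∀ i, (child i).IsS := fun i => by
        have h1 := (hred i).1
        have h2 := hcon i
        cases hci : child i with
        | Q => exact absurd hci h2
        | S => trivial
        | P => rw [hci] at h1; exact absurd trivial h1
      obtain ⟨l0, c0, i0, e0⟩ := (hK ⟨0, by omega⟩).exists_chain
      obtain ⟨l1, c1, i1, e1⟩ := (hK ⟨1, by omega⟩).exists_chain
      have hinter := (h1 ⟨0, by omega⟩ ⟨1, by omega⟩ (by simp)).1
      have h01 : ∀ x ∈ l0, x ∉ l1 := fun x hx hx' => by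
        have : x ∈ (K ⟨0, by omega⟩).verts ∩ (K ⟨1, by omega⟩).verts := ⟨(i0 x hx).1, (i1 x hx').1⟩
        rw [hinter] at this
        rcases this with rfl | rfl
        · exact (i0 _ hx).2.1 rfl
        · exact (i0 _ hx).2.2 rfl
      have h0z : ∀ x ∈ l0, x ∉ z := fun x hx hx' => hzH x hx' (hsub _ x (i0 x hx).1)
      have h1z : ∀ x ∈ l1, x ∉ z := fun x hx hx' => hzH x hx' (hsub _ x (i1 x hx).1)
      have hsz : s ∉ z := fun h => hzH s h hst.1
      have htz : t ∉ z := fun h => hzH t h hst.2.1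
      have hzr : (s :: (z.reverse ++ [t])).IsChain G.Adj := by
        have e : s :: (z.reverse ++ [t]) = (t :: (z ++ [s])).reverse := by simp
        rw [e, List.isChain_reverse]
        exact hz.imp fun _ _ h => SimpleGraph.Adj.symm h
      refine hf.false_of_theta hst.2.2 ![l0, l1, z.reverse] ?_ ?_ ?_ ?_ ?_
      · intro i
        fin_cases i
        · exact e0 (hchildS _)
        · exact e1 (hchildS _)
        · simpa using hzne
      · intro i
        fin_cases i
        · exact c0
        · exact c1
        · exact hzr
      · intro i j hij x hx hx'
        fin_cases i <;> fin_cases j <;> simp at hij hx hx'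
        · exact h01 x hx hx'
        · exact h0z x hx hx'
        · exact h01 x hx' hx
        · exact h1z x hx hx'
        · exact h0z x hx' hx
        · exact h1z x hx' hx
      · intro i
        fin_cases i
        · exact fun h => (i0 _ h).2.1 rfl
        · exact fun h => (i1 _ h).2.1 rfl
        · simpa using hsz
      · intro i
        fin_cases i
        · exact fun h => (i0 _ h).2.2 rfl
        · exact fun h => (i1 _ h).2.2 rfl
        · simpa using htz
    simp only [numPStar, if_pos hQ, zero_add, Finset.sum_eq_zero_iff, Finset.mem_univ, forall_const]
    intro i
    exact ih i (hK i) (hred i).2 hz (fun x hx hxi => hzH x hx (hsub i x hxi)) fun _ => hzne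

/-- In an outerplanar graph with adjacent terminals, every `P`-node of a reduced SPQ-tree has a
`Q`-node child. -/
theorem IsTreeOf.numPStar_eq_zero [Finite V] {T : SPQTree} {s t : V} (h : T.IsTreeOf G s t)
    (hred : T.Reduced) (hG : IsOuterplanar G) (hst : G.Adj s t) : T.numPStar = 0 := by
  obtain ⟨f, hf⟩ := hG
  have hf : NoncrossingPlacement G f := hf
  have htop : (⊤ : G.Subgraph).Adj s t := by simpa using hst
  cases T with
  | Q => rfl
  | S n child =>
    exfalso
    obtain ⟨hn, K, c, rfl, rfl, hH, hK, h1, h2⟩ := h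
    rw [hH] at htop
    exact (IsSeries.of_decomposes hK h1 h2).not_adj hn htop
  | P n child =>
    obtain ⟨hn, K, hH, hK, h1⟩ := h
    -- The child that contains the edge `st` is no `S`-node, since a series combination does not
    -- join its terminals by an edge, and no `P`-node, by reducedness.
    have hQ : ∃ i, child i = Q := by
      rw [hH, SimpleGraph.Subgraph.iSup_adj] at htop
      obtain ⟨i, hi⟩ := htop
      refine ⟨i, ?_⟩
      have hi1 := hK i
      have hi2 := (hred i).1
      cases hci : child i with
      | Q => rfl
      | S =>
        rw [hci] at hi1
        obtain ⟨hn, K', c, rfl, rfl, hH', hK', h1', h2'⟩ := hi1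
        rw [hH'] at hi
        exact absurd hi ((IsSeries.of_decomposes hK' h1' h2').not_adj hn)
      | P => rw [hci] at hi2; exact absurd trivial hi2
    simp only [numPStar, if_pos hQ, zero_add, Finset.sum_eq_zero_iff, Finset.mem_univ, forall_const]
    intro i
    -- The edge `ts` closes each child to a cycle; an outer path without inner vertices is good
    -- enough because no child is a `P`-node.
    exact (hK i).numPStar_eq_zero hf (hred i).2 (z := []) (by simpa using hst.symm) (by simp)
      fun hP => absurd hP (hred i).1

end SPQTree

namespace OrthogonalDrawing

lemma CoveredBy.one_le {V : Type*} [Nonempty V] {G : SimpleGraph V} {Γ : OrthogonalDrawing G}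
    {m : ℕ} (h : Γ.CoveredBy m) : 1 ≤ m := by
  obtain ⟨C, hC, -, h⟩ := h
  obtain ⟨S, hS, -⟩ := h (Classical.arbitrary V)
  exact (Finset.card_pos.2 ⟨S, hS⟩).trans_le hC

end OrthogonalDrawing

/-! ### Pieces of orthogonal paths -/

lemma left_mem_polylineCarrier (a : Point) (l : List Point) : a ∈ polylineCarrier (a :: l) := by
  cases l with
  | nil => simp [polylineCarrier]
  | cons b l => exact Or.inl (left_mem_segment ℝ a b)

lemma mem_polylineCarrier {l : List Point} {x : Point} (h : x ∈ l) : x ∈ polylineCarrier l := by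
  induction l with
  | nil => simp at h
  | cons a l ih =>
    rcases List.mem_cons.1 h with rfl | h
    · exact left_mem_polylineCarrier _ _
    · cases l with
      | nil => simp at h
      | cons b l => exact Or.inr (ih h)

lemma pair_infix_cons {a b p q : Point} {l : List Point} :
    [p, q] <:+: a :: b :: l ↔ (p = a ∧ q = b) ∨ [p, q] <:+: b :: l := by
  rw [List.infix_cons_iff]
  simp

lemma not_pair_infix_singleton {a p q : Point} : ¬ [p, q] <:+: [a] := fun h => by
  simpa using h.length_le

lemma segment_subset_polylineCarrier {p q : Point} {l : List Point} (h : [p, q] <:+: l) :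
    segment ℝ p q ⊆ polylineCarrier l := by
  induction l with
  | nil => simpa using h.length_le
  | cons a l ih =>
    cases l with
    | nil => exact absurd h not_pair_infix_singleton
    | cons b l =>
      rcases pair_infix_cons.1 h with ⟨rfl, rfl⟩ | h
      · exact Set.subset_union_left
      · exact (ih h).trans Set.subset_union_right

namespace IsOrthogonalPath

lemma piece {p q : Point} {l : List Point} (hl : IsOrthogonalPath l) (h : [p, q] <:+: l) :
    p ≠ q ∧ (IsHorizontal p q ∨ IsVertical p q) := by
  induction l with
  | nil => simpa using h.length_le
  | cons a l ih =>
    cases l with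
    | nil => exact absurd h not_pair_infix_singleton
    | cons b l =>
      rcases pair_infix_cons.1 h with ⟨rfl, rfl⟩ | h
      · exact ⟨hl.1, hl.2.1⟩
      · exact ih hl.2.2.2 h

lemma head_notMem {a b : Point} {l : List Point} (hl : IsOrthogonalPath (a :: b :: l)) :
    a ∉ polylineCarrier (b :: l) := fun h =>
  hl.1 (by simpa using hl.2.2.1 ⟨left_mem_segment ℝ a b, h⟩)

/-- The polyline is simple and does not return to its first corner, so only its first piece touches
it. The next lemma is the analogue for the last corner. -/
lemma piece_at_head {a b p q : Point} {l : List Point} (hl : IsOrthogonalPath (a :: b :: l))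
    (h : [p, q] <:+: a :: b :: l) (ha : p = a ∨ q = a) : p = a ∧ q = b := by
  rcases pair_infix_cons.1 h with h | h
  · exact h
  · have hs := segment_subset_polylineCarrier h
    exfalso
    rcases ha with rfl | rfl
    · exact hl.head_notMem (hs (left_mem_segment ℝ _ _))
    · exact hl.head_notMem (hs (right_mem_segment ℝ _ _))

lemma piece_at_last {z p q p' q' : Point} {l : List Point} (hl : IsOrthogonalPath (l ++ [z]))
    (h : [p, q] <:+: l ++ [z]) (hz : p = z ∨ q = z)
    (h' : [p', q'] <:+: l ++ [z]) (hz' : p' = z ∨ q' = z) : p = p' ∧ q = q' := by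
  induction l with
  | nil => exact absurd h not_pair_infix_singleton
  | cons a l ih =>
    cases l with
    | nil =>
      rcases pair_infix_cons.1 h with ⟨rfl, rfl⟩ | h
      · rcases pair_infix_cons.1 h' with ⟨rfl, rfl⟩ | h'
        · exact ⟨rfl, rfl⟩
        · exact absurd h' not_pair_infix_singleton
      · exact absurd h not_pair_infix_singleton
    | cons b l =>
      have ha : a ≠ z := by
        rintro rfl
        exact hl.head_notMem (mem_polylineCarrier (by simp))
      have hb : b ≠ z := by
        rintro rfl
        cases l with
        | nil => exact hl.2.2.2.1 rfl
        | cons c l => exact hl.2.2.2.head_notMem (mem_polylineCarrier (by simp))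
      have key : ∀ p q : Point, [p, q] <:+: a :: b :: (l ++ [z]) → p = z ∨ q = z →
          [p, q] <:+: b :: l ++ [z] := by
        intro p q h hz
        rcases pair_infix_cons.1 h with ⟨rfl, rfl⟩ | h
        · tauto
        · exact h
      exact ih hl.2.2.2 (key _ _ h hz) (key _ _ h' hz')

end IsOrthogonalPath

lemma segment_horizontal (y a b : ℝ) :
    segment ℝ ((a, y) : Point) (b, y) = {z | z.2 = y ∧ z.1 ∈ Set.uIcc a b} := by
  have := Prod.image_mk_segment_left (𝕜 := ℝ) a b y
  rw [← this, segment_eq_uIcc]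
  ext ⟨u, v⟩
  simp only [Set.mem_image, Prod.mk.injEq, Set.mem_ofPred_eq]
  constructor
  · rintro ⟨w, hw, rfl, rfl⟩
    exact ⟨rfl, hw⟩
  · rintro ⟨rfl, hw⟩
    exact ⟨u, hw, rfl, rfl⟩

lemma segment_vertical (x a b : ℝ) :
    segment ℝ ((x, a) : Point) (x, b) = {z | z.1 = x ∧ z.2 ∈ Set.uIcc a b} := by
  have := Prod.image_mk_segment_right (𝕜 := ℝ) x a b
  rw [← this, segment_eq_uIcc]
  ext ⟨u, v⟩
  simp only [Set.mem_image, Prod.mk.injEq, Set.mem_ofPred_eq]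
  constructor
  · rintro ⟨w, hw, rfl, rfl⟩
    exact ⟨rfl, hw⟩
  · rintro ⟨rfl, hw⟩
    exact ⟨v, hw, rfl, rfl⟩

/-- Among three horizontal line-segments from a common point, two overlap. -/
lemma exists_overlap_horizontal {o : Point} {z : Fin 3 → Point} (h : ∀ i, z i ≠ o)
    (hz : ∀ i, IsHorizontal o (z i)) :
    ∃ i j, i ≠ j ∧ ∃ x, x ≠ o ∧ x ∈ segment ℝ o (z i) ∧ x ∈ segment ℝ o (z j) := by
  obtain ⟨o1, o2⟩ := o
  have hseg : ∀ i, segment ℝ (o1, o2) (z i) = {x | x.2 = o2 ∧ x.1 ∈ Set.uIcc o1 (z i).1} := by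
    intro i
    rw [← segment_horizontal]
    congr 1
    exact Prod.ext rfl (hz i).symm
  have hne : ∀ i, (z i).1 ≠ o1 := fun i e => h i (Prod.ext e (hz i).symm)
  -- If two end points are on the same side of `o`, the nearer one lies on both line-segments; with
  -- three ends and two sides this must occur.
  have key : ∀ i j, i ≠ j → (((z i).1 < o1 ∧ (z j).1 < o1) ∨ (o1 < (z i).1 ∧ o1 < (z j).1)) →
      ∃ i j, i ≠ j ∧ ∃ x, x ≠ (o1, o2) ∧ x ∈ segment ℝ (o1, o2) (z i) ∧
        x ∈ segment ℝ (o1, o2) (z j) := by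
    intro i j hij hs
    refine ⟨i, j, hij, ?_⟩
    rcases hs with ⟨h1, h2⟩ | ⟨h1, h2⟩
    · refine ⟨(max (z i).1 (z j).1, o2), ?_, ?_, ?_⟩
      · simp only [ne_eq, Prod.mk.injEq, and_true]
        exact (max_lt h1 h2).ne
      · rw [hseg]
        exact ⟨rfl, Set.mem_uIcc.2 (Or.inr ⟨le_max_left _ _, (max_lt h1 h2).le⟩)⟩
      · rw [hseg]
        exact ⟨rfl, Set.mem_uIcc.2 (Or.inr ⟨le_max_right _ _, (max_lt h1 h2).le⟩)⟩
    · refine ⟨(min (z i).1 (z j).1, o2), ?_, ?_, ?_⟩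
      · simp only [ne_eq, Prod.mk.injEq, and_true]
        exact (lt_min h1 h2).ne'
      · rw [hseg]
        exact ⟨rfl, Set.mem_uIcc.2 (Or.inl ⟨(lt_min h1 h2).le, min_le_left _ _⟩)⟩
      · rw [hseg]
        exact ⟨rfl, Set.mem_uIcc.2 (Or.inl ⟨(lt_min h1 h2).le, min_le_right _ _⟩)⟩
  have k01 := key 0 1 (by decide)
  have k02 := key 0 2 (by decide)
  have k12 := key 1 2 (by decide)
  rcases lt_or_gt_of_ne (hne 0) with h0 | h0 <;> rcases lt_or_gt_of_ne (hne 1) with h1 | h1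
  · exact k01 (Or.inl ⟨h0, h1⟩)
  · rcases lt_or_gt_of_ne (hne 2) with h2 | h2
    · exact k02 (Or.inl ⟨h0, h2⟩)
    · exact k12 (Or.inr ⟨h1, h2⟩)
  · rcases lt_or_gt_of_ne (hne 2) with h2 | h2
    · exact k12 (Or.inl ⟨h1, h2⟩)
    · exact k02 (Or.inr ⟨h0, h2⟩)
  · exact k01 (Or.inr ⟨h0, h1⟩)

/-- Among three vertical line-segments from a common point, two overlap. -/
lemma exists_overlap_vertical {o : Point} {z : Fin 3 → Point} (h : ∀ i, z i ≠ o)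
    (hz : ∀ i, IsVertical o (z i)) :
    ∃ i j, i ≠ j ∧ ∃ x, x ≠ o ∧ x ∈ segment ℝ o (z i) ∧ x ∈ segment ℝ o (z j) := by
  obtain ⟨i, j, hij, x, hx, hxi, hxj⟩ := exists_overlap_horizontal (o := o.swap)
    (z := fun i => (z i).swap) (fun i e => h i (Prod.swap_injective e)) hz
  have hswap : ∀ k, x ∈ segment ℝ o.swap (z k).swap → x.swap ∈ segment ℝ o (z k) := by
    rintro k ⟨a, b, ha, hb, hab, rfl⟩
    exact ⟨a, b, ha, hb, hab, rfl⟩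
  refine ⟨i, j, hij, x.swap, fun e => hx ?_, hswap i hxi, hswap j hxj⟩
  rw [← e, Prod.swap_swap]

/-! ### Aligned edges at a vertex -/

namespace OrthogonalDrawing

variable {V : Type*} {G : SimpleGraph V}

/-- A piece of the edge `e` that starts or ends at the vertex `w`. -/
def PieceAt (Γ : OrthogonalDrawing G) (w : V) (e : Sym2 V) (p : Point × Point) : Prop :=
  [p.1, p.2] <:+: Γ.route e ∧ (p.1 = Γ.pos w ∨ p.2 = Γ.pos w)

lemma mem_of_pieceAt (Γ : OrthogonalDrawing G) {w : V} {e : Sym2 V} (he : e ∈ G.edgeSet)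
    {p : Point × Point} (h : Γ.PieceAt w e p) : w ∈ e := by
  refine Γ.vertex_on_route e he w ?_
  rcases h.2 with h2 | h2
  · exact segment_subset_polylineCarrier h.1 (h2 ▸ left_mem_segment ℝ _ _)
  · exact segment_subset_polylineCarrier h.1 (h2 ▸ right_mem_segment ℝ _ _)

/-- A piece of `e` at `w` forces `w` to be an end of `e`, where the simple route has only one piece.
Thus the direction in which an edge leaves its end is well defined. -/
lemma pieceAt_unique (Γ : OrthogonalDrawing G) {w : V} {e : Sym2 V} (he : e ∈ G.edgeSet)
    {p q : Point × Point} (hp : Γ.PieceAt w e p) (hq : Γ.PieceAt w e q) : p = q := by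
  have hw := Γ.mem_of_pieceAt he hp
  obtain ⟨u, v, bends, rfl, hr⟩ := Γ.route_ends e he
  have ho := Γ.route_orthogonal _ he
  obtain ⟨hp1, hp2⟩ := hp
  obtain ⟨hq1, hq2⟩ := hq
  rw [hr] at hp1 hq1 ho
  rcases Sym2.mem_iff.1 hw with rfl | rfl
  · obtain ⟨b, l, hbl⟩ : ∃ b l, bends ++ [Γ.pos v] = b :: l :=
      List.exists_cons_of_ne_nil (by simp)
    rw [hbl] at hp1 hq1 ho
    have h1 := ho.piece_at_head hp1 hp2
    have h2 := ho.piece_at_head hq1 hq2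
    exact Prod.ext (h1.1.trans h2.1.symm) (h1.2.trans h2.2.symm)
  · rw [← List.cons_append] at hp1 hq1 ho
    have := ho.piece_at_last hp1 hp2 hq1 hq2
    exact Prod.ext this.1 this.2

/-- Two different edges leave the vertex `w` in opposite directions. -/
def Aligned (Γ : OrthogonalDrawing G) (w : V) (e e' : Sym2 V) : Prop :=
  e ∈ G.edgeSet ∧ e' ∈ G.edgeSet ∧ e ≠ e' ∧
    ∃ p q, Γ.PieceAt w e p ∧ Γ.PieceAt w e' q ∧
      ((IsHorizontal p.1 p.2 ∧ IsHorizontal q.1 q.2) ∨ (IsVertical p.1 p.2 ∧ IsVertical q.1 q.2))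

lemma Aligned.symm {Γ : OrthogonalDrawing G} {w : V} {e e' : Sym2 V} (h : Γ.Aligned w e e') :
    Γ.Aligned w e' e := by
  obtain ⟨h1, h2, h3, p, q, hp, hq, h4⟩ := h
  exact ⟨h2, h1, h3.symm, q, p, hq, hp, h4.imp And.symm And.symm⟩

/-- The end of a piece other than a given vertex. -/
lemma PieceAt.exists_other {Γ : OrthogonalDrawing G} {w : V} {e : Sym2 V} (he : e ∈ G.edgeSet)
    {p : Point × Point} (h : Γ.PieceAt w e p) :
    ∃ z, z ≠ Γ.pos w ∧ segment ℝ (Γ.pos w) z ⊆ polylineCarrier (Γ.route e) ∧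
      (IsHorizontal p.1 p.2 → IsHorizontal (Γ.pos w) z) ∧
      (IsVertical p.1 p.2 → IsVertical (Γ.pos w) z) := by
  have hne := ((Γ.route_orthogonal e he).piece h.1).1
  have hs := segment_subset_polylineCarrier h.1
  rcases h.2 with h2 | h2
  · exact ⟨p.2, h2 ▸ hne.symm, h2 ▸ hs, h2 ▸ id, h2 ▸ id⟩
  · refine ⟨p.1, h2 ▸ hne, ?_, ?_, ?_⟩
    · rw [← h2, segment_symm]; exact hs
    · rw [← h2]; exact fun h => Eq.symm h
    · rw [← h2]; exact fun h => Eq.symm h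

lemma eq_of_mem_of_mem {e e' : Sym2 V} (hne : e ≠ e') {v w : V} (hv : v ∈ e) (hv' : v ∈ e')
    (hw : w ∈ e) (hw' : w ∈ e') : v = w := by
  by_contra h
  exact hne (((Sym2.mem_and_mem_iff h).1 ⟨hv, hw⟩).trans ((Sym2.mem_and_mem_iff h).1 ⟨hv', hw'⟩).symm)

/-- An edge is aligned with at most one other edge at each of its ends. -/
lemma Aligned.unique {Γ : OrthogonalDrawing G} {w : V} {e e₁ e₂ : Sym2 V} (h₁ : Γ.Aligned w e e₁)
    (h₂ : Γ.Aligned w e e₂) : e₁ = e₂ := by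
  by_contra hne
  obtain ⟨he, he1, hee1, p, p1, hp, hp1, h1⟩ := h₁
  obtain ⟨-, he2, hee2, q, p2, hq, hp2, h2⟩ := h₂
  obtain rfl := Γ.pieceAt_unique he hp hq
  have hpne := ((Γ.route_orthogonal e he).piece hp.1).1
  have hmem := Γ.mem_of_pieceAt he hp
  have hmem1 := Γ.mem_of_pieceAt he1 hp1
  have hmem2 := Γ.mem_of_pieceAt he2 hp2
  obtain ⟨z, hz, hzs, hzh, hzv⟩ := hp.exists_other he
  obtain ⟨z1, hz1, hzs1, hzh1, hzv1⟩ := hp1.exists_other he1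
  obtain ⟨z2, hz2, hzs2, hzh2, hzv2⟩ := hp2.exists_other he2
  -- The three pieces have the same type: if the two alignments were of different types, the piece
  -- of `e` would be both horizontal and vertical, hence degenerate.
  have hov : ∃ i j : Fin 3, i ≠ j ∧ ∃ x, x ≠ Γ.pos w ∧ x ∈ segment ℝ (Γ.pos w) (![z, z1, z2] i) ∧
      x ∈ segment ℝ (Γ.pos w) (![z, z1, z2] j) := by
    have hall : ∀ i : Fin 3, ![z, z1, z2] i ≠ Γ.pos w := by
      intro i; fin_cases i
      · exact hz
      · exact hz1
      · exact hz2
    rcases h1 with ⟨h1, h1'⟩ | ⟨h1, h1'⟩ <;> rcases h2 with ⟨h2, h2'⟩ | ⟨h2, h2'⟩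
    · apply exists_overlap_horizontal hall
      intro i; fin_cases i
      · exact hzh h1
      · exact hzh1 h1'
      · exact hzh2 h2'
    · exact absurd (Prod.ext h2 h1) hpne
    · exact absurd (Prod.ext h1 h2) hpne
    · apply exists_overlap_vertical hall
      intro i; fin_cases i
      · exact hzv h1
      · exact hzv1 h1'
      · exact hzv2 h2'
  obtain ⟨i, j, hij, x, hx, hxi, hxj⟩ := hov
  have key : ∀ i : Fin 3, ![e, e₁, e₂] i ∈ G.edgeSet ∧ w ∈ ![e, e₁, e₂] i ∧
      segment ℝ (Γ.pos w) (![z, z1, z2] i) ⊆ polylineCarrier (Γ.route (![e, e₁, e₂] i)) := by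
    intro i; fin_cases i
    · exact ⟨he, hmem, hzs⟩
    · exact ⟨he1, hmem1, hzs1⟩
    · exact ⟨he2, hmem2, hzs2⟩
  have hinj : ![e, e₁, e₂] i ≠ ![e, e₁, e₂] j := by
    fin_cases i <;> fin_cases j <;> simp_all [eq_comm]
  -- The point of overlap is a common end of two different edges, and these share no vertex besides
  -- `w`.
  obtain ⟨v, hv, hv', rfl⟩ := Γ.routes_meet _ (key i).1 _ (key j).1 hinj x ((key i).2.2 hxi)
    ((key j).2.2 hxj)
  exact hx (congrArg Γ.pos (eq_of_mem_of_mem hinj hv hv' (key i).2.1 (key j).2.1))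

/-- Consecutive pieces of a segment belong to the same edge or to aligned edges. -/
lemma eq_or_aligned_of_continues (Γ : OrthogonalDrawing G) {e e' : Sym2 V} (he : e ∈ G.edgeSet)
    (he' : e' ∈ G.edgeSet) {p q : Point × Point} (hp : [p.1, p.2] <:+: Γ.route e)
    (hq : [q.1, q.2] <:+: Γ.route e') (h : Continues p q) :
    e = e' ∨ ∃ w, w ∈ e ∧ w ∈ e' ∧ Γ.Aligned w e e' := by
  by_cases hee : e = e'
  · exact Or.inl hee
  right
  obtain ⟨htype, hshare⟩ := h
  have hp' := segment_subset_polylineCarrier hp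
  have hq' := segment_subset_polylineCarrier hq
  obtain ⟨x, hxp, hxq⟩ : ∃ x, (p.1 = x ∨ p.2 = x) ∧ (q.1 = x ∨ q.2 = x) := by
    rcases hshare with h | h | h | h
    · exact ⟨p.1, Or.inl rfl, Or.inl h.symm⟩
    · exact ⟨p.1, Or.inl rfl, Or.inr h.symm⟩
    · exact ⟨p.2, Or.inr rfl, Or.inl h.symm⟩
    · exact ⟨p.2, Or.inr rfl, Or.inr h.symm⟩
  have h1 : x ∈ polylineCarrier (Γ.route e) := by
    rcases hxp with rfl | rfl
    · exact hp' (left_mem_segment ℝ _ _)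
    · exact hp' (right_mem_segment ℝ _ _)
  have h2 : x ∈ polylineCarrier (Γ.route e') := by
    rcases hxq with rfl | rfl
    · exact hq' (left_mem_segment ℝ _ _)
    · exact hq' (right_mem_segment ℝ _ _)
  obtain ⟨w, hw, hw', rfl⟩ := Γ.routes_meet e he e' he' hee x h1 h2
  exact ⟨w, hw, hw', he, he', hee, p, q, ⟨hp, hxp⟩, ⟨hq, hxq⟩, htype⟩

/-! ### A lower bound for covers -/

/-- If every edge has an end in `R` and an end outside, and no more than three edges end at each
vertex of `R`, then a cover needs at least `|Rᶜ| - |R|` segments: the vertices outside `R` on a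
segment are linked through vertices of `R` at which two edges are aligned. -/
theorem card_compl_le_of_coveredBy [Fintype V] [DecidableEq V] (Γ : OrthogonalDrawing G)
    (R : Finset V) (hR : ∀ u v, G.Adj u v → (u ∈ R ↔ v ∉ R))
    (hdeg : ∀ r ∈ R, ∀ e : Fin 4 → Sym2 V, (∀ i, e i ∈ G.edgeSet ∧ r ∈ e i) →
      ¬ Function.Injective e)
    {m : ℕ} (hm : Γ.CoveredBy m) : Rᶜ.card ≤ R.card + m := by
  classical
  obtain ⟨C, hCm, hC, hcov⟩ := hm
  -- An edge is represented by its only end outside `R`.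
  have hι : ∀ e : Sym2 V, ∃ v, e ∈ G.edgeSet → v ∈ e ∧ v ∉ R ∧ ∀ w ∈ e, w ∉ R → w = v := by
    intro e
    induction e using Sym2.ind with | _ u v
    by_cases h : G.Adj u v
    · have := hR u v h
      by_cases hu : u ∈ R
      · refine ⟨v, fun _ => ⟨by simp, by tauto, ?_⟩⟩
        intro w hw hwR
        rcases Sym2.mem_iff.1 hw with rfl | rfl <;> tauto
      · refine ⟨u, fun _ => ⟨by simp, by tauto, ?_⟩⟩
        intro w hw hwR
        rcases Sym2.mem_iff.1 hw with rfl | rfl <;> tauto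
    · exact ⟨u, fun h' => absurd h' h⟩
  choose ι hι using hι
  choose! P hP hPS using hC
  have hPe : ∀ S ∈ C, ∃ e ∈ G.edgeSet, [(P S).1, (P S).2] <:+: Γ.route e := hP
  choose E hE hEP using hPe
  -- vertices outside R, and one vertex more
  let W := Option {v // v ∉ R}
  let toW : V → W := fun v => if h : v ∈ R then none else some ⟨v, h⟩
  -- The links: one for each `r ∈ R`, between the outer ends of two edges aligned at `r`, and one
  -- for each segment of the cover, from the additional vertex to an edge of the segment. The loop
  -- at `none` is a default value that `fromEdgeSet` discards.
  let F : {r // r ∈ R} ⊕ {S // S ∈ C} → Sym2 W := fun x => match x with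
    | Sum.inl r => if h : ∃ e e', Γ.Aligned r e e' then
        s(toW (ι h.choose), toW (ι h.choose_spec.choose)) else s(none, none)
    | Sum.inr S => s(none, toW (ι (E S.1 S.2)))
  let L : SimpleGraph W := SimpleGraph.fromEdgeSet (Set.range F)
  have hreachF : ∀ x a b, F x = s(a, b) → L.Reachable a b := by
    intro x a b h
    by_cases hab : a = b
    · subst hab; exact SimpleGraph.Reachable.refl _
    · exact SimpleGraph.Adj.reachable ((SimpleGraph.fromEdgeSet_adj _).2 ⟨⟨x, h⟩, hab⟩)
  have hal : ∀ r ∈ R, ∀ e e', Γ.Aligned r e e' → L.Reachable (toW (ι e)) (toW (ι e')) := by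
    intro r hr e e' h
    have hex : ∃ e e', Γ.Aligned r e e' := ⟨e, e', h⟩
    have h0 := hex.choose_spec.choose_spec
    have hF : F (Sum.inl ⟨r, hr⟩) =
        s(toW (ι hex.choose), toW (ι hex.choose_spec.choose)) := dif_pos hex
    have hreach := hreachF (Sum.inl ⟨r, hr⟩) (toW (ι hex.choose))
      (toW (ι hex.choose_spec.choose)) hF
    generalize hex.choose_spec.choose = d' at h0 hreach
    generalize hex.choose = d at h0 hreach
    have hmem : ∀ {e e'}, Γ.Aligned r e e' → r ∈ e ∧ r ∈ e' := by
      rintro e e' ⟨h1, h2, -, p, q, hp, hq, -⟩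
      exact ⟨Γ.mem_of_pieceAt h1 hp, Γ.mem_of_pieceAt h2 hq⟩
    -- With at most three edges at `r`, any two aligned pairs have an edge in common, so they
    -- coincide by `Aligned.unique`. Hence the one link chosen at `r` serves every aligned pair.
    have hninj := hdeg r hr ![e, e', d, d'] (by
      intro i
      fin_cases i
      · exact ⟨h.1, (hmem h).1⟩
      · exact ⟨h.2.1, (hmem h).2⟩
      · exact ⟨h0.1, (hmem h0).1⟩
      · exact ⟨h0.2.1, (hmem h0).2⟩)
    have hcases : e = d ∨ e = d' ∨ e' = d ∨ e' = d' := by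
      by_contra hcon
      push Not at hcon
      apply hninj
      have h1 := h.2.2.1
      have h2 := h0.2.2.1
      obtain ⟨h3, h4, h5, h6⟩ := hcon
      intro i j hij
      fin_cases i <;> fin_cases j <;> first
        | rfl
        | exact absurd hij h1 | exact absurd hij.symm h1
        | exact absurd hij h2 | exact absurd hij.symm h2
        | exact absurd hij h3 | exact absurd hij.symm h3
        | exact absurd hij h4 | exact absurd hij.symm h4
        | exact absurd hij h5 | exact absurd hij.symm h5
        | exact absurd hij h6 | exact absurd hij.symm h6
    rcases hcases with rfl | rfl | rfl | rfl
    · rw [h.unique h0]; exact hreach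
    · rw [h.unique h0.symm]; exact hreach.symm
    · rw [h.symm.unique h0]; exact hreach.symm
    · rw [h.symm.unique h0.symm]; exact hreach
  -- A segment passes to another edge either at a vertex of `R`, where there is a link, or at a
  -- vertex outside `R`, which is then the outer end of both edges.
  have hstep : ∀ e ∈ G.edgeSet, ∀ e' ∈ G.edgeSet, ∀ p q : Point × Point,
      [p.1, p.2] <:+: Γ.route e → [q.1, q.2] <:+: Γ.route e' → Continues p q →
      L.Reachable (toW (ι e)) (toW (ι e')) := by
    intro e he e' he' p q hp hq hpq
    rcases Γ.eq_or_aligned_of_continues he he' hp hq hpq with rfl | ⟨w, hw, hw', hal'⟩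
    · exact SimpleGraph.Reachable.refl _
    · by_cases hwR : w ∈ R
      · exact hal w hwR e e' hal'
      · rw [← (hι e he).2.2 w hw hwR, ← (hι e' he').2.2 w hw' hwR]
  have hchain : ∀ S ∈ C, ∀ q, Relation.ReflTransGen (fun a b => b ∈ Γ.pieces ∧ Continues a b) (P S) q →
      ∀ e ∈ G.edgeSet, [q.1, q.2] <:+: Γ.route e → L.Reachable none (toW (ι e)) := by
    intro S hS q hq
    have hstart : L.Reachable none (toW (ι (E S hS))) := hreachF (Sum.inr ⟨S, hS⟩) _ _ rfl
    induction hq with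
    | refl =>
      intro e he hp
      refine hstart.trans (hstep _ (hE S hS) _ he _ _ (hEP S hS) hp ⟨?_, Or.inl rfl⟩)
      rcases ((Γ.route_orthogonal e he).piece hp).2 with h | h
      · exact Or.inl ⟨h, h⟩
      · exact Or.inr ⟨h, h⟩
    | @tail b c hab hbc ih =>
      intro e he hp
      rcases Relation.ReflTransGen.cases_tail hab with rfl | ⟨d, -, ⟨e', he', hb⟩, -⟩
      · exact hstart.trans (hstep _ (hE S hS) _ he _ _ (hEP S hS) hp hbc.2)
      · exact (ih e' he' hb).trans (hstep _ he' _ he _ _ hb hp hbc.2)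
  have hconn : L.Connected := by
    refine SimpleGraph.Connected.mk (fun a b => ?_)
    have : ∀ a, L.Reachable none a := by
      intro a
      cases a with
      | none => exact SimpleGraph.Reachable.refl _
      | some v =>
        obtain ⟨v, hv⟩ := v
        obtain ⟨S, hS, q, hqS, hvq⟩ := hcov v
        rw [hPS S hS] at hqS
        have hq : ∃ e ∈ G.edgeSet, [q.1, q.2] <:+: Γ.route e := by
          rcases Relation.ReflTransGen.cases_tail hqS with h | ⟨d, -, h, -⟩
          · rw [h]; exact hP S hS
          · exact h
        obtain ⟨e, he, hqe⟩ := hq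
        have hve : v ∈ e := Γ.vertex_on_route e he v (segment_subset_polylineCarrier hqe hvq)
        have := hchain S hS q hqS e he hqe
        rw [← (hι e he).2.2 v hve hv] at this
        simpa [toW, hv] using this
    exact (this a).symm.trans (this b)
  -- A connected graph on `|Rᶜ| + 1` vertices has at least `|Rᶜ|` edges, and there are at most `|R|
  -- + |C|` links.
  have h1 := hconn.card_vert_le_card_edgeSet_add_one
  have h2 : Nat.card L.edgeSet ≤ R.card + C.card := by
    have : L.edgeSet ⊆ Set.range F := by
      intro e he
      rw [SimpleGraph.edgeSet_fromEdgeSet] at he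
      exact he.1
    calc Nat.card L.edgeSet ≤ Nat.card (Set.range F) :=
          Nat.card_mono (Set.finite_range F) this
      _ ≤ Nat.card (R ⊕ C) := Finite.card_range_le F
      _ = R.card + C.card := by simp
  have h3 : Nat.card W = Rᶜ.card + 1 := by
    rw [Nat.card_eq_fintype_card]
    simp only [W, Fintype.card_option, Fintype.card_subtype]
    congr 2
    ext v; simp
  omega

end OrthogonalDrawing

/-! ### Small series and parallel combinations -/

namespace SPQTree

variable {V : Type*} {G : SimpleGraph V}

lemma iSup_fin_two {α : Type*} [CompleteLattice α] (K : Fin 2 → α) : ⨆ i, K i = K 0 ⊔ K 1 := by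
  apply le_antisymm
  · refine iSup_le fun i => ?_
    fin_cases i
    · exact le_sup_left
    · exact le_sup_right
  · exact sup_le (le_iSup K 0) (le_iSup K 1)

lemma decomposes_S_two {child : Fin 2 → SPQTree} {H₁ H₂ : G.Subgraph} {s m t : V}
    (h₁ : (child 0).Decomposes H₁ s m) (h₂ : (child 1).Decomposes H₂ m t)
    (h : H₁.verts ∩ H₂.verts = {m}) : (S 2 child).Decomposes (H₁ ⊔ H₂) s t := by
  refine ⟨le_rfl, ![H₁, H₂], ![s, m, t], rfl, rfl, (iSup_fin_two ![H₁, H₂]).symm, ?_, ?_, ?_⟩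
  · intro i
    fin_cases i
    · exact h₁
    · exact h₂
  · intro i j hij
    fin_cases i <;> fin_cases j <;> simp at hij
    exact h
  · intro i j hij
    have := i.2
    have := j.2
    omega

lemma decomposes_P_two {child : Fin 2 → SPQTree} {H₁ H₂ : G.Subgraph} {s t : V}
    (h₁ : (child 0).Decomposes H₁ s t) (h₂ : (child 1).Decomposes H₂ s t)
    (h : H₁.verts ∩ H₂.verts = {s, t}) (hadj : ∀ u v, H₁.Adj u v → ¬ H₂.Adj u v) :
    (P 2 child).Decomposes (H₁ ⊔ H₂) s t := by
  have hd : Disjoint H₁.edgeSet H₂.edgeSet := by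
    rw [Set.disjoint_left]
    intro e
    induction e using Sym2.ind with | _ u v
    exact hadj u v
  refine ⟨le_rfl, ![H₁, H₂], (iSup_fin_two ![H₁, H₂]).symm, ?_, ?_⟩
  · intro i
    fin_cases i
    · exact h₁
    · exact h₂
  · intro i j hij
    fin_cases i <;> fin_cases j
    · exact absurd rfl hij
    · exact ⟨h, hd⟩
    · exact ⟨by rw [Set.inter_comm]; exact h, hd.symm⟩
    · exact absurd rfl hij

/-- A path with two edges. -/
def path : SPQTree := S 2 fun _ => Q

/-- A cycle of length four with opposite terminals. -/
def cycle : SPQTree := P 2 fun _ => path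

lemma path_decomposes {a b c : V} (hab : G.Adj a b) (hbc : G.Adj b c) (hac : a ≠ c) :
    path.Decomposes (G.subgraphOfAdj hab ⊔ G.subgraphOfAdj hbc) a c := by
  refine decomposes_S_two ⟨hab, rfl⟩ ⟨hbc, rfl⟩ ?_
  ext v
  simp only [SimpleGraph.subgraphOfAdj_verts, Set.mem_inter_iff, Set.mem_insert_iff,
    Set.mem_singleton_iff]
  have := hab.ne
  have := hbc.ne
  constructor
  · rintro ⟨rfl | rfl, h | h⟩ <;> simp_all
  · intro h
    simp [h]

lemma cycle_decomposes {a b c d : V} (hab : G.Adj a b) (hbc : G.Adj b c) (had : G.Adj a d)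
    (hdc : G.Adj d c) (hac : a ≠ c) (hbd : b ≠ d) :
    cycle.Decomposes ((G.subgraphOfAdj hab ⊔ G.subgraphOfAdj hbc) ⊔
      (G.subgraphOfAdj had ⊔ G.subgraphOfAdj hdc)) a c := by
  have := hab.ne
  have := hbc.ne
  have := had.ne
  have := hdc.ne
  refine decomposes_P_two (path_decomposes hab hbc hac) (path_decomposes had hdc hac) ?_ ?_
  · ext v
    simp only [SimpleGraph.Subgraph.verts_sup, SimpleGraph.subgraphOfAdj_verts, Set.mem_inter_iff,
      Set.mem_insert_iff, Set.mem_singleton_iff, Set.mem_union]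
    constructor
    · rintro ⟨(rfl | rfl) | (rfl | rfl), (h | h) | (h | h)⟩ <;> tauto
    · tauto
  · intro u v
    simp only [SimpleGraph.Subgraph.sup_adj, SimpleGraph.subgraphOfAdj_adj, Sym2.eq_iff]
    rintro ((⟨rfl, rfl⟩ | ⟨rfl, rfl⟩) | (⟨rfl, rfl⟩ | ⟨rfl, rfl⟩))
      ((⟨h1, h2⟩ | ⟨h1, h2⟩) | (⟨h1, h2⟩ | ⟨h1, h2⟩)) <;> simp_all

lemma numPStar_path : path.numPStar = 0 := by simp [path, numPStar]

lemma numPStar_cycle : cycle.numPStar = 1 := by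
  simp [cycle, numPStar, numPStar_path]
  simp [path]

end SPQTree

/-! ### A chain of cycles -/

/-- Cycles of length four, joined in a row by paths with two edges, with another edge at each end:
the cycle number `i` has the vertices `5 i + 1, …, 5 i + 4`. -/
def cycleChain (k : ℕ) : SimpleGraph (Fin (5 * k + 1)) :=
  SimpleGraph.fromRel fun u v =>
    ((u : ℕ) % 5 ≠ 2 ∧ (v : ℕ) = u + 1) ∨ (((u : ℕ) % 5 = 1 ∨ (u : ℕ) % 5 = 2) ∧ (v : ℕ) = u + 2)

namespace cycleChain

variable {k : ℕ}

lemma adj_iff {u v : Fin (5 * k + 1)} : (cycleChain k).Adj u v ↔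
    (((u : ℕ) % 5 ≠ 2 ∧ (v : ℕ) = u + 1) ∨
      (((u : ℕ) % 5 = 1 ∨ (u : ℕ) % 5 = 2) ∧ (v : ℕ) = u + 2)) ∨
    (((v : ℕ) % 5 ≠ 2 ∧ (u : ℕ) = v + 1) ∨
      (((v : ℕ) % 5 = 1 ∨ (v : ℕ) % 5 = 2) ∧ (u : ℕ) = v + 2)) := by
  simp only [cycleChain, SimpleGraph.fromRel_adj, ne_eq, Fin.ext_iff]
  omega

lemma degree_le [DecidableRel (cycleChain k).Adj] (u : Fin (5 * k + 1)) :
    (cycleChain k).degree u ≤ 3 := by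
  obtain ⟨a, b, c, h⟩ : ∃ a b c : ℕ, ∀ v : Fin (5 * k + 1), (cycleChain k).Adj u v →
      (v : ℕ) = a ∨ (v : ℕ) = b ∨ (v : ℕ) = c := by
    rcases (by omega : (u : ℕ) % 5 = 0 ∨ (u : ℕ) % 5 = 1 ∨ (u : ℕ) % 5 = 2 ∨ (u : ℕ) % 5 = 3 ∨
      (u : ℕ) % 5 = 4) with h | h | h | h | h
    · exact ⟨u - 1, u + 1, u, fun v hv => by rw [adj_iff] at hv; omega⟩
    · exact ⟨u - 1, u + 1, u + 2, fun v hv => by rw [adj_iff] at hv; omega⟩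
    · exact ⟨u - 1, u + 2, u, fun v hv => by rw [adj_iff] at hv; omega⟩
    · exact ⟨u - 2, u + 1, u, fun v hv => by rw [adj_iff] at hv; omega⟩
    · exact ⟨u - 2, u - 1, u + 1, fun v hv => by rw [adj_iff] at hv; omega⟩
  rw [← SimpleGraph.card_neighborFinset_eq_degree, ← Finset.card_map Fin.valEmbedding]
  refine (Finset.card_le_card ?_).trans (Finset.card_le_three (a := a) (b := b) (c := c))
  intro x hx
  simp only [Finset.mem_map, SimpleGraph.mem_neighborFinset, Fin.valEmbedding_apply] at hx
  obtain ⟨v, hv, rfl⟩ := hx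
  simpa using h v hv

lemma maxDegree_eq [DecidableRel (cycleChain k).Adj] (hk : 0 < k) :
    (cycleChain k).maxDegree = 3 := by
  refine le_antisymm (SimpleGraph.maxDegree_le_of_forall_degree_le _ _ degree_le) ?_
  refine le_trans ?_ (SimpleGraph.degree_le_maxDegree _ (⟨1, by omega⟩ : Fin (5 * k + 1)))
  rw [← SimpleGraph.card_neighborFinset_eq_degree]
  have h : ({⟨0, by omega⟩, ⟨2, by omega⟩, ⟨3, by omega⟩} : Finset (Fin (5 * k + 1))) ⊆
      (cycleChain k).neighborFinset ⟨1, by omega⟩ := by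
    intro v hv
    simp only [Finset.mem_insert, Finset.mem_singleton] at hv
    rw [SimpleGraph.mem_neighborFinset, adj_iff]
    rcases hv with rfl | rfl | rfl <;> simp
  refine le_trans (le_of_eq ?_) (Finset.card_le_card h)
  rw [Finset.card_eq_three.2]
  exact ⟨_, _, _, by simp [Fin.ext_iff], by simp [Fin.ext_iff], by simp [Fin.ext_iff], rfl⟩

/-- Each vertex `5 i + 3` is reflected to the negative side. Its edges then go from `-(5 i + 3)` to
`5 i + 1` and `5 i + 4`, which gives nested arcs; all other edges join neighbours in the order of
the remaining vertices. -/
lemma isOuterplanar : IsOuterplanar (cycleChain k) := by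
  obtain ⟨g, hg⟩ : ∃ g : Fin (5 * k + 1) → ℤ, ∀ u : Fin (5 * k + 1),
      ((u : ℕ) % 5 = 3 ∧ g u = -((u : ℕ) : ℤ)) ∨ ((u : ℕ) % 5 ≠ 3 ∧ g u = ((u : ℕ) : ℤ)) := by
    refine ⟨fun u : Fin (5 * k + 1) => if (u : ℕ) % 5 = 3 then -((u : ℕ) : ℤ)
      else ((u : ℕ) : ℤ), fun u => ?_⟩
    by_cases h : (u : ℕ) % 5 = 3 <;> simp [h]
  have hval : ∀ u, (0 ≤ g u ∧ g u % 5 ≠ 3) ∨ (g u < 0 ∧ (-g u) % 5 = 3) := fun u => by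
    have := hg u; omega
  have hedge : ∀ u v, (cycleChain k).Adj u v → g u < g v →
      (0 ≤ g u ∧ g v = g u + 1 ∧ (g u % 5 = 0 ∨ g u % 5 = 1 ∨ g u % 5 = 4)) ∨
      (0 ≤ g u ∧ g v = g u + 2 ∧ g u % 5 = 2) ∨
      (g u < 0 ∧ (-g u) % 5 = 3 ∧ (g v = -g u - 2 ∨ g v = - g u + 1)) := by
    intro u v h huv
    rw [adj_iff] at h
    have := hg u
    have := hg v
    omega
  refine ⟨fun u => (g u : ℝ), fun u v huv => ?_, fun a b c d hab hcd => ?_⟩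
  · have huv : g u = g v := Int.cast_injective (α := ℝ) huv
    have := hg u
    have := hg v
    ext
    omega
  · simp only [Int.cast_lt]
    rintro ⟨h1, h2, h3⟩
    have e1 := hedge a b hab (h1.trans h2)
    have e2 := hedge c d hcd (h2.trans h3)
    have e3 := hval c
    have e4 := hval b
    omega

/-- The SPQ-tree of a chain of cycles. -/
def tree (k : ℕ) : SPQTree :=
  .S (3 * k) fun i => if (i : ℕ) % 3 = 1 then .cycle else .Q

lemma reduced_tree : (tree k).Reduced := by
  intro i
  by_cases h : (i : ℕ) % 3 = 1
  · simp [h, SPQTree.cycle, SPQTree.path, SPQTree.IsS, SPQTree.IsP, SPQTree.Reduced]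
  · simp [h, SPQTree.IsS, SPQTree.Reduced]

lemma numPStar_tree : (tree k).numPStar = k := by
  have h : ∀ i : ℕ, (if i % 3 = 1 then SPQTree.cycle else .Q).numPStar =
      if i % 3 = 1 then 1 else 0 := by
    intro i
    split_ifs
    · exact SPQTree.numPStar_cycle
    · rfl
  simp only [tree, SPQTree.numPStar, h]
  rw [Fin.sum_univ_eq_sum_range (fun i => if i % 3 = 1 then 1 else 0)]
  induction k with
  | zero => simp
  | succ k ih =>
    rw [show 3 * (k + 1) = 3 * k + 1 + 1 + 1 by ring, Finset.sum_range_succ, Finset.sum_range_succ,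
      Finset.sum_range_succ, ih]
    have h1 : ¬ (3 * k % 3 = 1) := by omega
    have h2 : (3 * k + 1) % 3 = 1 := by omega
    have h3 : ¬ ((3 * k + 1 + 1) % 3 = 1) := by omega
    rw [if_neg h1, if_pos h2, if_neg h3]

/-- The cut vertices of a chain of cycles. -/
def cut (j : ℕ) : ℕ := 5 * (j / 3) + if j % 3 = 0 then 0 else if j % 3 = 1 then 1 else 4

/-- The factor `3` eliminates the quotient `j / 3`, which leaves linear facts for `omega`. -/
lemma cut_spec (j : ℕ) : (j % 3 = 0 ∧ 3 * cut j = 5 * j) ∨ (j % 3 = 1 ∧ 3 * cut j + 2 = 5 * j) ∨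
    (j % 3 = 2 ∧ 3 * cut j = 5 * j + 2) := by
  unfold cut
  split_ifs <;> omega

/-- The case `u = v` is included so that vertices and edges are located together. The last vertex `5
* k` starts no part and belongs to the last one. -/
lemma exists_part (hk : 0 < k) (u v : Fin (5 * k + 1))
    (huv : u = v ∨ (u < v ∧ (cycleChain k).Adj u v)) :
    ∃ i : Fin (3 * k), (cut i ≤ u ∧ u ≤ cut (i + 1)) ∧ (cut i ≤ v ∧ v ≤ cut (i + 1)) := by
  have hv := v.2
  rw [adj_iff, Fin.ext_iff, Fin.lt_def] at huv
  by_cases hu : (u : ℕ) = 5 * k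
  · have h1 := cut_spec (3 * k - 1)
    have h2 := cut_spec (3 * k - 1 + 1)
    exact ⟨⟨3 * k - 1, by omega⟩, by simp only; omega, by simp only; omega⟩
  · obtain ⟨q, hq⟩ : ∃ q, (u : ℕ) / 5 = q := ⟨_, rfl⟩
    have h0 := cut_spec (3 * q)
    have h1 := cut_spec (3 * q + 1)
    have h2 := cut_spec (3 * q + 1 + 1)
    have h3 := cut_spec (3 * q + 1 + 1 + 1)
    rcases (by omega : (u : ℕ) % 5 = 0 ∨ (u : ℕ) % 5 = 4 ∨ ((u : ℕ) % 5 ≠ 0 ∧ (u : ℕ) % 5 ≠ 4))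
      with h | h | h
    · exact ⟨⟨3 * q, by omega⟩, by simp only; omega, by simp only; omega⟩
    · exact ⟨⟨3 * q + 1 + 1, by omega⟩, by simp only; omega, by simp only; omega⟩
    · exact ⟨⟨3 * q + 1, by omega⟩, by simp only; omega, by simp only; omega⟩

/-- The subgraph between two consecutive cut vertices. -/
def part (k : ℕ) (i : Fin (3 * k)) : (cycleChain k).Subgraph :=
  (⊤ : (cycleChain k).Subgraph).induce {v | cut i ≤ v ∧ v ≤ cut (i + 1)}

lemma cut_lt (j : Fin (3 * k + 1)) : cut j < 5 * k + 1 := by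
  have := cut_spec j
  have := j.2
  omega

lemma part_decomposes (i : Fin (3 * k)) :
    (if (i : ℕ) % 3 = 1 then SPQTree.cycle else .Q).Decomposes (part k i)
      ⟨cut i.castSucc, cut_lt _⟩ ⟨cut i.succ, cut_lt _⟩ := by
  unfold part
  have h1 := cut_spec i
  have h2 := cut_spec (i + 1)
  have hi := i.2
  by_cases h : (i : ℕ) % 3 = 1
  · simp only [h, if_true]
    have e : cut (i + 1) = cut i + 3 := by omega
    have e1 : cut i % 5 = 1 := by omega
    obtain ⟨a, b, c, d, ha, hb, hc, hd⟩ : ∃ a b c d : Fin (5 * k + 1), (a : ℕ) = cut i ∧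
        (b : ℕ) = cut i + 1 ∧ (c : ℕ) = cut i + 3 ∧ (d : ℕ) = cut i + 2 :=
      ⟨⟨cut i, by omega⟩, ⟨cut i + 1, by omega⟩, ⟨cut i + 3, by omega⟩, ⟨cut i + 2, by omega⟩,
        rfl, rfl, rfl, rfl⟩
    have key := SPQTree.cycle_decomposes (G := cycleChain k) (a := a) (b := b) (c := c) (d := d)
      (by rw [adj_iff]; omega) (by rw [adj_iff]; omega) (by rw [adj_iff]; omega)
      (by rw [adj_iff]; omega) (by rw [ne_eq, Fin.ext_iff]; omega)
      (by rw [ne_eq, Fin.ext_iff]; omega)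
    convert key using 1
    · ext u v
      · simp only [SimpleGraph.Subgraph.induce_verts, Set.mem_ofPred_eq,
          SimpleGraph.Subgraph.verts_sup, SimpleGraph.subgraphOfAdj_verts, Set.mem_union,
          Set.mem_insert_iff, Set.mem_singleton_iff, Fin.ext_iff]
        omega
      · simp only [SimpleGraph.Subgraph.induce_adj, Set.mem_ofPred_eq,
          SimpleGraph.Subgraph.sup_adj, SimpleGraph.subgraphOfAdj_adj, Sym2.eq_iff,
          SimpleGraph.Subgraph.top_adj, adj_iff, Fin.ext_iff]
        omega
    · ext
      simp only [Fin.val_castSucc]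
      omega
    · ext
      simp only [Fin.val_succ]
      omega
  · simp only [h, if_false]
    have e : cut (i + 1) = cut i + 1 := by omega
    refine ⟨?_, ?_⟩
    · rw [adj_iff]
      simp only [Fin.val_succ, Fin.val_castSucc]
      omega
    · rw [SimpleGraph.Subgraph.subgraphOfAdj_eq_induce]
      congr 1
      ext u
      simp only [Set.mem_ofPred_eq, Set.mem_insert_iff, Set.mem_singleton_iff, Fin.ext_iff,
        Fin.val_succ, Fin.val_castSucc]
      omega

lemma isTreeOf (hk : 0 < k) : (tree k).IsTreeOf (cycleChain k) 0 (Fin.last (5 * k)) := by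
  refine ⟨by omega, part k, fun j => ⟨cut j, cut_lt j⟩, ?_, ?_, ?_, ?_, ?_, ?_⟩
  · ext; simp [cut]
  · ext
    have := cut_spec (3 * k)
    simp only [Fin.val_last]
    omega
  · ext u v
    · simp only [part, SimpleGraph.Subgraph.verts_top, Set.mem_univ, SimpleGraph.Subgraph.verts_iSup,
        SimpleGraph.Subgraph.induce_verts, Set.mem_iUnion, Set.mem_ofPred_eq, true_iff]
      obtain ⟨i, hi, -⟩ := exists_part hk u u (Or.inl rfl)
      exact ⟨i, hi⟩
    · simp only [part, SimpleGraph.Subgraph.top_adj, SimpleGraph.Subgraph.iSup_adj,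
        SimpleGraph.Subgraph.induce_adj, Set.mem_ofPred_eq]
      refine ⟨fun h => ?_, fun ⟨_, _, _, h⟩ => h⟩
      rcases lt_or_gt_of_ne h.ne with huv | huv
      · obtain ⟨i, hi, hi'⟩ := exists_part hk u v (Or.inr ⟨huv, h⟩)
        exact ⟨i, hi, hi', h⟩
      · obtain ⟨i, hi, hi'⟩ := exists_part hk v u (Or.inr ⟨huv, h.symm⟩)
        exact ⟨i, hi', hi, h⟩
  · exact part_decomposes
  · intro i j hij
    have h1 := cut_spec i
    have h2 := cut_spec (i + 1)
    have h3 := cut_spec (j + 1)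
    rw [← hij] at h3
    ext u
    simp only [part, SimpleGraph.Subgraph.induce_verts, Set.mem_inter_iff, Set.mem_ofPred_eq,
      Set.mem_singleton_iff, Fin.ext_iff, Fin.val_castSucc, ← hij]
    omega
  · intro i j hij
    have h1 := cut_spec (i + 1)
    have h2 := cut_spec j
    rw [Set.disjoint_left]
    simp only [part, SimpleGraph.Subgraph.induce_verts, Set.mem_ofPred_eq]
    intro u
    omega

/-- Covering a chain of cycles takes one segment more than there are cycles. -/
lemma lt_of_coveredBy (Γ : OrthogonalDrawing (cycleChain k)) {m : ℕ} (hm : Γ.CoveredBy m) :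
    k + 1 ≤ m := by
  classical
  -- `R` consists of the two vertices at which each cycle is attached to the chain. Every edge has
  -- exactly one end in `R`; there are at most `2 * k` vertices inside, so at least `3 * k + 1`
  -- outside, and the difference is at least `k + 1`.
  let R : Finset (Fin (5 * k + 1)) := Finset.univ.filter fun u => (u : ℕ) % 5 = 1 ∨ (u : ℕ) % 5 = 4
  have hR : R.card ≤ 2 * k := by
    have : R.card ≤ (Finset.range (2 * k)).card := by
      refine Finset.card_le_card_of_injOn (fun u => 2 * ((u : ℕ) / 5) + if (u : ℕ) % 5 = 1 then 0 else 1)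
        ?_ ?_
      · intro u hu
        have := u.2
        simp only [R, Finset.coe_filter, Finset.mem_univ, true_and, Set.mem_ofPred_eq] at hu
        simp only [Finset.coe_range, Set.mem_Iio]
        split_ifs <;> omega
      · intro u hu v hv huv
        simp only [R, Finset.coe_filter, Finset.mem_univ, true_and, Set.mem_ofPred_eq] at hu hv
        simp only at huv
        ext
        split_ifs at huv <;> omega
    simpa using this
  have h := Γ.card_compl_le_of_coveredBy R (fun u v huv => by
    rw [adj_iff] at huv
    simp only [R, Finset.mem_filter, Finset.mem_univ, true_and]
    omega) (fun r _ e he hinj => by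
      have h1 : Finset.univ.map ⟨e, hinj⟩ ⊆ (cycleChain k).incidenceFinset r := by
        intro x hx
        simp only [Finset.mem_map, Finset.mem_univ, true_and, Function.Embedding.coeFn_mk] at hx
        obtain ⟨i, rfl⟩ := hx
        rw [SimpleGraph.mem_incidenceFinset]
        exact he i
      have h2 := Finset.card_le_card h1
      rw [SimpleGraph.card_incidenceFinset_eq_degree] at h2
      have h3 := degree_le r
      simp at h2
      omega) hm
  rw [Finset.card_compl, Fintype.card_fin] at h
  omega

end cycleChain

/-! ### A triangle with a pendant edge -/

/-- A triangle with a pendant edge at the vertex `1`. -/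
def paw : SimpleGraph (Fin 4) :=
  SimpleGraph.fromRel fun u v => (u = 0 ∧ v = 1) ∨ (u = 1 ∧ v = 2) ∨ (u = 1 ∧ v = 3) ∨ (u = 3 ∧ v = 2)

namespace paw

instance : DecidableRel paw.Adj := fun u v => by
  unfold paw
  rw [SimpleGraph.fromRel_adj]
  infer_instance

/-- The SPQ-tree of a triangle with a pendant edge. -/
def tree : SPQTree := .S 2 ![.Q, .P 2 ![.Q, .path]]

lemma maxDegree_eq : paw.maxDegree = 3 := by decide

lemma isTreeOf : tree.IsTreeOf paw 0 2 := by
  have h01 : paw.Adj 0 1 := by decide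
  have h12 : paw.Adj 1 2 := by decide
  have h13 : paw.Adj 1 3 := by decide
  have h32 : paw.Adj 3 2 := by decide
  have htop : (⊤ : paw.Subgraph) = paw.subgraphOfAdj h01 ⊔ (paw.subgraphOfAdj h12 ⊔
      (paw.subgraphOfAdj h13 ⊔ paw.subgraphOfAdj h32)) := by
    ext u v
    · simp only [SimpleGraph.Subgraph.verts_top, Set.mem_univ, SimpleGraph.Subgraph.verts_sup,
        SimpleGraph.subgraphOfAdj_verts, Set.mem_union, Set.mem_insert_iff, Set.mem_singleton_iff]
      revert u; decide
    · simp only [SimpleGraph.Subgraph.top_adj, SimpleGraph.Subgraph.sup_adj,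
        SimpleGraph.subgraphOfAdj_adj]
      revert u v; decide
  unfold SPQTree.IsTreeOf
  rw [htop]
  refine SPQTree.decomposes_S_two (m := 1) ⟨h01, rfl⟩ (SPQTree.decomposes_P_two ⟨h12, rfl⟩
    (SPQTree.path_decomposes h13 h32 (by decide)) ?_ ?_) ?_
  · ext u
    simp only [SimpleGraph.Subgraph.verts_sup, SimpleGraph.subgraphOfAdj_verts, Set.mem_inter_iff,
      Set.mem_union, Set.mem_insert_iff, Set.mem_singleton_iff]
    revert u; decide
  · simp only [SimpleGraph.Subgraph.sup_adj, SimpleGraph.subgraphOfAdj_adj]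
    decide
  · ext u
    simp only [SimpleGraph.Subgraph.verts_sup, SimpleGraph.subgraphOfAdj_verts, Set.mem_inter_iff,
      Set.mem_union, Set.mem_insert_iff, Set.mem_singleton_iff]
    revert u; decide

lemma reduced_tree : tree.Reduced := by
  simp [tree, SPQTree.path, SPQTree.Reduced, SPQTree.IsS, SPQTree.IsP, Fin.forall_fin_two]

lemma numPStar_tree : tree.numPStar = 0 := by
  simp [tree, SPQTree.numPStar, SPQTree.numPStar_path]

lemma isOuterplanar : IsOuterplanar paw := by
  refine ⟨fun u => ((u : ℕ) : ℝ), fun u v h => Fin.val_injective (Nat.cast_injective h), ?_⟩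
  simp only [Nat.cast_lt]
  decide

end paw

/-- The count of segments is attained for every number of `P`-nodes without `Q`-node child. -/
theorem exists_outerplanar_lower_bound (k : ℕ) :
    ∃ (n : ℕ) (G : SimpleGraph (Fin n)) (_ : DecidableRel G.Adj) (s t : Fin n) (T : SPQTree),
      G.maxDegree = 3 ∧ T.IsTreeOf G s t ∧ T.Reduced ∧ IsOuterplanar G ∧ T.numPStar = k ∧
      ∀ (Γ : OrthogonalDrawing G) (m : ℕ), Γ.CoveredBy m → k + 1 ≤ m := by
  classical
  rcases Nat.eq_zero_or_pos k with rfl | hk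
  -- The chain with `k = 0` is a single vertex, so a different graph has to provide the maximum
  -- degree three.
  · exact ⟨4, paw, inferInstance, 0, 2, paw.tree, paw.maxDegree_eq, paw.isTreeOf, paw.reduced_tree,
      paw.isOuterplanar, paw.numPStar_tree, fun Γ m hm => hm.one_le⟩
  · exact ⟨5 * k + 1, cycleChain k, Classical.decRel _, 0, Fin.last (5 * k), cycleChain.tree k,
      cycleChain.maxDegree_eq hk, cycleChain.isTreeOf hk, cycleChain.reduced_tree,
      cycleChain.isOuterplanar, cycleChain.numPStar_tree, fun Γ m hm => cycleChain.lt_of_coveredBy Γ hm⟩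

/-! ### Binary series-parallel compositions -/

/-- The number of neighbours of a vertex in a subgraph. -/
noncomputable def valency {V : Type*} {G : SimpleGraph V} (H : G.Subgraph) (v : V) : ℕ :=
  (H.neighborSet v).ncard

section Valency

variable {V : Type*} {G : SimpleGraph V}

lemma valency_sup [Finite V] {H₁ H₂ : G.Subgraph} (h : ∀ u v, H₁.Adj u v → ¬ H₂.Adj u v) (v : V) :
    valency (H₁ ⊔ H₂) v = valency H₁ v + valency H₂ v := by
  unfold valency
  rw [SimpleGraph.Subgraph.neighborSet_sup]
  exact Set.ncard_union_eq (Set.disjoint_left.2 fun w hw => h v w hw) (Set.toFinite _)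
    (Set.toFinite _)

lemma valency_eq_zero {H : G.Subgraph} {v : V} (h : v ∉ H.verts) : valency H v = 0 := by
  have : H.neighborSet v = ∅ := Set.eq_empty_of_forall_notMem fun w hw => h (H.edge_vert hw)
  rw [valency, this, Set.ncard_empty]

lemma valency_mono [Finite V] {H₁ H₂ : G.Subgraph} (h : H₁ ≤ H₂) (v : V) :
    valency H₁ v ≤ valency H₂ v :=
  Set.ncard_le_ncard (fun _ hw => h.2 hw) (Set.toFinite _)

lemma valency_pos [Finite V] {H : G.Subgraph} {v w : V} (h : H.Adj v w) : 1 ≤ valency H v :=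
  (Set.ncard_pos (Set.toFinite _)).2 ⟨w, h⟩

lemma eq_of_valency_eq_one {H : G.Subgraph} {v a b : V} (h : valency H v = 1) (ha : H.Adj v a)
    (hb : H.Adj v b) : a = b := by
  obtain ⟨c, hc⟩ := Set.ncard_eq_one.1 h
  have ha' : a ∈ H.neighborSet v := ha
  have hb' : b ∈ H.neighborSet v := hb
  rw [hc] at ha' hb'
  exact ha'.trans hb'.symm

lemma valency_subgraphOfAdj_left {s t : V} (h : G.Adj s t) :
    valency (G.subgraphOfAdj h) s = 1 := by
  rw [valency, SimpleGraph.neighborSet_fst_subgraphOfAdj, Set.ncard_singleton]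

lemma valency_subgraphOfAdj_right {s t : V} (h : G.Adj s t) :
    valency (G.subgraphOfAdj h) t = 1 := by
  rw [valency, SimpleGraph.neighborSet_snd_subgraphOfAdj, Set.ncard_singleton]

lemma not_adj_of_inter_eq_singleton {H₁ H₂ : G.Subgraph} {m : V} (h : H₁.verts ∩ H₂.verts = {m})
    (u v : V) (h₁ : H₁.Adj u v) : ¬ H₂.Adj u v := by
  intro h₂
  have hu : u ∈ H₁.verts ∩ H₂.verts := ⟨H₁.edge_vert h₁, H₂.edge_vert h₂⟩
  have hv : v ∈ H₁.verts ∩ H₂.verts := ⟨H₁.edge_vert h₁.symm, H₂.edge_vert h₂.symm⟩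
  rw [h] at hu hv
  exact h₁.ne (hu.trans hv.symm)

end Valency

/-- Series-parallel subgraphs built by binary compositions. The number counts the parallel
compositions other than those with a single edge. -/
inductive SeriesParallel {V : Type*} {G : SimpleGraph V} : G.Subgraph → V → V → ℕ → Prop
  | edge {s t : V} (h : G.Adj s t) : SeriesParallel (G.subgraphOfAdj h) s t 0
  | series {H₁ H₂ : G.Subgraph} {s m t : V} {k₁ k₂ : ℕ} (h₁ : SeriesParallel H₁ s m k₁)
      (h₂ : SeriesParallel H₂ m t k₂) (hv : H₁.verts ∩ H₂.verts = {m}) :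
      SeriesParallel (H₁ ⊔ H₂) s t (k₁ + k₂)
  | par {H₁ H₂ : G.Subgraph} {s t : V} {k₁ k₂ : ℕ} (h₁ : SeriesParallel H₁ s t k₁)
      (h₂ : SeriesParallel H₂ s t k₂) (hv : H₁.verts ∩ H₂.verts = {s, t})
      (he : ∀ u v, H₁.Adj u v → ¬ H₂.Adj u v) : SeriesParallel (H₁ ⊔ H₂) s t (k₁ + k₂ + 1)
  | parEdge {H : G.Subgraph} {s t : V} {k : ℕ} (h₁ : SeriesParallel H s t k) (h : G.Adj s t)
      (he : ¬ H.Adj s t) : SeriesParallel (H ⊔ G.subgraphOfAdj h) s t k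

namespace SeriesParallel

variable {V : Type*} {G : SimpleGraph V} {H : G.Subgraph} {s t : V} {k : ℕ}

lemma terminals (h : SeriesParallel H s t k) : s ∈ H.verts ∧ t ∈ H.verts ∧ s ≠ t := by
  induction h with
  | edge h => exact ⟨by simp, by simp, h.ne⟩
  | @series H₁ H₂ s m t k₁ k₂ h₁ h₂ hv ih₁ ih₂ =>
    refine ⟨Or.inl ih₁.1, Or.inr ih₂.2.1, ?_⟩
    rintro rfl
    have : s ∈ H₁.verts ∩ H₂.verts := ⟨ih₁.1, ih₂.2.1⟩
    rw [hv] at this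
    exact ih₁.2.2 this
  | par h₁ h₂ hv he ih₁ ih₂ => exact ⟨Or.inl ih₁.1, Or.inl ih₁.2.1, ih₁.2.2⟩
  | parEdge h₁ h he ih => exact ⟨Or.inl ih.1, Or.inl ih.2.1, ih.2.2⟩

/-- Needed for drawings as well as for degrees: a `Layout` keeps runs away from a vertex only
through conditions on the edges at that vertex. -/
lemma exists_adj (h : SeriesParallel H s t k) {v : V} (hv : v ∈ H.verts) : ∃ w, H.Adj v w := by
  induction h with
  | edge h =>
    simp only [SimpleGraph.subgraphOfAdj_verts, Set.mem_insert_iff, Set.mem_singleton_iff] at hv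
    rcases hv with rfl | rfl
    · exact ⟨_, SimpleGraph.subgraphOfAdj_adj_self h⟩
    · exact ⟨_, (SimpleGraph.subgraphOfAdj_adj_self h).symm⟩
  | series h₁ h₂ _ ih₁ ih₂ | par h₁ h₂ _ _ ih₁ ih₂ =>
    rcases hv with hv | hv
    · obtain ⟨w, hw⟩ := ih₁ hv
      exact ⟨w, Or.inl hw⟩
    · obtain ⟨w, hw⟩ := ih₂ hv
      exact ⟨w, Or.inr hw⟩
  | parEdge h₁ h he ih =>
    rcases hv with hv | hv
    · obtain ⟨w, hw⟩ := ih hv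
      exact ⟨w, Or.inl hw⟩
    · simp only [SimpleGraph.subgraphOfAdj_verts, Set.mem_insert_iff, Set.mem_singleton_iff] at hv
      rcases hv with rfl | rfl
      · exact ⟨_, Or.inr (SimpleGraph.subgraphOfAdj_adj_self h)⟩
      · exact ⟨_, Or.inr (SimpleGraph.subgraphOfAdj_adj_self h).symm⟩

lemma one_le_left [Finite V] (h : SeriesParallel H s t k) : 1 ≤ valency H s := by
  obtain ⟨w, hw⟩ := h.exists_adj h.terminals.1
  exact valency_pos hw

lemma one_le_right [Finite V] (h : SeriesParallel H s t k) : 1 ≤ valency H t := by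
  obtain ⟨w, hw⟩ := h.exists_adj h.terminals.2.1
  exact valency_pos hw

lemma symm (h : SeriesParallel H s t k) : SeriesParallel H t s k := by
  induction h with
  | edge h => rw [← SimpleGraph.subgraphOfAdj_symm]; exact edge h.symm
  | series h₁ h₂ hv ih₁ ih₂ =>
    rw [sup_comm, add_comm]
    exact series ih₂ ih₁ (by rw [Set.inter_comm]; exact hv)
  | par h₁ h₂ hv he ih₁ ih₂ => exact par ih₁ ih₂ (by rw [hv, Set.pair_comm]) he
  | parEdge h₁ h he ih =>
    rw [← SimpleGraph.subgraphOfAdj_symm]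
    exact parEdge ih h.symm fun h' => he h'.symm

end SeriesParallel

/-! ### Combinatorial layouts -/

section Layout

variable {V : Type*} {G : SimpleGraph V}

/-- Integer data of an orthogonal drawing in which the edge `uv` leaves `u` and `v` vertically, and
runs horizontally at the height `m s(u, v)` between them. The conditions say that different vertices
have different abscissae, that the horizontal parts of different edges do not overlap, and that no
vertical part meets a horizontal part. -/
structure Layout (H : G.Subgraph) (x y : V → ℤ) (m : Sym2 V → ℤ) : Prop where
  inj : ∀ u ∈ H.verts, ∀ v ∈ H.verts, x u = x v → u = v
  runs : ∀ a b c d, H.Adj a b → H.Adj c d → x a < x b → x c < x d → m s(a, b) = m s(c, d) →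
    x a < x d → x c < x b → s(a, b) = s(c, d)
  cross : ∀ w v a b, H.Adj w v → H.Adj a b → x a < x w → x w < x b →
    (m s(a, b) < y w ∧ m s(a, b) < m s(w, v)) ∨ (y w < m s(a, b) ∧ m s(w, v) < m s(a, b))

/-- One of two edges at `w` does not go down from `w`, the other one does not go up. -/
def OppositeStubs (y : V → ℤ) (m : Sym2 V → ℤ) (w a b : V) : Prop :=
  (m s(w, a) ≤ y w ∧ y w ≤ m s(w, b)) ∨ (m s(w, b) ≤ y w ∧ y w ≤ m s(w, a))

/-- The vertical parts of different edges at a vertex do not overlap. -/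
def Stubs (H : G.Subgraph) (y : V → ℤ) (m : Sym2 V → ℤ) : Prop :=
  ∀ w a b, H.Adj w a → H.Adj w b → a ≠ b → OppositeStubs y m w a b

/-- Consecutive vertices of the same height are joined by a straight edge. -/
def Straight (H : G.Subgraph) (x y : V → ℤ) (m : Sym2 V → ℤ) : Prop :=
  ∀ v ∈ H.verts, ∀ w ∈ H.verts, y w = y v → x w < x v →
    ∃ u, H.Adj u v ∧ x w ≤ x u ∧ x u < x v ∧ y u = y v ∧ m s(u, v) = y v

/-- `s` is the leftmost vertex, at height `0`, and its edges do not go up; a single edge is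
straight. -/
structure LeftEnd (H : G.Subgraph) (x y : V → ℤ) (m : Sym2 V → ℤ) (s : V) : Prop where
  lt : ∀ v ∈ H.verts, v ≠ s → x s < x v
  height : y s = 0
  nonpos : ∀ v, H.Adj s v → m s(s, v) ≤ 0
  straight : valency H s = 1 → ∀ v, H.Adj s v → m s(s, v) = 0

/-- Only the order of abscissae and the order of heights, up to reversal, matter. A leftmost or
rightmost vertex may get any height, as no run passes above or below it; this allows a terminal to
be moved in a parallel composition. -/
lemma Layout.map {H : G.Subgraph} {x y : V → ℤ} {m : Sym2 V → ℤ} (h : Layout H x y m)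
    {x' y' : V → ℤ} {m' : Sym2 V → ℤ} {φ : ℤ → ℤ} (hφ : StrictMono φ ∨ StrictAnti φ)
    (hx : ∀ u ∈ H.verts, ∀ v ∈ H.verts, x u < x v → x' u < x' v)
    (hm : ∀ u v, H.Adj u v → m' s(u, v) = φ (m s(u, v)))
    (hy : ∀ u ∈ H.verts, y' u = φ (y u) ∨ (∀ v ∈ H.verts, v ≠ u → x u < x v) ∨
      (∀ v ∈ H.verts, v ≠ u → x v < x u)) :
    Layout H x' y' m' := by
  have hinj : Function.Injective φ := hφ.elim StrictMono.injective StrictAnti.injective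
  have hx' : ∀ u ∈ H.verts, ∀ v ∈ H.verts, x' u < x' v → x u < x v := by
    intro u hu v hv huv
    rcases lt_trichotomy (x u) (x v) with h1 | h1 | h1
    · exact h1
    · rw [h.inj u hu v hv h1] at huv
      exact absurd huv (lt_irrefl _)
    · exact absurd huv (hx v hv u hu h1).not_gt
  have hv : ∀ {u v}, H.Adj u v → u ∈ H.verts ∧ v ∈ H.verts := fun h =>
    ⟨H.edge_vert h, H.edge_vert h.symm⟩
  refine ⟨?_, ?_, ?_⟩
  · intro u hu v hv huv
    rcases lt_trichotomy (x u) (x v) with h1 | h1 | h1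
    · exact absurd huv (hx u hu v hv h1).ne
    · exact h.inj u hu v hv h1
    · exact absurd huv (hx v hv u hu h1).ne'
  · intro a b c d hab hcd h1 h2 h3 h4 h5
    rw [hm a b hab, hm c d hcd] at h3
    exact h.runs a b c d hab hcd (hx' _ (hv hab).1 _ (hv hab).2 h1) (hx' _ (hv hcd).1 _ (hv hcd).2 h2)
      (hinj h3) (hx' _ (hv hab).1 _ (hv hcd).2 h4) (hx' _ (hv hcd).1 _ (hv hab).2 h5)
  · intro w v a b hwv hab h1 h2
    have h1 := hx' _ (hv hab).1 _ (hv hwv).1 h1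
    have h2 := hx' _ (hv hwv).1 _ (hv hab).2 h2
    rcases hy w (hv hwv).1 with h3 | h3 | h3
    · rw [hm w v hwv, hm a b hab, h3]
      have := h.cross w v a b hwv hab h1 h2
      rcases hφ with hφ | hφ
      · exact this.imp (fun h => ⟨hφ h.1, hφ h.2⟩) (fun h => ⟨hφ h.1, hφ h.2⟩)
      · exact this.symm.imp (fun h => ⟨hφ h.1, hφ h.2⟩) (fun h => ⟨hφ h.1, hφ h.2⟩)
    · exact absurd h1 (h3 a (hv hab).1 (fun e => by rw [e] at h1; exact lt_irrefl _ h1)).not_gt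
    · exact absurd h2 (h3 b (hv hab).2 (fun e => by rw [e] at h2; exact lt_irrefl _ h2)).not_gt

/-- Stated for one pair `v`, `w` whose heights follow `φ`. The vertex `u` found between them may be
a moved extreme vertex, but only if it is `w` itself. -/
lemma Straight.map {H : G.Subgraph} {x y : V → ℤ} {m : Sym2 V → ℤ} (hl : Layout H x y m)
    (h : Straight H x y m) {x' y' : V → ℤ} {m' : Sym2 V → ℤ} {φ : ℤ → ℤ}
    (hφ : Function.Injective φ)
    (hx : ∀ u ∈ H.verts, ∀ v ∈ H.verts, x u < x v → x' u < x' v)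
    (hm : ∀ u v, H.Adj u v → m' s(u, v) = φ (m s(u, v)))
    (hy : ∀ u ∈ H.verts, y' u = φ (y u) ∨ (∀ v ∈ H.verts, v ≠ u → x u < x v) ∨
      (∀ v ∈ H.verts, v ≠ u → x v < x u)) {v w : V} (hv : v ∈ H.verts) (hw : w ∈ H.verts)
    (hyv : y' v = φ (y v)) (hyw : y' w = φ (y w)) (hvw : y' w = y' v) (hxvw : x' w < x' v) :
    ∃ u, H.Adj u v ∧ x' w ≤ x' u ∧ x' u < x' v ∧ y' u = y' v ∧ m' s(u, v) = y' v := by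
  have hx' : x w < x v := by
    rcases lt_trichotomy (x w) (x v) with h1 | h1 | h1
    · exact h1
    · rw [hl.inj w hw v hv h1] at hxvw
      exact absurd hxvw (lt_irrefl _)
    · exact absurd hxvw (hx v hv w hw h1).not_gt
  obtain ⟨u, huv, h1, h2, h3, h4⟩ := h v hv w hw (hφ (by rw [← hyw, ← hyv, hvw])) hx'
  have hu := H.edge_vert huv
  refine ⟨u, huv, ?_, hx u hu v hv h2, ?_, ?_⟩
  · rcases h1.lt_or_eq with h1 | h1
    · exact (hx w hw u hu h1).le
    · rw [hl.inj w hw u hu h1]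
  · rcases hy u hu with h5 | h5 | h5
    · rw [h5, h3, hyv]
    · have : w = u := by
        by_contra hne
        exact absurd h1 (h5 w hw hne).not_ge
      rw [← this, hvw]
    · have hne : v ≠ u := fun e => by rw [e] at h2; exact lt_irrefl _ h2
      exact absurd h2 (h5 v hv hne).not_gt
  · rw [hm u v huv, h4, hyv]

lemma Layout.sup {H₁ H₂ : G.Subgraph} {x y : V → ℤ} {m : Sym2 V → ℤ} (h₁ : Layout H₁ x y m)
    (h₂ : Layout H₂ x y m)
    (inj : ∀ u ∈ H₁.verts, ∀ v ∈ H₂.verts, x u = x v → u = v)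
    (runs : ∀ a b c d, H₁.Adj a b → H₂.Adj c d → x a < x b → x c < x d → m s(a, b) = m s(c, d) →
      x a < x d → x c < x b → False)
    (cross₁ : ∀ w v a b, H₁.Adj w v → H₂.Adj a b → x a < x w → x w < x b →
      (m s(a, b) < y w ∧ m s(a, b) < m s(w, v)) ∨ (y w < m s(a, b) ∧ m s(w, v) < m s(a, b)))
    (cross₂ : ∀ w v a b, H₂.Adj w v → H₁.Adj a b → x a < x w → x w < x b →
      (m s(a, b) < y w ∧ m s(a, b) < m s(w, v)) ∨ (y w < m s(a, b) ∧ m s(w, v) < m s(a, b))) :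
    Layout (H₁ ⊔ H₂) x y m := by
  refine ⟨?_, ?_, ?_⟩
  · rintro u (hu | hu) v (hv | hv) huv
    · exact h₁.inj u hu v hv huv
    · exact inj u hu v hv huv
    · exact (inj v hv u hu huv.symm).symm
    · exact h₂.inj u hu v hv huv
  · rintro a b c d (hab | hab) (hcd | hcd) h1 h2 h3 h4 h5
    · exact h₁.runs a b c d hab hcd h1 h2 h3 h4 h5
    · exact (runs a b c d hab hcd h1 h2 h3 h4 h5).elim
    · exact (runs c d a b hcd hab h2 h1 h3.symm h5 h4).elim
    · exact h₂.runs a b c d hab hcd h1 h2 h3 h4 h5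
  · rintro w v a b (hwv | hwv) (hab | hab) h1 h2
    · exact h₁.cross w v a b hwv hab h1 h2
    · exact cross₁ w v a b hwv hab h1 h2
    · exact cross₂ w v a b hwv hab h1 h2
    · exact h₂.cross w v a b hwv hab h1 h2

/-- A layout of a two-terminal graph in which the vertices have at most `k` heights besides `0`. -/
structure IsDrawn (H : G.Subgraph) (s t : V) (k : ℕ) (x y : V → ℤ) (m : Sym2 V → ℤ)
    (L : Finset ℤ) : Prop where
  layout : Layout H x y m
  stubs : Stubs H y m
  straight : Straight H x y m
  left : valency H s ≤ 2 → LeftEnd H x y m s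
  right : valency H t ≤ 2 → LeftEnd H (fun v => -x v) y m t
  heights : ∀ v ∈ H.verts, y v = 0 ∨ y v ∈ L
  card_le : L.card ≤ k

lemma isDrawn_edge {s t : V} (h : G.Adj s t) :
    ∃ x y m L, IsDrawn (G.subgraphOfAdj h) s t 0 x y m L := by
  classical
  have hts := h.ne'
  refine ⟨fun v => if v = s then 0 else 1, fun _ => 0, fun _ => 0, ∅, ⟨?_, ?_, ?_⟩, ?_, ?_, ?_, ?_,
    ?_, ?_⟩
  · rintro u (rfl | rfl) v (rfl | rfl) <;> simp [hts]
  · rintro a b c d hab hcd - - - - -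
    exact Eq.trans (Eq.symm hab) hcd
  · intro w v a b _ _ h1 h2
    split_ifs at h1 h2 <;> omega
  · intro w a b _ _ _
    exact Or.inl ⟨le_rfl, le_rfl⟩
  · intro v hv w hw _ hwv
    simp only at hwv
    have hws : w = s := by
      by_contra hne
      rw [if_neg hne] at hwv
      split_ifs at hwv <;> omega
    have hvs : v ≠ s := by
      rintro rfl
      rw [if_pos rfl, if_pos hws] at hwv
      omega
    have hvt : v = t := by
      rcases hv with hv | hv
      · exact absurd hv hvs
      · exact hv
    subst hws hvt
    exact ⟨w, SimpleGraph.subgraphOfAdj_adj_self h, le_rfl, hwv, rfl, rfl⟩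
  · refine fun _ => ⟨?_, rfl, fun _ _ => le_rfl, fun _ _ _ => rfl⟩
    intro v _ hv
    simp [hv]
  · refine fun _ => ⟨?_, rfl, fun _ _ => le_rfl, fun _ _ _ => rfl⟩
    rintro v (rfl | rfl) hv
    · simp [hts]
    · exact absurd rfl hv
  · exact fun _ _ => Or.inl rfl
  · simp

end Layout

/-! ### Series composition of layouts -/

section Composition

variable {V : Type*} {G : SimpleGraph V}

lemma exists_abs_le {α : Type*} [Finite α] (f : α → ℤ) : ∃ N, 0 ≤ N ∧ ∀ a, -N ≤ f a ∧ f a ≤ N := by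
  obtain ⟨B, hB⟩ := (Set.finite_range fun a => |f a|).bddAbove
  refine ⟨max B 0, le_max_right _ _, fun a => ?_⟩
  have h : |f a| ≤ B := hB ⟨a, rfl⟩
  exact abs_le.1 (h.trans (le_max_left _ _))

/-- Stretching the integers by moving the non-zero ones away from zero. -/
def stretch (N z : ℤ) : ℤ := if 0 < z then z + N else if z < 0 then z - N else 0

lemma stretch_spec (N z : ℤ) : (0 < z ∧ stretch N z = z + N) ∨ (z < 0 ∧ stretch N z = z - N) ∨
    (z = 0 ∧ stretch N z = 0) := by
  unfold stretch
  split_ifs <;> omega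

lemma strictMono_stretch {N : ℤ} (hN : 0 ≤ N) : StrictMono (stretch N) := by
  intro a b hab
  have := stretch_spec N a
  have := stretch_spec N b
  omega

lemma stubs_congr {y y' : V → ℤ} {m m' : Sym2 V → ℤ} {φ : ℤ → ℤ} (hφ : StrictMono φ ∨ StrictAnti φ)
    {w a b : V} (hy : y' w = φ (y w)) (ha : m' s(w, a) = φ (m s(w, a)))
    (hb : m' s(w, b) = φ (m s(w, b))) (h : OppositeStubs y m w a b) :
    OppositeStubs y' m' w a b := by
  unfold OppositeStubs at h ⊢
  rw [hy, ha, hb]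
  rcases hφ with hφ | hφ
  · simpa only [hφ.le_iff_le] using h
  · simp only [hφ.le_iff_ge]
    tauto

/-- The degree bound at `p` makes `p` an end at height `0` of both layouts, so these can be put side
by side. Height `0` is shared, hence the numbers of other heights just add up. -/
lemma IsDrawn.series [Finite V] {H₁ H₂ : G.Subgraph} {s p t : V} {k₁ k₂ : ℕ}
    (sp₁ : SeriesParallel H₁ s p k₁) (sp₂ : SeriesParallel H₂ p t k₂)
    (hv : H₁.verts ∩ H₂.verts = {p}) (hp : valency (H₁ ⊔ H₂) p ≤ 3)
    {x₁ y₁ x₂ y₂ : V → ℤ} {m₁ m₂ : Sym2 V → ℤ} {L₁ L₂ : Finset ℤ}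
    (h₁ : IsDrawn H₁ s p k₁ x₁ y₁ m₁ L₁) (h₂ : IsDrawn H₂ p t k₂ x₂ y₂ m₂ L₂) :
    ∃ x y m L, IsDrawn (H₁ ⊔ H₂) s t (k₁ + k₂) x y m L := by
  classical
  have hadj := not_adj_of_inter_eq_singleton hv
  have hval := valency_sup hadj
  have hp₁ := sp₁.one_le_right
  have hp₂ := sp₂.one_le_left
  have hr := h₁.right (by have := hval p; omega)
  have hl := h₂.left (by have := hval p; omega)
  have hpm₁ := sp₁.terminals.2.1
  have hpm₂ := sp₂.terminals.1
  have hmeet : ∀ v, v ∈ H₁.verts → v ∈ H₂.verts → v = p := fun v h h' => by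
    have : v ∈ H₁.verts ∩ H₂.verts := ⟨h, h'⟩
    rwa [hv] at this
  -- Stretching by `N` moves the non-zero heights of `H₂` out of `[-N, N]`, so they differ from all
  -- heights of `H₁`, while `0` stays fixed.
  obtain ⟨N, hN0, hN⟩ := exists_abs_le y₁
  have hφ := strictMono_stretch hN0
  have hφ0 : stretch N 0 = 0 := by simp [stretch]
  obtain ⟨x, hx⟩ : ∃ x : V → ℤ, ∀ v, x v = if v ∈ H₁.verts then x₁ v else x₂ v - x₂ p + x₁ p :=
    ⟨_, fun _ => rfl⟩
  obtain ⟨y, hy⟩ : ∃ y : V → ℤ, ∀ v, y v = if v ∈ H₁.verts then y₁ v else stretch N (y₂ v) :=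
    ⟨_, fun _ => rfl⟩
  obtain ⟨m, hm⟩ : ∃ m : Sym2 V → ℤ, ∀ e, m e = if e ∈ H₁.edgeSet then m₁ e else stretch N (m₂ e) :=
    ⟨_, fun _ => rfl⟩
  have hx₁ : ∀ v ∈ H₁.verts, x v = x₁ v := fun v hv => by rw [hx, if_pos hv]
  have hy₁ : ∀ v ∈ H₁.verts, y v = y₁ v := fun v hv => by rw [hy, if_pos hv]
  have hm₁ : ∀ u v, H₁.Adj u v → m s(u, v) = m₁ s(u, v) := fun u v h => by
    rw [hm, if_pos (SimpleGraph.Subgraph.mem_edgeSet.2 h)]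
  have hx₂ : ∀ v ∈ H₂.verts, x v = x₂ v - x₂ p + x₁ p := fun v hv => by
    rw [hx]
    split_ifs with h
    · rw [hmeet v h hv]; ring
    · rfl
  have hy₂ : ∀ v ∈ H₂.verts, y v = stretch N (y₂ v) := fun v hv => by
    rw [hy]
    split_ifs with h
    · rw [hmeet v h hv, hr.height, hl.height, hφ0]
    · rfl
  have hm₂ : ∀ u v, H₂.Adj u v → m s(u, v) = stretch N (m₂ s(u, v)) := fun u v h => by
    rw [hm, if_neg fun h' => hadj u v (SimpleGraph.Subgraph.mem_edgeSet.1 h') h]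
  have hle₁ : ∀ v ∈ H₁.verts, x v ≤ x p := fun v hv => by
    by_cases e : v = p
    · rw [e]
    · have := hr.lt v hv e
      rw [hx₁ v hv, hx₁ p hpm₁]
      omega
  have hle₂ : ∀ v ∈ H₂.verts, x p ≤ x v := fun v hv => by
    by_cases e : v = p
    · rw [e]
    · have := hl.lt v hv e
      rw [hx₂ v hv, hx₂ p hpm₂]
      omega
  have mono₁ : ∀ u ∈ H₁.verts, ∀ v ∈ H₁.verts, x₁ u < x₁ v → x u < x v := fun u hu v hv h => by
    rw [hx₁ u hu, hx₁ v hv]; exact h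
  have mono₂ : ∀ u ∈ H₂.verts, ∀ v ∈ H₂.verts, x₂ u < x₂ v → x u < x v := fun u hu v hv h => by
    rw [hx₂ u hu, hx₂ v hv]; omega
  have lay₁ : Layout H₁ x y m := h₁.layout.map (φ := id) (Or.inl strictMono_id) mono₁ hm₁
    fun u hu => Or.inl (hy₁ u hu)
  have lay₂ : Layout H₂ x y m := h₂.layout.map (Or.inl hφ) mono₂ hm₂ fun u hu => Or.inl (hy₂ u hu)
  have hinj : ∀ u ∈ H₁.verts, ∀ v ∈ H₂.verts, x u = x v → u = v := fun u hu v hv huv => by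
    have h1 := hle₁ u hu
    have h2 := hle₂ v hv
    rw [lay₁.inj u hu p hpm₁ (by omega), lay₂.inj v hv p hpm₂ (by omega)]
  have hs : valency (H₁ ⊔ H₂) s = valency H₁ s := by
    rw [hval, valency_eq_zero (H := H₂), add_zero]
    exact fun h => sp₁.terminals.2.2 (hmeet s sp₁.terminals.1 h)
  have ht : valency (H₁ ⊔ H₂) t = valency H₂ t := by
    rw [hval, valency_eq_zero (H := H₁), zero_add]
    exact fun h => sp₂.terminals.2.2 (hmeet t h sp₂.terminals.2.1).symm
  refine ⟨x, y, m, L₁ ∪ L₂.image (stretch N), ⟨?_, ?_, ?_, ?_, ?_, ?_, ?_⟩⟩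
  · refine lay₁.sup lay₂ hinj ?_ ?_ ?_
    · intro a b c d hab hcd h1 h2 h3 h4 h5
      have := hle₁ b (H₁.edge_vert hab.symm)
      have := hle₂ c (H₂.edge_vert hcd)
      omega
    · intro w v a b hwv hab h1 h2
      have := hle₁ w (H₁.edge_vert hwv)
      have := hle₂ a (H₂.edge_vert hab)
      omega
    · intro w v a b hwv hab h1 h2
      have := hle₂ w (H₂.edge_vert hwv)
      have := hle₁ b (H₁.edge_vert hab.symm)
      omega
  -- At `p` one of the graphs has a single edge, which leaves horizontally, and the edges of the
  -- other graph do not go up.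
  · have key : ∀ w a b, H₁.Adj w a → H₂.Adj w b → OppositeStubs y m w a b := by
      intro w a b ha hb
      obtain rfl := hmeet w (H₁.edge_vert ha) (H₂.edge_vert hb)
      unfold OppositeStubs
      have e1 := hr.nonpos a ha
      have e2 := hl.nonpos b hb
      have e3 := stretch_spec N (m₂ s(w, b))
      rw [hm₁ _ _ ha, hm₂ _ _ hb, hy₁ w hpm₁, hr.height]
      have := hval w
      rcases (by omega : valency H₁ w = 1 ∨ valency H₂ w = 1) with h | h
      · have := hr.straight h a ha
        omega
      · have := hl.straight h b hb
        omega
    rintro w a b (ha | ha) (hb | hb) hab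
    · exact stubs_congr (φ := id) (Or.inl strictMono_id) (hy₁ w (H₁.edge_vert ha)) (hm₁ _ _ ha)
        (hm₁ _ _ hb) (h₁.stubs w a b ha hb hab)
    · exact key w a b ha hb
    · exact (key w b a hb ha).symm
    · exact stubs_congr (Or.inl hφ) (hy₂ w (H₂.edge_vert ha)) (hm₂ _ _ ha)
        (hm₂ _ _ hb) (h₂.stubs w a b ha hb hab)
  · have s₁ : ∀ v ∈ H₁.verts, ∀ w ∈ H₁.verts, y w = y v → x w < x v →
        ∃ u, (H₁ ⊔ H₂).Adj u v ∧ x w ≤ x u ∧ x u < x v ∧ y u = y v ∧ m s(u, v) = y v := by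
      intro v hv w hw hwv hx
      obtain ⟨u, hu, h⟩ := h₁.straight.map h₁.layout (φ := id) Function.injective_id mono₁ hm₁
        (fun u hu => Or.inl (hy₁ u hu)) hv hw (hy₁ v hv) (hy₁ w hw) hwv hx
      exact ⟨u, Or.inl hu, h⟩
    have s₂ : ∀ v ∈ H₂.verts, ∀ w ∈ H₂.verts, y w = y v → x w < x v →
        ∃ u, (H₁ ⊔ H₂).Adj u v ∧ x w ≤ x u ∧ x u < x v ∧ y u = y v ∧ m s(u, v) = y v := by
      intro v hv w hw hwv hx
      obtain ⟨u, hu, h⟩ := h₂.straight.map h₂.layout hφ.injective mono₂ hm₂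
        (fun u hu => Or.inl (hy₂ u hu)) hv hw (hy₂ v hv) (hy₂ w hw) hwv hx
      exact ⟨u, Or.inr hu, h⟩
    rintro v (hv₁ | hv₂) w (hw₁ | hw₂) hwv hxwv
    · exact s₁ v hv₁ w hw₁ hwv hxwv
    · have := hle₁ v hv₁
      have := hle₂ w hw₂
      omega
    -- Vertices of equal height in different parts have height `0`, so `p` lies between them on the
    -- same level and the question is reduced to one part.
    · have e1 := hN w
      have e2 := stretch_spec N (y₂ v)
      have e3 := hy₁ w hw₁
      have e4 := hy₂ v hv₂
      have e5 : y p = 0 := by rw [hy₁ p hpm₁, hr.height]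
      have e6 : y v = 0 := by omega
      have e7 := hle₁ w hw₁
      rcases (hle₂ v hv₂).lt_or_eq with h | h
      · obtain ⟨u, hu, h1, h2⟩ := s₂ v hv₂ p hpm₂ (by rw [e5, e6]) h
        exact ⟨u, hu, e7.trans h1, h2⟩
      · have : v = p := (lay₂.inj p hpm₂ v hv₂ h).symm
        subst this
        exact s₁ v hpm₁ w hw₁ hwv hxwv
    · exact s₂ v hv₂ w hw₂ hwv hxwv
  · intro h
    rw [hs] at h
    have hl' := h₁.left h
    have hsm := sp₁.terminals.1
    have hnot : ∀ v, ¬ H₂.Adj s v := fun v h =>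
      sp₁.terminals.2.2 (hmeet s hsm (H₂.edge_vert h))
    refine ⟨?_, ?_, ?_, ?_⟩
    · have hlt : ∀ v ∈ H₁.verts, v ≠ s → x s < x v := fun v hv hvs => by
        rw [hx₁ s hsm, hx₁ v hv]; exact hl'.lt v hv hvs
      rintro v (hv | hv) hvs
      · exact hlt v hv hvs
      · exact (hlt p hpm₁ sp₁.terminals.2.2.symm).trans_le (hle₂ v hv)
    · rw [hy₁ s hsm, hl'.height]
    · rintro v (hv | hv)
      · rw [hm₁ _ _ hv]; exact hl'.nonpos v hv
      · exact absurd hv (hnot v)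
    · rw [hs]
      rintro h v (hv | hv)
      · rw [hm₁ _ _ hv]; exact hl'.straight h v hv
      · exact absurd hv (hnot v)
  · intro h
    rw [ht] at h
    have hr' := h₂.right h
    have htm := sp₂.terminals.2.1
    have hnot : ∀ v, ¬ H₁.Adj t v := fun v h =>
      sp₂.terminals.2.2 (hmeet t (H₁.edge_vert h) htm).symm
    refine ⟨?_, ?_, ?_, ?_⟩
    · have hlt : ∀ v ∈ H₂.verts, v ≠ t → x v < x t := fun v hv hvs => by
        have := hr'.lt v hv hvs
        rw [hx₂ t htm, hx₂ v hv]
        omega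
      rintro v (hv | hv) hvs
      · exact neg_lt_neg ((hle₁ v hv).trans_lt (hlt p hpm₂ sp₂.terminals.2.2))
      · exact neg_lt_neg (hlt v hv hvs)
    · rw [hy₂ t htm, hr'.height, hφ0]
    · rintro v (hv | hv)
      · exact absurd hv (hnot v)
      · rw [hm₂ _ _ hv]
        have := hr'.nonpos v hv
        have := stretch_spec N (m₂ s(t, v))
        omega
    · rw [ht]
      rintro h v (hv | hv)
      · exact absurd hv (hnot v)
      · rw [hm₂ _ _ hv, hr'.straight h v hv, hφ0]
  · rintro v (hv | hv)
    · rw [hy₁ v hv]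
      exact (h₁.heights v hv).imp id fun h => Finset.mem_union_left _ h
    · rw [hy₂ v hv]
      rcases h₂.heights v hv with h | h
      · left; rw [h, hφ0]
      · right; exact Finset.mem_union_right _ (Finset.mem_image_of_mem _ h)
  · exact (Finset.card_union_le _ _).trans
      (add_le_add h₁.card_le (Finset.card_image_le.trans h₂.card_le))

end Composition

/-! ### Parallel composition, and existence of layouts -/

section Composition

variable {V : Type*} {G : SimpleGraph V}

/-- The edges at a common terminal of two parallel graphs, the first one mirrored and the second one
moved down by `K`, do not overlap, if the terminal is placed suitably. -/
lemma stubs_par [Finite V] {H₁ H₂ : G.Subgraph} {s : V} {x₁ y₁ x₂ y₂ y : V → ℤ} {m₁ m₂ m : Sym2 V → ℤ}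
    {K : ℤ} (hK : 0 ≤ K) (l₁ : LeftEnd H₁ x₁ y₁ m₁ s) (l₂ : LeftEnd H₂ x₂ y₂ m₂ s)
    (hs : (valency H₂ s = 1 ∧ y s = 0) ∨ (valency H₁ s = 1 ∧ y s = -K))
    (hm₁ : ∀ u v, H₁.Adj u v → m s(u, v) = -m₁ s(u, v))
    (hm₂ : ∀ u v, H₂.Adj u v → m s(u, v) = m₂ s(u, v) - K)
    (st₁ : Stubs H₁ y₁ m₁) (st₂ : Stubs H₂ y₂ m₂) (a b : V) (ha : (H₁ ⊔ H₂).Adj s a)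
    (hb : (H₁ ⊔ H₂).Adj s b) (hab : a ≠ b) : OppositeStubs y m s a b := by
  have key : ∀ a b, H₁.Adj s a → H₂.Adj s b → OppositeStubs y m s a b := by
    intro a b ha hb
    have e1 := l₁.nonpos a ha
    have e2 := l₂.nonpos b hb
    unfold OppositeStubs
    rw [hm₁ _ _ ha, hm₂ _ _ hb]
    rcases hs with ⟨h, hy⟩ | ⟨h, hy⟩
    · have := l₂.straight h b hb
      omega
    · have := l₁.straight h a ha
      omega
  rcases ha with ha | ha <;> rcases hb with hb | hb
  · have e := st₁ s a b ha hb hab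
    unfold OppositeStubs at e ⊢
    rw [hm₁ _ _ ha, hm₁ _ _ hb]
    rw [l₁.height] at e
    rcases hs with ⟨h, hy⟩ | ⟨h, hy⟩
    · omega
    · exact absurd (eq_of_valency_eq_one h ha hb) hab
  · exact key a b ha hb
  · exact (key b a hb ha).symm
  · have e := st₂ s a b ha hb hab
    unfold OppositeStubs at e ⊢
    rw [hm₂ _ _ ha, hm₂ _ _ hb]
    rw [l₂.height] at e
    rcases hs with ⟨h, hy⟩ | ⟨h, hy⟩
    · exact absurd (eq_of_valency_eq_one h ha hb) hab
    · omega

/-- `H₁` is turned upside down and `H₂` is moved below it. `M` contains the heights of `H₂` that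
really occur as new ones: those of its inner vertices, and `0`, its base line, if some terminal has
to go down to it. Keeping `M` variable covers a single edge, where it is empty. -/
lemma IsDrawn.parallel [Finite V] {H₁ H₂ : G.Subgraph} {s t : V} {k₁ k₂ : ℕ}
    (sp₁ : SeriesParallel H₁ s t k₁) (sp₂ : SeriesParallel H₂ s t k₂)
    (hi : H₁.verts ∩ H₂.verts = {s, t}) (hadj : ∀ u v, H₁.Adj u v → ¬ H₂.Adj u v)
    (hs : valency (H₁ ⊔ H₂) s ≤ 3) (ht : valency (H₁ ⊔ H₂) t ≤ 3)
    {x₁ y₁ x₂ y₂ : V → ℤ} {m₁ m₂ : Sym2 V → ℤ} {L₁ L₂ : Finset ℤ}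
    (h₁ : IsDrawn H₁ s t k₁ x₁ y₁ m₁ L₁) (h₂ : IsDrawn H₂ s t k₂ x₂ y₂ m₂ L₂) (M : Finset ℤ)
    (hM : ∀ v ∈ H₂.verts, v ≠ s → v ≠ t → y₂ v ∈ M)
    (hM0 : valency H₂ s ≠ 1 ∨ valency H₂ t ≠ 1 → 0 ∈ M) :
    ∃ x y m L, IsDrawn (H₁ ⊔ H₂) s t (k₁ + M.card) x y m L := by
  classical
  have hval := valency_sup hadj
  rw [hval] at hs ht
  have hs₁ := sp₁.one_le_left
  have hs₂ := sp₂.one_le_left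
  have ht₁ := sp₁.one_le_right
  have ht₂ := sp₂.one_le_right
  have l₁ := h₁.left (by omega)
  have l₂ := h₂.left (by omega)
  have r₁ := h₁.right (by omega)
  have r₂ := h₂.right (by omega)
  obtain ⟨sm₁, tm₁, hst⟩ := sp₁.terminals
  obtain ⟨sm₂, tm₂, -⟩ := sp₂.terminals
  have hmeet : ∀ v, v ∈ H₁.verts → v ∈ H₂.verts → v = s ∨ v = t := fun v h h' => by
    have : v ∈ H₁.verts ∩ H₂.verts := ⟨h, h'⟩
    rwa [hi] at this
  obtain ⟨N₁, hN₁0, hN₁⟩ := exists_abs_le y₁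
  obtain ⟨N₂, hN₂0, hN₂⟩ := exists_abs_le y₂
  obtain ⟨N₃, hN₃0, hN₃⟩ := exists_abs_le m₁
  obtain ⟨N₄, hN₄0, hN₄⟩ := exists_abs_le m₂
  obtain ⟨N, hN⟩ : ∃ N, N = N₁ + N₂ + N₃ + N₄ := ⟨_, rfl⟩
  -- All heights of both graphs lie in `[-N, N]`, so after the shift by `K` everything from `H₂` is
  -- strictly below `-N`.
  obtain ⟨K, hK⟩ : ∃ K, K = 2 * N + 1 := ⟨_, rfl⟩
  -- The inner vertices of `H₁` come before the old abscissa of `t`, those of `H₂` behind it; `s`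
  -- keeps its place in `H₁` and `t` takes its place in the shifted `H₂`.
  obtain ⟨x, hx⟩ : ∃ x : V → ℤ, ∀ v, x v = if v ∈ H₁.verts ∧ v ≠ t then x₁ v else
      x₂ v - x₂ s + x₁ t := ⟨_, fun _ => rfl⟩
  -- A terminal stays on the base line of `H₁` if `H₂` has only one edge there. Otherwise `H₁` has
  -- only one, and the terminal joins the base line of `H₂`.
  obtain ⟨y, hy⟩ : ∃ y : V → ℤ, ∀ v, y v =
      if v = s then (if valency H₂ s = 1 then 0 else -K) else
      if v = t then (if valency H₂ t = 1 then 0 else -K) else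
      if v ∈ H₁.verts then -y₁ v else y₂ v - K := ⟨_, fun _ => rfl⟩
  obtain ⟨m, hm⟩ : ∃ m : Sym2 V → ℤ, ∀ e, m e = if e ∈ H₁.edgeSet then -m₁ e else m₂ e - K :=
    ⟨_, fun _ => rfl⟩
  have hm₁ : ∀ u v, H₁.Adj u v → m s(u, v) = -m₁ s(u, v) := fun u v h => by
    rw [hm, if_pos (SimpleGraph.Subgraph.mem_edgeSet.2 h)]
  have hm₂ : ∀ u v, H₂.Adj u v → m s(u, v) = m₂ s(u, v) - K := fun u v h => by
    rw [hm, if_neg fun h' => hadj u v (SimpleGraph.Subgraph.mem_edgeSet.1 h') h]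
  have hys : (valency H₂ s = 1 ∧ y s = 0) ∨ (valency H₁ s = 1 ∧ y s = -K) := by
    have := hy s
    rw [if_pos rfl] at this
    split_ifs at this <;> omega
  have hyt : (valency H₂ t = 1 ∧ y t = 0) ∨ (valency H₁ t = 1 ∧ y t = -K) := by
    have := hy t
    rw [if_neg hst.symm, if_pos rfl] at this
    split_ifs at this <;> omega
  have hy₁ : ∀ v ∈ H₁.verts, v ≠ s → v ≠ t → y v = -y₁ v := fun v hv hvs hvt => by
    rw [hy, if_neg hvs, if_neg hvt, if_pos hv]
  have hy₂ : ∀ v ∈ H₂.verts, v ≠ s → v ≠ t → y v = y₂ v - K := fun v hv hvs hvt => by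
    rw [hy, if_neg hvs, if_neg hvt, if_neg]
    intro h
    rcases hmeet v h hv with h | h
    · exact hvs h
    · exact hvt h
  have hx₁ : ∀ v ∈ H₁.verts, v ≠ t → x v = x₁ v := fun v hv hvt => by
    rw [hx, if_pos ⟨hv, hvt⟩]
  have hxt : x t = x₂ t - x₂ s + x₁ t := by rw [hx, if_neg fun h => h.2 rfl]
  have hx₂ : ∀ v ∈ H₂.verts, v ≠ s → x v = x₂ v - x₂ s + x₁ t := fun v hv hvs => by
    rw [hx, if_neg]
    rintro ⟨h, hvt⟩
    rcases hmeet v h hv with h | h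
    · exact hvs h
    · exact hvt h
  have hxs : x s = x₁ s := hx₁ s sm₁ hst
  have lt₁ : x₁ s < x₁ t := l₁.lt t tm₁ hst.symm
  have lt₂ : x₂ s < x₂ t := l₂.lt t tm₂ hst.symm
  have hrt₁ : ∀ v ∈ H₁.verts, v ≠ t → x₁ v < x₁ t := fun v hv hvt => by
    have := r₁.lt v hv hvt
    omega
  have hrt₂ : ∀ v ∈ H₂.verts, v ≠ t → x₂ v < x₂ t := fun v hv hvt => by
    have := r₂.lt v hv hvt
    omega
  have mono₁ : ∀ u ∈ H₁.verts, ∀ v ∈ H₁.verts, x₁ u < x₁ v → x u < x v := by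
    intro u hu v hv h
    have hut : u ≠ t := by
      rintro rfl
      by_cases e : v = u
      · rw [e] at h; exact lt_irrefl _ h
      · exact absurd h (hrt₁ v hv e).not_gt
    rw [hx₁ u hu hut]
    by_cases e : v = t
    · rw [e, hxt]
      have := hrt₁ u hu hut
      omega
    · rw [hx₁ v hv e]; exact h
  have mono₂ : ∀ u ∈ H₂.verts, ∀ v ∈ H₂.verts, x₂ u < x₂ v → x u < x v := by
    intro u hu v hv h
    have hvs : v ≠ s := by
      rintro rfl
      by_cases e : u = v
      · rw [e] at h; exact lt_irrefl _ h
      · exact absurd h (l₂.lt u hu e).not_gt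
    rw [hx₂ v hv hvs]
    by_cases e : u = s
    · rw [e] at h ⊢
      omega
    · rw [hx₂ u hu e]; omega
  have hmin : ∀ v ∈ (H₁ ⊔ H₂).verts, v ≠ s → x s < x v := by
    rintro v (hv | hv) hvs
    · exact mono₁ s sm₁ v hv (l₁.lt v hv hvs)
    · exact mono₂ s sm₂ v hv (l₂.lt v hv hvs)
  have hmax : ∀ v ∈ (H₁ ⊔ H₂).verts, v ≠ t → x v < x t := by
    rintro v (hv | hv) hvt
    · exact mono₁ v hv t tm₁ (hrt₁ v hv hvt)
    · exact mono₂ v hv t tm₂ (hrt₂ v hv hvt)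
  have ext₁ : ∀ u ∈ H₁.verts, y u = -y₁ u ∨ (∀ v ∈ H₁.verts, v ≠ u → x₁ u < x₁ v) ∨
      (∀ v ∈ H₁.verts, v ≠ u → x₁ v < x₁ u) := by
    intro u hu
    by_cases hus : u = s
    · subst hus; exact Or.inr (Or.inl l₁.lt)
    · by_cases hut : u = t
      · subst hut; exact Or.inr (Or.inr hrt₁)
      · exact Or.inl (hy₁ u hu hus hut)
  have ext₂ : ∀ u ∈ H₂.verts, y u = y₂ u - K ∨ (∀ v ∈ H₂.verts, v ≠ u → x₂ u < x₂ v) ∨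
      (∀ v ∈ H₂.verts, v ≠ u → x₂ v < x₂ u) := by
    intro u hu
    by_cases hus : u = s
    · subst hus; exact Or.inr (Or.inl l₂.lt)
    · by_cases hut : u = t
      · subst hut; exact Or.inr (Or.inr hrt₂)
      · exact Or.inl (hy₂ u hu hus hut)
  have hneg : StrictAnti fun z : ℤ => -z := fun a b h => neg_lt_neg h
  have hsub : StrictMono fun z : ℤ => z - K := fun a b h => sub_lt_sub_right h K
  have lay₁ : Layout H₁ x y m := h₁.layout.map (Or.inr hneg) mono₁ hm₁ ext₁
  have lay₂ : Layout H₂ x y m := h₂.layout.map (Or.inl hsub) mono₂ hm₂ ext₂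
  have hinner : ∀ w a b, a ∈ (H₁ ⊔ H₂).verts → b ∈ (H₁ ⊔ H₂).verts → x a < x w → x w < x b →
      w ≠ s ∧ w ≠ t := by
    intro w a b ha hb h1 h2
    constructor
    · rintro rfl
      by_cases e : a = w
      · rw [e] at h1; exact lt_irrefl _ h1
      · exact absurd h1 (hmin a ha e).not_gt
    · rintro rfl
      by_cases e : b = w
      · rw [e] at h2; exact lt_irrefl _ h2
      · exact absurd h2 (hmax b hb e).not_gt
  have hinj : ∀ u ∈ H₁.verts, ∀ v ∈ H₂.verts, x u = x v → u = v := by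
    intro u hu v hv huv
    by_contra hne
    by_cases hus : u = s
    · subst hus; exact (hmin v (Or.inr hv) (Ne.symm hne)).ne huv
    by_cases hut : u = t
    · subst hut; exact (hmax v (Or.inr hv) (Ne.symm hne)).ne' huv
    by_cases hvs : v = s
    · subst hvs; exact (hmin u (Or.inl hu) hne).ne' huv
    have e1 := hx₁ u hu hut
    have e2 := hx₂ v hv hvs
    have e3 := hrt₁ u hu hut
    have e4 := l₂.lt v hv hvs
    omega
  -- the levels of the two graphs are separated
  have bm₁ : ∀ u v, H₁.Adj u v → -N ≤ m s(u, v) := fun u v h => by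
    have := hN₃ s(u, v)
    rw [hm₁ u v h]
    omega
  have bm₂ : ∀ u v, H₂.Adj u v → m s(u, v) < -N := fun u v h => by
    have := hN₄ s(u, v)
    rw [hm₂ u v h]
    omega
  have by₁ : ∀ v, -N ≤ -y₁ v := fun v => by
    have := hN₁ v
    omega
  have by₂ : ∀ v, y₂ v - K < -N := fun v => by
    have := hN₂ v
    omega
  -- Each terminal counts for the graph on whose base line it was placed, so vertices of equal
  -- height always belong to the same side.
  have hside : ∀ v ∈ (H₁ ⊔ H₂).verts, (v ∈ H₁.verts ∧ y v = -y₁ v) ∨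
      (v ∈ H₂.verts ∧ y v = y₂ v - K) := by
    intro v hv
    by_cases hvs : v = s
    · subst hvs
      have := l₁.height
      have := l₂.height
      rcases hys with h | h
      · exact Or.inl ⟨sm₁, by omega⟩
      · exact Or.inr ⟨sm₂, by omega⟩
    by_cases hvt : v = t
    · subst hvt
      have := r₁.height
      have := r₂.height
      rcases hyt with h | h
      · exact Or.inl ⟨tm₁, by omega⟩
      · exact Or.inr ⟨tm₂, by omega⟩
    rcases hv with hv | hv
    · exact Or.inl ⟨hv, hy₁ v hv hvs hvt⟩
    · exact Or.inr ⟨hv, hy₂ v hv hvs hvt⟩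
  -- With valency at most two, both graphs have one edge at `p`; then `p` is at height `0` and its
  -- edges run at `0` and `-K`.
  have hends : ∀ p, p = s ∨ p = t → valency (H₁ ⊔ H₂) p ≤ 2 → y p = 0 ∧
      (∀ v, (H₁ ⊔ H₂).Adj p v → m s(p, v) ≤ 0) ∧ valency (H₁ ⊔ H₂) p ≠ 1 := by
    have gen : ∀ p x₁ x₂, LeftEnd H₁ x₁ y₁ m₁ p → LeftEnd H₂ x₂ y₂ m₂ p → 1 ≤ valency H₁ p →
        1 ≤ valency H₂ p → ((valency H₂ p = 1 ∧ y p = 0) ∨ (valency H₁ p = 1 ∧ y p = -K)) →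
        (valency H₂ p = 1 → y p = 0) → valency (H₁ ⊔ H₂) p ≤ 2 → y p = 0 ∧
        (∀ v, (H₁ ⊔ H₂).Adj p v → m s(p, v) ≤ 0) ∧ valency (H₁ ⊔ H₂) p ≠ 1 := by
      rintro p x₁ x₂ e₁ e₂ p₁ p₂ - hp1 hp
      rw [hval] at hp ⊢
      refine ⟨hp1 (by omega), ?_, by omega⟩
      rintro v (hv | hv)
      · rw [hm₁ _ _ hv, e₁.straight (by omega) v hv, neg_zero]
      · rw [hm₂ _ _ hv, e₂.straight (by omega) v hv]
        omega
    rintro p (rfl | rfl)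
    · exact gen p _ _ l₁ l₂ hs₁ hs₂ hys fun h => by rw [hy, if_pos rfl, if_pos h]
    · exact gen p _ _ r₁ r₂ ht₁ ht₂ hyt fun h => by rw [hy, if_neg hst.symm, if_pos rfl, if_pos h]
  refine ⟨x, y, m, L₁.image (fun z => -z) ∪ M.image (fun z => z - K), ⟨?_, ?_, ?_, ?_, ?_, ?_, ?_⟩⟩
  · refine lay₁.sup lay₂ hinj ?_ ?_ ?_
    · intro a b c d hab hcd _ _ h _ _
      have := bm₁ a b hab
      have := bm₂ c d hcd
      omega
    · intro w v a b hwv hab h1 h2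
      obtain ⟨hws, hwt⟩ := hinner w a b (Or.inr (H₂.edge_vert hab)) (Or.inr (H₂.edge_vert hab.symm))
        h1 h2
      have := bm₂ a b hab
      have := bm₁ w v hwv
      have := by₁ w
      have := hy₁ w (H₁.edge_vert hwv) hws hwt
      omega
    · intro w v a b hwv hab h1 h2
      obtain ⟨hws, hwt⟩ := hinner w a b (Or.inl (H₁.edge_vert hab)) (Or.inl (H₁.edge_vert hab.symm))
        h1 h2
      have := bm₁ a b hab
      have := bm₂ w v hwv
      have := by₂ w
      have := hy₂ w (H₂.edge_vert hwv) hws hwt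
      omega
  · intro w a b ha hb hab
    have hK0 : 0 ≤ K := by omega
    by_cases hws : w = s
    · subst hws
      exact stubs_par hK0 l₁ l₂ hys hm₁ hm₂ h₁.stubs h₂.stubs a b ha hb hab
    by_cases hwt : w = t
    · subst hwt
      exact stubs_par hK0 r₁ r₂ hyt hm₁ hm₂ h₁.stubs h₂.stubs a b ha hb hab
    have hnot : ∀ a b, H₁.Adj w a → ¬ H₂.Adj w b := fun a b ha hb => by
      rcases hmeet w (H₁.edge_vert ha) (H₂.edge_vert hb) with h | h
      · exact hws h
      · exact hwt h
    rcases ha with ha | ha <;> rcases hb with hb | hb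
    · exact stubs_congr (Or.inr hneg) (hy₁ w (H₁.edge_vert ha) hws hwt) (hm₁ _ _ ha) (hm₁ _ _ hb)
        (h₁.stubs w a b ha hb hab)
    · exact absurd hb (hnot a b ha)
    · exact absurd ha (hnot b a hb)
    · exact stubs_congr (Or.inl hsub) (hy₂ w (H₂.edge_vert ha) hws hwt) (hm₂ _ _ ha) (hm₂ _ _ hb)
        (h₂.stubs w a b ha hb hab)
  · intro v hv w hw hwv hxwv
    rcases hside v hv with ⟨hv', ev⟩ | ⟨hv', ev⟩ <;> rcases hside w hw with ⟨hw', ew⟩ | ⟨hw', ew⟩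
    · obtain ⟨u, hu, h⟩ := h₁.straight.map h₁.layout hneg.injective mono₁ hm₁ ext₁ hv' hw' ev ew
        hwv hxwv
      exact ⟨u, Or.inl hu, h⟩
    · have := by₁ v
      have := by₂ w
      omega
    · have := by₁ w
      have := by₂ v
      omega
    · obtain ⟨u, hu, h⟩ := h₂.straight.map h₂.layout hsub.injective mono₂ hm₂ ext₂ hv' hw' ev ew
        hwv hxwv
      exact ⟨u, Or.inr hu, h⟩
  · intro h
    obtain ⟨e1, e2, e3⟩ := hends s (Or.inl rfl) h
    exact ⟨hmin, e1, e2, fun h => absurd h e3⟩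
  · intro h
    obtain ⟨e1, e2, e3⟩ := hends t (Or.inr rfl) h
    exact ⟨fun v hv hvt => neg_lt_neg (hmax v hv hvt), e1, e2, fun h => absurd h e3⟩
  · have h0 : ∀ p, p = s ∨ p = t → y p = 0 ∨
        y p ∈ L₁.image (fun z => -z) ∪ M.image (fun z => z - K) := by
      have hmem : (valency H₂ s ≠ 1 ∨ valency H₂ t ≠ 1) →
          -K ∈ L₁.image (fun z => -z) ∪ M.image (fun z => z - K) := fun h =>
        Finset.mem_union_right _ (Finset.mem_image.2 ⟨0, hM0 h, by ring⟩)
      rintro p (rfl | rfl)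
      · rw [hy, if_pos rfl]
        split_ifs with h
        · exact Or.inl rfl
        · exact Or.inr (hmem (Or.inl h))
      · rw [hy, if_neg hst.symm, if_pos rfl]
        split_ifs with h
        · exact Or.inl rfl
        · exact Or.inr (hmem (Or.inr h))
    intro v hv
    by_cases hvs : v = s
    · exact h0 v (Or.inl hvs)
    by_cases hvt : v = t
    · exact h0 v (Or.inr hvt)
    rcases hv with hv | hv
    · rw [hy₁ v hv hvs hvt]
      rcases h₁.heights v hv with h | h
      · left; omega
      · right; exact Finset.mem_union_left _ (Finset.mem_image.2 ⟨_, h, rfl⟩)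
    · rw [hy₂ v hv hvs hvt]
      right; exact Finset.mem_union_right _ (Finset.mem_image.2 ⟨_, hM v hv hvs hvt, rfl⟩)
  · exact (Finset.card_union_le _ _).trans
      (add_le_add (Finset.card_image_le.trans h₁.card_le) Finset.card_image_le)

/-- Every series-parallel graph of maximum degree three has a layout. -/
theorem SeriesParallel.exists_isDrawn [Finite V] {H : G.Subgraph} {s t : V} {k : ℕ}
    (h : SeriesParallel H s t k) (hdeg : ∀ v, valency H v ≤ 3) :
    ∃ x y m L, IsDrawn H s t k x y m L := by
  classical
  induction h with
  | edge h => exact isDrawn_edge h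
  | series sp₁ sp₂ hv ih₁ ih₂ =>
    obtain ⟨x₁, y₁, m₁, L₁, h₁⟩ := ih₁ fun v => (valency_mono le_sup_left v).trans (hdeg v)
    obtain ⟨x₂, y₂, m₂, L₂, h₂⟩ := ih₂ fun v => (valency_mono le_sup_right v).trans (hdeg v)
    exact h₁.series sp₁ sp₂ hv (hdeg _) h₂
  | @par H₁ H₂ s t k₁ k₂ sp₁ sp₂ hv he ih₁ ih₂ =>
    obtain ⟨x₁, y₁, m₁, L₁, h₁⟩ := ih₁ fun v => (valency_mono le_sup_left v).trans (hdeg v)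
    obtain ⟨x₂, y₂, m₂, L₂, h₂⟩ := ih₂ fun v => (valency_mono le_sup_right v).trans (hdeg v)
    -- The inserted `0` is the base line of `H₂`: the one new height charged to this composition.
    obtain ⟨x, y, m, L, h⟩ := h₁.parallel sp₁ sp₂ hv he (hdeg _) (hdeg _) h₂ (insert 0 L₂)
      (fun v hv _ _ => by
        rw [Finset.mem_insert]; exact h₂.heights v hv) (fun _ => Finset.mem_insert_self _ _)
    refine ⟨x, y, m, L, { h with card_le := h.card_le.trans ?_ }⟩
    have := Finset.card_insert_le 0 L₂
    have := h₂.card_le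
    omega
  | @parEdge H s t k sp₁ h he ih =>
    obtain ⟨x₁, y₁, m₁, L₁, h₁⟩ := ih fun v => (valency_mono le_sup_left v).trans (hdeg v)
    obtain ⟨x₂, y₂, m₂, L₂, h₂⟩ := isDrawn_edge h
    have hadj : ∀ u v, H.Adj u v → ¬ (G.subgraphOfAdj h).Adj u v := by
      intro u v huv h'
      rw [SimpleGraph.subgraphOfAdj_adj, Sym2.eq_iff] at h'
      rcases h' with ⟨rfl, rfl⟩ | ⟨rfl, rfl⟩
      · exact he huv
      · exact he huv.symm
    -- An edge has no inner vertex and valency one at both ends, so both terminals keep height `0`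
    -- and no height is added.
    refine h₁.parallel sp₁ (.edge h) ?_ hadj (hdeg _) (hdeg _) h₂ ∅ ?_ ?_
    · rw [SimpleGraph.subgraphOfAdj_verts, Set.inter_eq_right]
      rintro v (rfl | rfl)
      · exact sp₁.terminals.1
      · exact sp₁.terminals.2.1
    · rintro v (rfl | rfl) h1 h2
      · exact absurd rfl h1
      · exact absurd rfl h2
    · rw [valency_subgraphOfAdj_left, valency_subgraphOfAdj_right]
      tauto

end Composition

/-! ### From layouts to drawings -/

/-- The polyline from `(x₁, y₁)` vertically to the height `m`, horizontally to the abscissa `x₂`, and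
vertically to `(x₂, y₂)`, without degenerate pieces. -/
noncomputable def bentPath (x₁ y₁ m x₂ y₂ : ℝ) : List Point :=
  (x₁, y₁) :: (((if m = y₁ then [] else [(x₁, m)]) ++ (if m = y₂ then [] else [(x₂, m)])) ++
    [(x₂, y₂)])

lemma mem_segment_vertical {x a b : ℝ} {z : Point} :
    z ∈ segment ℝ ((x, a) : Point) (x, b) ↔ z.1 = x ∧ ((a ≤ z.2 ∧ z.2 ≤ b) ∨ (b ≤ z.2 ∧ z.2 ≤ a)) := by
  rw [segment_vertical, Set.mem_ofPred_eq, Set.mem_uIcc]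

lemma mem_segment_horizontal {y a b : ℝ} (hab : a < b) {z : Point} :
    z ∈ segment ℝ ((a, y) : Point) (b, y) ↔ z.2 = y ∧ a ≤ z.1 ∧ z.1 ≤ b := by
  rw [segment_horizontal, Set.mem_ofPred_eq, Set.mem_uIcc]
  constructor
  · rintro ⟨h, h' | h'⟩
    · exact ⟨h, h'⟩
    · exact ⟨h, by linarith, by linarith⟩
  · rintro ⟨h, h'⟩
    exact ⟨h, Or.inl h'⟩

lemma mem_polylineCarrier_cons_cons {a b z : Point} {l : List Point} :
    z ∈ polylineCarrier (a :: b :: l) ↔ z ∈ segment ℝ a b ∨ z ∈ polylineCarrier (b :: l) := Iff.rfl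

lemma mem_polylineCarrier_cons_cons_cons {a b c z : Point} {l : List Point} :
    z ∈ polylineCarrier (a :: b :: c :: l) ↔
      z ∈ segment ℝ a b ∨ z ∈ polylineCarrier (b :: c :: l) := Iff.rfl

lemma mem_polylineCarrier_pair {a b z : Point} :
    z ∈ polylineCarrier [a, b] ↔ z ∈ segment ℝ a b := by
  rw [mem_polylineCarrier_cons_cons]
  refine ⟨fun h => h.elim id fun h => ?_, Or.inl⟩
  rw [show z = b from h]
  exact right_mem_segment ℝ a b

lemma mem_polylineCarrier_bentPath {x₁ y₁ m x₂ y₂ : ℝ} (hx : x₁ < x₂) {z : Point}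
    (h : z ∈ polylineCarrier (bentPath x₁ y₁ m x₂ y₂)) :
    (z.1 = x₁ ∧ ((y₁ ≤ z.2 ∧ z.2 ≤ m) ∨ (m ≤ z.2 ∧ z.2 ≤ y₁))) ∨
    (z.2 = m ∧ x₁ ≤ z.1 ∧ z.1 ≤ x₂) ∨
    (z.1 = x₂ ∧ ((y₂ ≤ z.2 ∧ z.2 ≤ m) ∨ (m ≤ z.2 ∧ z.2 ≤ y₂))) := by
  unfold bentPath at h
  by_cases h₁ : m = y₁ <;> by_cases h₂ : m = y₂
  · subst h₁ h₂
    simp only [if_true, List.append_nil, List.nil_append, mem_polylineCarrier_pair,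
      mem_segment_horizontal hx] at h
    tauto
  · subst h₁
    simp only [h₂, if_true, if_false, List.nil_append, List.cons_append,
      mem_polylineCarrier_cons_cons_cons, mem_polylineCarrier_pair, mem_segment_horizontal hx,
      mem_segment_vertical] at h
    tauto
  · subst h₂
    simp only [h₁, if_true, if_false, List.append_nil, List.nil_append, List.cons_append,
      mem_polylineCarrier_cons_cons_cons, mem_polylineCarrier_pair, mem_segment_horizontal hx,
      mem_segment_vertical] at h
    tauto
  · simp only [h₁, h₂, if_false, List.nil_append, List.cons_append,
      mem_polylineCarrier_cons_cons_cons, mem_polylineCarrier_pair, mem_segment_horizontal hx,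
      mem_segment_vertical] at h
    tauto

lemma isOrthogonalPath_pair {a b : Point} (hab : a ≠ b) (h : IsHorizontal a b ∨ IsVertical a b) :
    IsOrthogonalPath [a, b] :=
  ⟨hab, h, fun _ hx => hx.2, trivial⟩

lemma isOrthogonalPath_bentPath {x₁ y₁ m x₂ y₂ : ℝ} (hx : x₁ < x₂) :
    IsOrthogonalPath (bentPath x₁ y₁ m x₂ y₂) := by
  unfold bentPath
  have hne : ∀ a b : ℝ, ((x₁, a) : Point) ≠ (x₂, b) := fun a b e => hx.ne (congrArg Prod.fst e)
  have hne' : ∀ a b c : ℝ, b ≠ c → ((a, b) : Point) ≠ (a, c) :=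
    fun a b c h e => h (congrArg Prod.snd e)
  have hlast : m ≠ y₂ → IsOrthogonalPath [(x₁, m), (x₂, m), (x₂, y₂)] := by
    intro h₂
    refine ⟨hne _ _, Or.inl rfl, ?_, isOrthogonalPath_pair (hne' _ _ _ h₂) (Or.inr rfl)⟩
    rintro z ⟨h, h'⟩
    rw [mem_polylineCarrier_pair, mem_segment_vertical] at h'
    rw [mem_segment_horizontal hx] at h
    exact Prod.ext h'.1 h.1
  have hfirst : ∀ l, m ≠ y₁ → IsOrthogonalPath ((x₁, m) :: l) →
      (∀ z ∈ polylineCarrier ((x₁, m) :: l), z.1 = x₁ → z.2 = m) →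
      IsOrthogonalPath ((x₁, y₁) :: (x₁, m) :: l) := by
    intro l h₁ hl hz
    refine ⟨hne' _ _ _ (Ne.symm h₁), Or.inr rfl, ?_, hl⟩
    rintro z ⟨h, h'⟩
    rw [mem_segment_vertical] at h
    exact Prod.ext h.1 (hz z h' h.1)
  by_cases h₁ : m = y₁ <;> by_cases h₂ : m = y₂
  · subst h₁ h₂
    simp only [if_true, List.append_nil, List.nil_append]
    exact isOrthogonalPath_pair (hne _ _) (Or.inl rfl)
  · subst h₁
    simp only [h₂, if_true, if_false, List.nil_append, List.cons_append]
    exact hlast h₂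
  · subst h₂
    simp only [h₁, if_true, if_false, List.append_nil, List.nil_append, List.cons_append]
    refine hfirst _ h₁ (isOrthogonalPath_pair (hne _ _) (Or.inl rfl)) ?_
    intro z hz _
    rw [mem_polylineCarrier_pair, mem_segment_horizontal hx] at hz
    exact hz.1
  · simp only [h₁, h₂, if_false, List.nil_append, List.cons_append]
    refine hfirst _ h₁ (hlast h₂) ?_
    intro z hz hz1
    rw [mem_polylineCarrier_cons_cons, mem_polylineCarrier_pair, mem_segment_horizontal hx,
      mem_segment_vertical] at hz
    rcases hz with hz | hz
    · exact hz.1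
    · linarith [hz.1]

section LayoutDrawing

variable {V : Type*} {G : SimpleGraph V} {x y : V → ℤ} {m : Sym2 V → ℤ}

open Classical in
/-- The polylines of a layout. -/
noncomputable def layoutRoute (x y : V → ℤ) (m : Sym2 V → ℤ) (e : Sym2 V) : List Point :=
  if h : ∃ p : V × V, e = s(p.1, p.2) ∧ x p.1 < x p.2 then
    bentPath (x h.choose.1) (y h.choose.1) (m e) (x h.choose.2) (y h.choose.2) else []

lemma layoutRoute_eq {u v : V} (h : x u < x v) :
    layoutRoute x y m s(u, v) = bentPath (x u) (y u) (m s(u, v)) (x v) (y v) := by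
  have hex : ∃ p : V × V, s(u, v) = s(p.1, p.2) ∧ x p.1 < x p.2 := ⟨(u, v), rfl, h⟩
  have hs := hex.choose_spec
  rw [layoutRoute, dif_pos hex]
  generalize hex.choose = p at hs ⊢
  obtain ⟨h1, h2⟩ := hs
  rcases Sym2.eq_iff.1 h1 with ⟨e1, e2⟩ | ⟨e1, e2⟩
  · rw [← e1, ← e2]
  · rw [← e1, ← e2] at h2
    omega

/-- `z` lies on the vertical part of the edge `e` at the end `w`. -/
def OnStub (G : SimpleGraph V) (x y : V → ℤ) (m : Sym2 V → ℤ) (e : Sym2 V) (w : V) (z : Point) :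
    Prop :=
  ∃ w', e = s(w, w') ∧ G.Adj w w' ∧ z.1 = x w ∧
    (((y w : ℝ) ≤ z.2 ∧ z.2 ≤ m e) ∨ ((m e : ℝ) ≤ z.2 ∧ z.2 ≤ y w))

/-- `z` lies on the horizontal part of the edge `e`. -/
def OnRun (G : SimpleGraph V) (x : V → ℤ) (m : Sym2 V → ℤ) (e : Sym2 V) (z : Point) : Prop :=
  ∃ a b, e = s(a, b) ∧ G.Adj a b ∧ x a < x b ∧ z.2 = m e ∧ (x a : ℝ) ≤ z.1 ∧ z.1 ≤ x b

lemma Layout.exists_orientation (h : Layout (⊤ : G.Subgraph) x y m) {e : Sym2 V}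
    (he : e ∈ G.edgeSet) : ∃ u v, e = s(u, v) ∧ G.Adj u v ∧ x u < x v := by
  induction e using Sym2.ind with | _ u v
  have he : G.Adj u v := he
  rcases lt_trichotomy (x u) (x v) with h1 | h1 | h1
  · exact ⟨u, v, rfl, he, h1⟩
  · exact absurd (h.inj u trivial v trivial h1) he.ne
  · exact ⟨v, u, Sym2.eq_swap, he.symm, h1⟩

lemma Layout.mem_route (h : Layout (⊤ : G.Subgraph) x y m) {e : Sym2 V}
    (he : e ∈ G.edgeSet) {z : Point} (hz : z ∈ polylineCarrier (layoutRoute x y m e)) :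
    (∃ w, OnStub G x y m e w z) ∨ OnRun G x m e z := by
  obtain ⟨u, v, rfl, hadj, huv⟩ := h.exists_orientation he
  rw [layoutRoute_eq huv] at hz
  rcases mem_polylineCarrier_bentPath (Int.cast_lt.2 huv) hz with h | h | h
  · exact Or.inl ⟨u, v, rfl, hadj, h⟩
  · exact Or.inr ⟨u, v, rfl, hadj, huv, h⟩
  · exact Or.inl ⟨v, u, Sym2.eq_swap, hadj.symm, h⟩

lemma OnStub.mem {e : Sym2 V} {w : V} {z : Point} (h : OnStub G x y m e w z) : w ∈ e := by
  obtain ⟨w', rfl, -⟩ := h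
  simp

/-- Equal abscissae force the two stubs to start at the same vertex, and by `Stubs` they do not
leave it in the same direction. -/
lemma Layout.meet_stub_stub (h : Layout (⊤ : G.Subgraph) x y m) (hs : Stubs (⊤ : G.Subgraph) y m)
    {e e' : Sym2 V} (hne : e ≠ e') {w w' : V} {z : Point} (h₁ : OnStub G x y m e w z)
    (h₂ : OnStub G x y m e' w' z) : ∃ v, v ∈ e ∧ v ∈ e' ∧ z = ((x v : ℝ), (y v : ℝ)) := by
  have hw := h₁.mem
  have hw' := h₂.mem
  obtain ⟨a, rfl, ha, hz1, hz2⟩ := h₁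
  obtain ⟨b, rfl, hb, hz1', hz2'⟩ := h₂
  have hww : w = w' := h.inj w trivial w' trivial (by exact_mod_cast hz1.symm.trans hz1')
  subst hww
  refine ⟨w, hw, hw', Prod.ext hz1 ?_⟩
  have hab : a ≠ b := fun e => hne (by rw [e])
  simp only
  rcases hs w a b ha hb hab with ⟨h1, h2⟩ | ⟨h1, h2⟩
  · have h1 : (m s(w, a) : ℝ) ≤ y w := by exact_mod_cast h1
    have h2 : (y w : ℝ) ≤ m s(w, b) := by exact_mod_cast h2
    rcases hz2 with hz2 | hz2 <;> rcases hz2' with hz2' | hz2' <;> linarith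
  · have h1 : (m s(w, b) : ℝ) ≤ y w := by exact_mod_cast h1
    have h2 : (y w : ℝ) ≤ m s(w, a) := by exact_mod_cast h2
    rcases hz2 with hz2 | hz2 <;> rcases hz2' with hz2' | hz2' <;> linarith

lemma onStub_corner {a b : V} (hab : G.Adj a b) {z : Point} (h1 : z.1 = x a)
    (h2 : z.2 = m s(a, b)) : OnStub G x y m s(a, b) a z := by
  refine ⟨b, rfl, hab, h1, ?_⟩
  rcases le_total (y a : ℝ) (m s(a, b)) with h | h
  · exact Or.inl ⟨h2 ▸ h, h2.le⟩
  · exact Or.inr ⟨h2.ge, h2 ▸ h⟩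

/-- A point of a run that has the abscissa of a vertex is a corner, or passes the vertex. -/
lemma Layout.onStub_or_lt (h : Layout (⊤ : G.Subgraph) x y m) {e : Sym2 V} {z : Point}
    (hz : OnRun G x m e z) {w : V} (hw : z.1 = x w) :
    OnStub G x y m e w z ∨ ∃ a b, e = s(a, b) ∧ G.Adj a b ∧ x a < x w ∧ x w < x b := by
  obtain ⟨a, b, rfl, hab, hlt, h1, h2, h3⟩ := hz
  rw [hw] at h2 h3
  have h2 : x a ≤ x w := by exact_mod_cast h2
  have h3 : x w ≤ x b := by exact_mod_cast h3
  rcases h2.lt_or_eq with h2 | h2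
  · rcases h3.lt_or_eq with h3 | h3
    · exact Or.inr ⟨a, b, rfl, hab, h2, h3⟩
    · obtain rfl := h.inj w trivial b trivial h3
      left
      rw [Sym2.eq_swap] at h1 ⊢
      exact onStub_corner hab.symm hw h1
  · obtain rfl := h.inj a trivial w trivial h2
    exact Or.inl (onStub_corner hab hw h1)

/-- At the abscissa of the stub the run either has a corner, which lies on a stub of its own edge,
or passes by, which `Layout.cross` excludes. -/
lemma Layout.meet_stub_run (h : Layout (⊤ : G.Subgraph) x y m) (hs : Stubs (⊤ : G.Subgraph) y m)
    {e e' : Sym2 V} (hne : e ≠ e') {w : V} {z : Point} (h₁ : OnStub G x y m e w z)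
    (h₂ : OnRun G x m e' z) : ∃ v, v ∈ e ∧ v ∈ e' ∧ z = ((x v : ℝ), (y v : ℝ)) := by
  have h₁' := h₁
  obtain ⟨w', rfl, hww', hz1, hz2⟩ := h₁
  rcases h.onStub_or_lt (y := y) h₂ hz1 with h3 | ⟨a, b, rfl, hab, h3, h4⟩
  · exact h.meet_stub_stub hs hne h₁' h3
  · exfalso
    obtain ⟨-, -, -, -, -, hz, -, -⟩ := h₂
    rw [hz] at hz2
    norm_cast at hz2
    have := h.cross w w' a b hww' hab h3 h4
    omega

/-- By `Layout.runs`, runs of different edges at the same height can only touch end to end; the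
common point is a corner, hence on a stub. -/
lemma Layout.meet_run_run (h : Layout (⊤ : G.Subgraph) x y m) (hs : Stubs (⊤ : G.Subgraph) y m)
    {e e' : Sym2 V} (hne : e ≠ e') {z : Point} (h₁ : OnRun G x m e z)
    (h₂ : OnRun G x m e' z) : ∃ v, v ∈ e ∧ v ∈ e' ∧ z = ((x v : ℝ), (y v : ℝ)) := by
  have h₁' := h₁
  have h₂' := h₂
  obtain ⟨a, b, rfl, hab, hlt, hz1, hz2, hz3⟩ := h₁
  obtain ⟨c, d, rfl, hcd, hlt', hz1', hz2', hz3'⟩ := h₂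
  by_cases h1 : x a < x d
  · by_cases h2 : x c < x b
    · exact absurd (h.runs a b c d hab hcd hlt hlt' (by exact_mod_cast hz1.symm.trans hz1') h1 h2) hne
    · have h2 : (x b : ℝ) ≤ x c := by exact_mod_cast not_lt.1 h2
      have hzb : z.1 = x b := le_antisymm hz3 (h2.trans hz2')
      have hstub : OnStub G x y m s(a, b) b z := by
        rw [Sym2.eq_swap] at hz1 ⊢
        exact onStub_corner hab.symm hzb hz1
      exact h.meet_stub_run hs hne hstub h₂'
  · have h1 : (x d : ℝ) ≤ x a := by exact_mod_cast not_lt.1 h1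
    have hza : z.1 = x a := le_antisymm (hz3'.trans h1) hz2
    exact h.meet_stub_run hs hne (onStub_corner hab hza hz1) h₂'

/-- The drawing given by a layout. -/
noncomputable def Layout.drawing (h : Layout (⊤ : G.Subgraph) x y m)
    (hs : Stubs (⊤ : G.Subgraph) y m) (hadj : ∀ v, ∃ w, G.Adj v w) : OrthogonalDrawing G where
  pos v := ((x v : ℝ), (y v : ℝ))
  route := layoutRoute x y m
  pos_injective u v huv := h.inj u trivial v trivial (Int.cast_injective (α := ℝ) (congrArg Prod.fst huv))
  route_ends e he := by
    obtain ⟨u, v, rfl, -, huv⟩ := h.exists_orientation he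
    exact ⟨u, v, _, rfl, layoutRoute_eq huv⟩
  route_orthogonal e he := by
    obtain ⟨u, v, rfl, -, huv⟩ := h.exists_orientation he
    rw [layoutRoute_eq huv]
    exact isOrthogonalPath_bentPath (Int.cast_lt.2 huv)
  vertex_on_route e he w hw := by
    rcases h.mem_route he hw with ⟨v, hv⟩ | hr
    · have hve := hv.mem
      obtain ⟨v', -, -, h1, -⟩ := hv
      rwa [h.inj w trivial v trivial (Int.cast_injective (α := ℝ) h1)]
    · rcases h.onStub_or_lt (y := y) hr (w := w) rfl with h1 | ⟨a, b, rfl, hab, h1, h2⟩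
      · exact h1.mem
      · exfalso
        -- `Layout.cross` applies to `w` only through an edge at `w`.
        obtain ⟨w', hw'⟩ := hadj w
        obtain ⟨-, -, -, -, -, hz, -, -⟩ := hr
        have hz : y w = m s(a, b) := Int.cast_injective (α := ℝ) hz
        have := h.cross w w' a b hw' hab h1 h2
        omega
  routes_meet e he e' he' hne z hz hz' := by
    rcases h.mem_route he hz with ⟨w, h1⟩ | h1 <;> rcases h.mem_route he' hz' with ⟨w', h2⟩ | h2
    · exact h.meet_stub_stub hs hne h1 h2
    · exact h.meet_stub_run hs hne h1 h2
    · obtain ⟨v, hv, hv', e⟩ := h.meet_stub_run hs hne.symm h2 h1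
      exact ⟨v, hv', hv, e⟩
    · exact h.meet_run_run hs hne h1 h2

/-- All vertices of the same height lie on a segment of the drawing. -/
lemma Layout.exists_isMaxSegment [Finite V] (h : Layout (⊤ : G.Subgraph) x y m)
    (hs : Stubs (⊤ : G.Subgraph) y m) (hst : Straight (⊤ : G.Subgraph) x y m)
    (hadj : ∀ v, ∃ w, G.Adj v w) (v : V) :
    ∃ S, (h.drawing hs hadj).IsMaxSegment S ∧
      ∀ w, y w = y v → (h.drawing hs hadj).LiesOn w S := by
  set Γ := h.drawing hs hadj with hΓ
  have hpiece : ∀ u w, G.Adj u w → x u < x w → y u = y w → m s(u, w) = y w →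
      (Γ.pos u, Γ.pos w) ∈ Γ.pieces := by
    intro u w huw h1 h2 h3
    refine ⟨s(u, w), huw, ?_⟩
    have e : Γ.route s(u, w) = [Γ.pos u, Γ.pos w] := by
      change layoutRoute x y m s(u, w) = _
      rw [layoutRoute_eq h1, bentPath, h2, h3, if_pos rfl]
      simp [hΓ, Layout.drawing, h2]
    rw [e]
  obtain ⟨v₀, hv₀, hmin⟩ := Set.exists_min_image {w | y w = y v} x (Set.toFinite _) ⟨v, rfl⟩
  have hv₀ : y v₀ = y v := hv₀
  have hmin : ∀ w, y w = y v → x v₀ ≤ x w := hmin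
  by_cases hex : ∃ w, y w = y v ∧ x v₀ < x w
  · obtain ⟨v₁, ⟨hv₁, hlt⟩, hmin₁⟩ := Set.exists_min_image {w | y w = y v ∧ x v₀ < x w} x
      (Set.toFinite _) hex
    obtain ⟨u, hu, h1, h2, h3, h4⟩ := hst v₁ trivial v₀ trivial (hv₀.trans hv₁.symm) hlt
    have hu0 : v₀ = u := by
      rcases h1.lt_or_eq with h1 | h1
      · exact absurd h2 (hmin₁ u ⟨h3.trans hv₁, h1⟩).not_gt
      · exact h.inj v₀ trivial u trivial h1
    subst hu0
    have hp := hpiece v₀ v₁ hu h2 h3 h4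
    refine ⟨_, ⟨_, hp, rfl⟩, ?_⟩
    -- Induction on the distance from the leftmost vertex `v₀` of this height: `Straight` gives a
    -- straight edge from `w` to an earlier vertex of the same height.
    have key : ∀ n : ℕ, ∀ w, y w = y v → x w - x v₀ = n → ∃ q,
        Relation.ReflTransGen (fun a b => b ∈ Γ.pieces ∧ OrthogonalDrawing.Continues a b)
          (Γ.pos v₀, Γ.pos v₁) q ∧ IsHorizontal q.1 q.2 ∧ (q.1 = Γ.pos w ∨ q.2 = Γ.pos w) := by
      intro n
      induction n using Nat.strong_induction_on with
      | _ n ih =>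
        intro w hw hn
        rcases (hmin w hw).lt_or_eq with hlt | heq
        · obtain ⟨u, hu, k1, k2, k3, k4⟩ := hst w trivial v₀ trivial (hv₀.trans hw.symm) hlt
          obtain ⟨q, hq, hqh, hqu⟩ := ih (x u - x v₀).toNat (by omega) u (k3.trans hw) (by omega)
          have hyr : IsHorizontal (Γ.pos u) (Γ.pos w) := by
            change ((y u : ℤ) : ℝ) = y w
            rw [k3]
          refine ⟨(Γ.pos u, Γ.pos w), hq.tail ⟨hpiece u w hu k2 k3 k4, Or.inl ⟨hqh, hyr⟩, ?_⟩,
            hyr, Or.inr rfl⟩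
          rcases hqu with hqu | hqu
          · exact Or.inl hqu
          · exact Or.inr (Or.inr (Or.inl hqu))
        · obtain rfl := h.inj v₀ trivial w trivial heq
          refine ⟨_, Relation.ReflTransGen.refl, ?_, Or.inl rfl⟩
          change ((y v₀ : ℤ) : ℝ) = y v₁
          rw [h3]
    intro w hw
    obtain ⟨q, hq, -, hqw⟩ := key (x w - x v₀).toNat w hw (by have := hmin w hw; omega)
    refine ⟨q, hq, ?_⟩
    rcases hqw with hqw | hqw
    · rw [← hqw]; exact left_mem_segment ℝ _ _
    · rw [← hqw]; exact right_mem_segment ℝ _ _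
  -- Here `v` is the only vertex of its height, and any piece at `v` will do, even a vertical one.
  · push Not at hex
    obtain ⟨w, hw⟩ := hadj v
    obtain ⟨a, b, bends, he, hr⟩ := Γ.route_ends s(v, w) hw
    have hp : ∃ p ∈ Γ.pieces, Γ.pos v ∈ segment ℝ p.1 p.2 := by
      have hv : v = a ∨ v = b := by
        have : v ∈ s(a, b) := he ▸ Sym2.mem_mk_left v w
        simpa using this
      rcases hv with rfl | rfl
      · obtain ⟨c, l, hl⟩ : ∃ c l, bends ++ [Γ.pos b] = c :: l :=
          List.exists_cons_of_ne_nil (by simp)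
        refine ⟨(Γ.pos v, c), ⟨s(v, w), hw, ?_⟩, left_mem_segment ℝ _ _⟩
        rw [hr, hl]
        exact ⟨[], l, rfl⟩
      · obtain ⟨l, c, hl⟩ : ∃ l c, Γ.pos a :: bends = l ++ [c] :=
          ⟨_, _, (List.dropLast_append_getLast (List.cons_ne_nil _ _)).symm⟩
        refine ⟨(c, Γ.pos v), ⟨s(v, w), hw, ?_⟩, right_mem_segment ℝ _ _⟩
        rw [hr, ← List.cons_append, hl]
        exact ⟨l, [], by simp⟩
    obtain ⟨p, hp, hvp⟩ := hp
    refine ⟨_, ⟨p, hp, rfl⟩, fun w hw => ?_⟩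
    have hwv : w = v := h.inj w trivial v trivial (by
      have := hmin v rfl
      have := hmin w hw
      have := hex v rfl
      have := hex w hw
      omega)
    exact ⟨p, Relation.ReflTransGen.refl, hwv ▸ hvp⟩

lemma Layout.coveredBy [Finite V] (h : Layout (⊤ : G.Subgraph) x y m)
    (hs : Stubs (⊤ : G.Subgraph) y m) (hst : Straight (⊤ : G.Subgraph) x y m)
    (hadj : ∀ v, ∃ w, G.Adj v w) {L : Finset ℤ} (hL : ∀ v, y v ∈ L) :
    (h.drawing hs hadj).CoveredBy L.card := by
  classical
  choose S hS hcov using h.exists_isMaxSegment hs hst hadj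
  refine ⟨(L.filter fun l => ∃ v, y v = l).attach.image fun l =>
    S (Finset.mem_filter.1 l.2).2.choose, ?_, ?_, ?_⟩
  · refine Finset.card_image_le.trans ?_
    rw [Finset.card_attach]
    exact Finset.card_filter_le _ _
  · intro T hT
    obtain ⟨l, -, rfl⟩ := Finset.mem_image.1 hT
    exact hS _
  · intro v
    have hmem : y v ∈ L.filter fun l => ∃ v, y v = l :=
      Finset.mem_filter.2 ⟨hL v, v, rfl⟩
    refine ⟨_, Finset.mem_image.2 ⟨⟨y v, hmem⟩, Finset.mem_attach _ _, rfl⟩, hcov _ v ?_⟩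
    exact ((Finset.mem_filter.1 hmem).2.choose_spec).symm

end LayoutDrawing

/-- A series-parallel graph of maximum degree three has a drawing with a small cover. -/
theorem SeriesParallel.exists_coveredBy {V : Type*} [Finite V] {G : SimpleGraph V} {s t : V} {k : ℕ}
    (h : SeriesParallel (⊤ : G.Subgraph) s t k) (hdeg : ∀ v, valency (⊤ : G.Subgraph) v ≤ 3) :
    ∃ Γ : OrthogonalDrawing G, Γ.CoveredBy (k + 1) := by
  classical
  obtain ⟨x, y, m, L, hd⟩ := h.exists_isDrawn hdeg
  refine ⟨hd.layout.drawing hd.stubs fun v => h.exists_adj (v := v) trivial, ?_⟩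
  obtain ⟨C, hC, h1, h2⟩ := hd.layout.coveredBy hd.stubs hd.straight
    (fun v => h.exists_adj (v := v) trivial) (L := insert 0 L)
    fun v => Finset.mem_insert.2 (hd.heights v trivial)
  refine ⟨C, hC.trans ((Finset.card_insert_le _ _).trans ?_), h1, h2⟩
  have := hd.card_le
  omega

/-! ### Compositions with changed terminals -/

namespace SeriesParallel

variable {V : Type*} {G : SimpleGraph V} {H : G.Subgraph} {s t : V} {k : ℕ}

lemma not_adj_subgraphOfAdj (h : G.Adj s t) (he : ¬ H.Adj s t) (u v : V) (huv : H.Adj u v) :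
    ¬ (G.subgraphOfAdj h).Adj u v := by
  intro h'
  rw [SimpleGraph.subgraphOfAdj_adj, Sym2.eq_iff] at h'
  rcases h' with ⟨rfl, rfl⟩ | ⟨rfl, rfl⟩
  · exact he huv
  · exact he huv.symm

/-- If a terminal has only one edge, that edge can be split off. -/
lemma exists_split [Finite V] (h : SeriesParallel H s t k) (ht : valency H t = 1) :
    (∃ h : G.Adj s t, H = G.subgraphOfAdj h) ∨
    ∃ (w : V) (H' : G.Subgraph) (h : G.Adj w t) (k' : ℕ), k' ≤ k ∧ SeriesParallel H' s w k' ∧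
      H = H' ⊔ G.subgraphOfAdj h ∧ t ∉ H'.verts := by
  induction h with
  | edge h => exact Or.inl ⟨h, rfl⟩
  | @series H₁ H₂ s m t k₁ k₂ h₁ h₂ hv ih₁ ih₂ =>
    right
    have ht₁ : t ∉ H₁.verts := fun h => by
      have : t ∈ H₁.verts ∩ H₂.verts := ⟨h, h₂.terminals.2.1⟩
      rw [hv] at this
      exact h₂.terminals.2.2 this.symm
    rw [valency_sup (not_adj_of_inter_eq_singleton hv), valency_eq_zero ht₁, zero_add] at ht
    rcases ih₂ ht with ⟨h, rfl⟩ | ⟨w, H', h, k', hk, h', rfl, htH⟩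
    · exact ⟨m, H₁, h, k₁, by omega, h₁, rfl, ht₁⟩
    · refine ⟨w, H₁ ⊔ H', h, k₁ + k', by omega, h₁.series h' ?_, (sup_assoc _ _ _).symm, ?_⟩
      · refine Set.Subset.antisymm ?_ ?_
        · rw [← hv]
          exact Set.inter_subset_inter_right _ Set.subset_union_left
        · rintro _ rfl
          exact ⟨h₁.terminals.2.1, h'.terminals.1⟩
      · rintro (h | h)
        · exact ht₁ h
        · exact htH h
  | par h₁ h₂ hv he _ _ =>
    rw [valency_sup he] at ht
    have := h₁.one_le_right
    have := h₂.one_le_right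
    omega
  | parEdge h₁ h he _ =>
    rw [valency_sup (not_adj_subgraphOfAdj h he), valency_subgraphOfAdj_right] at ht
    have := h₁.one_le_right
    omega

/-- A parallel combination with a graph that has only one edge at `t` can be rebuilt with other
terminals, without a new parallel combination. -/
lemma exists_reroot [Finite V] {H₁ H₂ : G.Subgraph} {k₁ k₂ : ℕ} (h₁ : SeriesParallel H₁ s t k₁)
    (h₂ : SeriesParallel H₂ s t k₂) (hv : H₁.verts ∩ H₂.verts = {s, t})
    (he : ∀ u v, H₁.Adj u v → ¬ H₂.Adj u v) (ht : valency H₂ t = 1) :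
    ∃ w k, k ≤ k₁ + k₂ ∧ SeriesParallel (H₁ ⊔ H₂) w t k := by
  rcases h₂.exists_split ht with ⟨h, rfl⟩ | ⟨w, H', h, k', hk, h', rfl, htH⟩
  · exact ⟨s, k₁, by omega, h₁.parEdge h fun h' => he _ _ h' (SimpleGraph.subgraphOfAdj_adj_self h)⟩
  · refine ⟨w, k' + k₁, by omega, ?_⟩
    -- `H₂` is `H'` from `s` to `w` followed by the edge `wt`. Starting at `w`, the reversed `H'`
    -- and `H₁` form a series combination from `w` to `t`, to which `wt` is parallel.
    have hser : SeriesParallel (H' ⊔ H₁) w t (k' + k₁) := by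
      refine h'.symm.series h₁ (Set.Subset.antisymm ?_ ?_)
      · rintro v ⟨hv', hv₁⟩
        have : v ∈ H₁.verts ∩ (H' ⊔ G.subgraphOfAdj h).verts := ⟨hv₁, Or.inl hv'⟩
        rw [hv] at this
        rcases this with rfl | rfl
        · rfl
        · exact absurd hv' htH
      · rintro _ rfl
        exact ⟨h'.terminals.1, h₁.terminals.1⟩
    have e : H₁ ⊔ (H' ⊔ G.subgraphOfAdj h) = (H' ⊔ H₁) ⊔ G.subgraphOfAdj h := by
      rw [← sup_assoc, sup_comm H₁ H']
    rw [e]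
    refine hser.parEdge h ?_
    rintro (h0 | h0)
    · exact htH (H'.edge_vert h0.symm)
    · exact he _ _ h0 (Or.inr (SimpleGraph.subgraphOfAdj_adj_self h))

lemma of_isSeries {n : ℕ} {K : Fin (n + 1) → G.Subgraph} {c : Fin (n + 2) → V} {k : Fin (n + 1) → ℕ}
    (h : SPQTree.IsSeries K c) (hK : ∀ i, SeriesParallel (K i) (c i.castSucc) (c i.succ) (k i)) :
    SeriesParallel (⨆ i, K i) (c 0) (c (Fin.last (n + 1))) (∑ i, k i) := by
  induction n with
  | zero =>
    have e : ⨆ i, K i = K 0 :=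
      le_antisymm (iSup_le fun i => by rw [Subsingleton.elim (α := Fin 1) i 0]) (le_iSup K 0)
    have e' : ∑ i, k i = k 0 := Fin.sum_univ_one k
    rw [e, e']
    exact hK 0
  | succ n ih =>
    have h' : SPQTree.IsSeries (fun i : Fin (n + 1) => K i.castSucc)
        (fun i : Fin (n + 2) => c i.castSucc) :=
      ⟨fun i => h.left_mem i.castSucc, fun i => h.right_mem i.castSucc, fun i => h.ne i.castSucc,
        fun i j hij => h.inter i.castSucc j.castSucc hij,
        fun i j hij => h.disj i.castSucc j.castSucc hij⟩
    have h1 := ih h' fun i => hK i.castSucc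
    have h2 := hK (Fin.last (n + 1))
    have e : ⨆ i, K i = (⨆ i : Fin (n + 1), K i.castSucc) ⊔ K (Fin.last (n + 1)) := by
      apply le_antisymm
      · refine iSup_le fun i => ?_
        induction i using Fin.lastCases with
        | last => exact le_sup_right
        | cast i => exact le_sup_of_le_left (le_iSup (fun i : Fin (n + 1) => K i.castSucc) i)
      · exact sup_le (iSup_le fun i => le_iSup K i.castSucc) (le_iSup K _)
    rw [e, Fin.sum_univ_castSucc]
    refine h1.series h2 (Set.Subset.antisymm ?_ ?_)
    · rintro v ⟨hv, hv'⟩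
      simp only [SimpleGraph.Subgraph.verts_iSup, Set.mem_iUnion] at hv
      obtain ⟨i, hi⟩ := hv
      exact (h.eq_of_mem (Fin.castSucc_lt_last i) hi hv').2
    · rintro _ rfl
      exact ⟨h1.terminals.2.1, h2.terminals.1⟩

end SeriesParallel

/-! ### From SPQ-trees to binary compositions -/

namespace SPQTree

variable {V : Type*} {G : SimpleGraph V} {H : G.Subgraph} {s t : V}

lemma Decomposes.exists_adj {T : SPQTree} (h : T.Decomposes H s t) :
    (∃ w, H.Adj s w) ∧ ∃ w, H.Adj t w := by
  induction T generalizing H s t with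
  | Q =>
    obtain ⟨h, rfl⟩ := h
    exact ⟨⟨_, SimpleGraph.subgraphOfAdj_adj_self h⟩, ⟨_, (SimpleGraph.subgraphOfAdj_adj_self h).symm⟩⟩
  | S n child ih =>
    obtain ⟨hn, K, c, rfl, rfl, rfl, hK, h1, h2⟩ := h
    obtain ⟨n, rfl⟩ : ∃ m, n = m + 1 := ⟨n - 1, by omega⟩
    obtain ⟨w, hw⟩ := (ih 0 (hK 0)).1
    obtain ⟨w', hw'⟩ := (ih (Fin.last n) (hK (Fin.last n))).2
    simp only [SimpleGraph.Subgraph.iSup_adj]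
    exact ⟨⟨w, 0, hw⟩, ⟨w', Fin.last n, hw'⟩⟩
  | P n child ih =>
    obtain ⟨hn, K, rfl, hK, h1⟩ := h
    obtain ⟨⟨w, hw⟩, ⟨w', hw'⟩⟩ := ih ⟨0, by omega⟩ (hK ⟨0, by omega⟩)
    simp only [SimpleGraph.Subgraph.iSup_adj]
    exact ⟨⟨w, _, hw⟩, ⟨w', _, hw'⟩⟩

lemma Decomposes.one_le_left [Finite V] {T : SPQTree} (h : T.Decomposes H s t) :
    1 ≤ valency H s := valency_pos h.exists_adj.1.choose_spec

lemma Decomposes.one_le_right [Finite V] {T : SPQTree} (h : T.Decomposes H s t) :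
    1 ≤ valency H t := valency_pos h.exists_adj.2.choose_spec

lemma not_adj_of_disjoint_edgeSet {H₁ H₂ : G.Subgraph} (h : Disjoint H₁.edgeSet H₂.edgeSet)
    (u v : V) (h₁ : H₁.Adj u v) : ¬ H₂.Adj u v := fun h₂ =>
  Set.disjoint_left.1 h (SimpleGraph.Subgraph.mem_edgeSet.2 h₁)
    (SimpleGraph.Subgraph.mem_edgeSet.2 h₂)

open Classical in
/-- A parallel combination of two graphs. -/
lemma seriesParallel_of_two {T₁ T₂ : SPQTree} {H₁ H₂ : G.Subgraph} (d₁ : T₁.Decomposes H₁ s t)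
    (d₂ : T₂.Decomposes H₂ s t) (h₁ : SeriesParallel H₁ s t T₁.numPStar)
    (h₂ : SeriesParallel H₂ s t T₂.numPStar) (hv : H₁.verts ∩ H₂.verts = {s, t})
    (he : ∀ u v, H₁.Adj u v → ¬ H₂.Adj u v) :
    SeriesParallel (H₁ ⊔ H₂) s t
      ((if T₁ = Q ∨ T₂ = Q then 0 else 1) + (T₁.numPStar + T₂.numPStar)) := by
  by_cases q₁ : T₁ = Q
  · subst q₁
    obtain ⟨h, rfl⟩ := d₁
    rw [if_pos (Or.inl rfl), sup_comm]
    simpa [numPStar] using h₂.parEdge h fun h' => he s t (SimpleGraph.subgraphOfAdj_adj_self h) h'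
  by_cases q₂ : T₂ = Q
  · subst q₂
    obtain ⟨h, rfl⟩ := d₂
    rw [if_pos (Or.inr rfl)]
    simpa [numPStar] using h₁.parEdge h fun h' => he s t h' (SimpleGraph.subgraphOfAdj_adj_self h)
  rw [if_neg (by tauto), add_comm 1]
  exact h₁.par h₂ hv he

/-- The degree bound in a parallel combination. -/
lemma sum_valency_le [Finite V] {n : ℕ} {K : Fin n → G.Subgraph} {v : V}
    (hd : ∀ i j, i ≠ j → Disjoint (K i).edgeSet (K j).edgeSet) {r : ℕ} (f : Fin r → Fin n)
    (hf : Function.Injective f) (hpos : ∀ i, 1 ≤ valency (K i) v) :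
    r ≤ valency (⨆ i, K i) v := by
  have hw : ∀ i, ∃ w, (K i).Adj v w := fun i =>
    (Set.ncard_pos (Set.toFinite _)).1 (hpos i)
  choose w hw using hw
  have hinj : Function.Injective fun i => w (f i) := by
    intro i j hij
    by_contra hne
    have h1 := hw (f i)
    have h2 := hw (f j)
    simp only at hij
    rw [← hij] at h2
    exact not_adj_of_disjoint_edgeSet (hd _ _ fun e => hne (hf e)) _ _ h1 h2
  have : Set.range (fun i => w (f i)) ⊆ (⨆ i, K i).neighborSet v := by
    rintro _ ⟨i, rfl⟩
    simp only [SimpleGraph.Subgraph.mem_neighborSet, SimpleGraph.Subgraph.iSup_adj]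
    exact ⟨f i, hw _⟩
  have h := Set.ncard_le_ncard this (Set.toFinite _)
  rwa [← Set.image_univ, Set.ncard_image_of_injective _ hinj, Set.ncard_univ, Nat.card_fin] at h

open Classical in
lemma numPStar_P_two (child : Fin 2 → SPQTree) : (P 2 child).numPStar =
    (if child 0 = Q ∨ child 1 = Q then 0 else 1) + ((child 0).numPStar + (child 1).numPStar) := by
  simp only [numPStar, Fin.sum_univ_two, Fin.exists_fin_two]

/-- A decomposition yields binary compositions with the same count, unless its root is a `P`-node
with three edges at both terminals. -/
theorem Decomposes.seriesParallel [Finite V] (hdeg : ∀ v, valency (⊤ : G.Subgraph) v ≤ 3)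
    {T : SPQTree} (h : T.Decomposes H s t)
    (hP : ∀ n child, T = P n child → n = 2 ∨ valency H s ≤ 2 ∨ valency H t ≤ 2) :
    SeriesParallel H s t T.numPStar := by
  classical
  induction T generalizing H s t with
  | Q =>
    obtain ⟨h, rfl⟩ := h
    exact .edge h
  | S n child ih =>
    obtain ⟨hn, K, c, rfl, rfl, rfl, hK, h1, h2⟩ := h
    have hS := IsSeries.of_decomposes hK h1 h2
    obtain ⟨n, rfl⟩ : ∃ m, n = m + 1 := ⟨n - 1, by omega⟩
    -- Every part has a neighbouring part, which uses an edge at their common terminal and leaves at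
    -- most two edges there.
    refine SeriesParallel.of_isSeries hS fun i => ih i (hK i) fun _ _ _ => Or.inr ?_
    have hsum : ∀ i j : Fin (n + 1), (i : ℕ) + 1 = j → ∀ v,
        valency (K i) v + valency (K j) v ≤ 3 := by
      intro i j hij v
      rw [← valency_sup (not_adj_of_inter_eq_singleton (h1 i j hij))]
      exact (valency_mono le_top v).trans (hdeg v)
    by_cases hi : (i : ℕ) + 1 < n + 1
    · right
      have h3 := hsum i ⟨i + 1, hi⟩ rfl (c i.succ)
      have h4 := (hK ⟨i + 1, hi⟩).one_le_left
      have e : c (Fin.castSucc ⟨i + 1, hi⟩) = c i.succ := rfl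
      rw [e] at h4
      omega
    · left
      have hi0 : 0 < (i : ℕ) := by omega
      have h3 := hsum ⟨i - 1, by omega⟩ i (by simp only; omega) (c i.castSucc)
      have h4 := (hK ⟨i - 1, by omega⟩).one_le_right
      have e : c (Fin.succ ⟨i - 1, by omega⟩) = c i.castSucc := by
        congr 1; ext; simp; omega
      rw [e] at h4
      omega
  | P n child ih =>
    obtain ⟨hn, K, rfl, hK, h1⟩ := h
    have hn2 : n = 2 := by
      by_contra hne
      have e : 3 ≤ n := by omega
      have hd : ∀ i j, i ≠ j → Disjoint (K i).edgeSet (K j).edgeSet := fun i j hij => (h1 i j hij).2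
      have e1 := sum_valency_le hd (Fin.castLE e) (Fin.castLE_injective e)
        fun i => (hK i).one_le_left
      have e2 := sum_valency_le hd (Fin.castLE e) (Fin.castLE_injective e)
        fun i => (hK i).one_le_right
      have := hP n child rfl
      omega
    subst hn2
    have h01 := h1 0 1 (by decide)
    have hadj := not_adj_of_disjoint_edgeSet h01.2
    have hv : valency (K 0) s + valency (K 1) s ≤ 3 := by
      rw [← valency_sup hadj]
      exact (valency_mono le_top s).trans (hdeg s)
    have hs0 := (hK 0).one_le_left
    have hs1 := (hK 1).one_le_left
    rw [iSup_fin_two, numPStar_P_two]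
    -- Each child leaves at least one edge at `s` to the other, so the other has at most two.
    exact seriesParallel_of_two (hK 0) (hK 1)
      (ih 0 (hK 0) fun _ _ _ => Or.inr (Or.inl (by omega)))
      (ih 1 (hK 1) fun _ _ _ => Or.inr (Or.inl (by omega))) h01.1 hadj

open Classical in
/-- A parallel combination of three graphs, for suitable terminals. -/
lemma exists_seriesParallel_of_three [Finite V] (hdeg : ∀ v, valency (⊤ : G.Subgraph) v ≤ 3)
    {child : Fin 3 → SPQTree} {K : Fin 3 → G.Subgraph}
    (hK : ∀ i, (child i).Decomposes (K i) s t)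
    (h1 : ∀ i j, i ≠ j → (K i).verts ∩ (K j).verts = {s, t} ∧ Disjoint (K i).edgeSet (K j).edgeSet)
    {a b c : Fin 3} (hab : a ≠ b) (hac : a ≠ c) (hbc : b ≠ c) :
    ∃ w k, k ≤ (if child a = Q ∨ child b = Q then 0 else 1) +
      ((child a).numPStar + (child b).numPStar) + (child c).numPStar ∧
      SeriesParallel (K a ⊔ K b ⊔ K c) w t k := by
  have eab := not_adj_of_disjoint_edgeSet (h1 a b hab).2
  have eac := not_adj_of_disjoint_edgeSet (h1 a c hac).2
  have ebc := not_adj_of_disjoint_edgeSet (h1 b c hbc).2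
  have eabc : ∀ u v, (K a ⊔ K b).Adj u v → ¬ (K c).Adj u v := fun u v h =>
    h.elim (eac u v) (ebc u v)
  have hsum : ∀ v, valency (K a) v + valency (K b) v + valency (K c) v ≤ 3 := by
    intro v
    rw [← valency_sup eab, ← valency_sup eabc]
    exact (valency_mono le_top v).trans (hdeg v)
  have hs := fun i => (hK i).one_le_left
  have ht := fun i => (hK i).one_le_right
  have hsp : ∀ i, i = a ∨ i = b ∨ i = c → SeriesParallel (K i) s t (child i).numPStar := by
    intro i hi
    refine (hK i).seriesParallel hdeg fun _ _ _ => Or.inr (Or.inl ?_)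
    have := hsum s
    have := hs a
    have := hs b
    have := hs c
    rcases hi with rfl | rfl | rfl <;> omega
  have h12 := seriesParallel_of_two (hK a) (hK b) (hsp a (by tauto)) (hsp b (by tauto))
    (h1 a b hab).1 eab
  -- Three parts share at most three edges at `t`, so part `c` has exactly one and its last edge can
  -- be cut off.
  refine h12.exists_reroot (hsp c (by tauto)) ?_ eabc ?_
  · rw [SimpleGraph.Subgraph.verts_sup, Set.union_inter_distrib_right, (h1 a c hac).1,
      (h1 b c hbc).1, Set.union_self]
  · have := hsum t
    have := ht a
    have := ht b
    have := ht c
    omega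

/-- A series-parallel graph of maximum degree three can be built by binary compositions without
increasing the count, possibly with other terminals. -/
theorem IsTreeOf.exists_seriesParallel [Finite V] (hdeg : ∀ v, valency (⊤ : G.Subgraph) v ≤ 3)
    {T : SPQTree} (h : T.IsTreeOf G s t) :
    ∃ s' t' k, k ≤ T.numPStar ∧ SeriesParallel (⊤ : G.Subgraph) s' t' k := by
  classical
  by_cases hP : ∀ n child, T = P n child → n = 2 ∨ valency (⊤ : G.Subgraph) s ≤ 2 ∨
      valency (⊤ : G.Subgraph) t ≤ 2
  · exact ⟨s, t, _, le_rfl, Decomposes.seriesParallel hdeg h hP⟩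
  push Not at hP
  obtain ⟨n, child, rfl, hn, -, -⟩ := hP
  obtain ⟨hn2, K, hH, hK, h1⟩ := h
  have hn3 : n = 3 := by
    by_contra hne
    have e : 4 ≤ n := by omega
    have e1 := sum_valency_le (fun i j hij => (h1 i j hij).2) (Fin.castLE e)
      (Fin.castLE_injective e) fun i => (hK i).one_le_left
    rw [← hH] at e1
    have := hdeg s
    omega
  subst hn3
  have hK3 : (⊤ : G.Subgraph) = K 0 ⊔ K 1 ⊔ K 2 := by
    rw [hH]
    apply le_antisymm
    · refine iSup_le fun i => ?_
      fin_cases i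
      · exact le_sup_of_le_left le_sup_left
      · exact le_sup_of_le_left le_sup_right
      · exact le_sup_right
    · exact sup_le (sup_le (le_iSup K 0) (le_iSup K 1)) (le_iSup K 2)
  have hnum : (P 3 child).numPStar = (if child 0 = Q ∨ child 1 = Q ∨ child 2 = Q then 0 else 1) +
      ((child 0).numPStar + (child 1).numPStar + (child 2).numPStar) := by
    simp only [numPStar, Fin.sum_univ_three, Fin.exists_fin_succ, Fin.exists_fin_zero]
    simp
  -- The third graph is merged without cost, so the pair combined first should contain a `Q`-node if
  -- there is one.
  by_cases q2 : child 2 = Q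
  · have q1 : child 1 ≠ Q := by
      intro q1
      have d1 := hK 1
      have d2 := hK 2
      rw [q1] at d1
      rw [q2] at d2
      obtain ⟨a1, b1⟩ := d1
      obtain ⟨a2, b2⟩ := d2
      refine not_adj_of_disjoint_edgeSet (h1 1 2 (by decide)).2 s t ?_ ?_
      · rw [b1]; exact SimpleGraph.subgraphOfAdj_adj_self a1
      · rw [b2]; exact SimpleGraph.subgraphOfAdj_adj_self a2
    obtain ⟨w, k, hk, hw⟩ := exists_seriesParallel_of_three hdeg hK h1 (a := 0) (b := 2) (c := 1)
      (by decide) (by decide) (by decide)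
    refine ⟨w, t, k, ?_, ?_⟩
    · rw [hnum, if_pos (by tauto)]
      rw [if_pos (by tauto)] at hk
      omega
    · rw [hK3, sup_assoc, sup_comm (K 1), ← sup_assoc]
      exact hw
  · obtain ⟨w, k, hk, hw⟩ := exists_seriesParallel_of_three hdeg hK h1 (a := 0) (b := 1) (c := 2)
      (by decide) (by decide) (by decide)
    refine ⟨w, t, k, ?_, hK3 ▸ hw⟩
    rw [hnum]
    simpa [q2, add_assoc] using hk

end SPQTree

/-! ### The theorem -/

lemma OrthogonalDrawing.CoveredBy.mono {V : Type*} {G : SimpleGraph V} {Γ : OrthogonalDrawing G}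
    {m m' : ℕ} (h : Γ.CoveredBy m) (hm : m ≤ m') : Γ.CoveredBy m' := by
  obtain ⟨C, hC, h⟩ := h
  exact ⟨C, hC.trans hm, h⟩

/-- Every series-parallel graph of maximum degree three has an orthogonal drawing whose vertices are
covered by one segment more than the SPQ-tree has `P`-nodes without a `Q`-node child. -/
theorem SPQTree.IsTreeOf.exists_coveredBy {V : Type*} [Fintype V] {G : SimpleGraph V}
    [DecidableRel G.Adj] {s t : V} {T : SPQTree} (hG : G.maxDegree ≤ 3) (h : T.IsTreeOf G s t) :
    ∃ Γ : OrthogonalDrawing G, Γ.CoveredBy (T.numPStar + 1) := by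
  have hdeg : ∀ v, valency (⊤ : G.Subgraph) v ≤ 3 := by
    intro v
    have e : (⊤ : G.Subgraph).neighborSet v = (G.neighborFinset v : Set V) := by
      ext w; simp
    rw [valency, e, Set.ncard_coe_finset, SimpleGraph.card_neighborFinset_eq_degree]
    exact (G.degree_le_maxDegree v).trans hG
  obtain ⟨s', t', k, hk, hsp⟩ := h.exists_seriesParallel hdeg
  obtain ⟨Γ, hΓ⟩ := hsp.exists_coveredBy hdeg
  exact ⟨Γ, hΓ.mono (by omega)⟩

theorem mainTheorem4 :
    -- always sufficient
    (∀ (V : Type*) [Fintype V] (G : SimpleGraph V) [DecidableRel G.Adj] (s t : V) (T : SPQTree),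
      G.maxDegree ≤ 3 → T.IsTreeOf G s t →
      ∃ Γ : OrthogonalDrawing G, Γ.CoveredBy (T.numPStar + 1)) ∧
    -- sometimes necessary, for every value of the count, already for outerplanar graphs
    (∀ k : ℕ, ∃ (n : ℕ) (G : SimpleGraph (Fin n)) (_ : DecidableRel G.Adj) (s t : Fin n)
      (T : SPQTree),
      G.maxDegree = 3 ∧ T.IsTreeOf G s t ∧ T.Reduced ∧ IsOuterplanar G ∧ T.numPStar = k ∧
      ∀ (Γ : OrthogonalDrawing G) (m : ℕ), Γ.CoveredBy m → k + 1 ≤ m) ∧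
    -- necessary for every outerplanar graph whose terminals are adjacent
    (∀ (V : Type*) [Fintype V] (G : SimpleGraph V) [DecidableRel G.Adj] (s t : V) (T : SPQTree),
      G.maxDegree ≤ 3 → T.IsTreeOf G s t → T.Reduced → IsOuterplanar G → G.Adj s t →
      ∀ (Γ : OrthogonalDrawing G) (m : ℕ), Γ.CoveredBy m → T.numPStar + 1 ≤ m) := by
  refine ⟨?_, fun k => exists_outerplanar_lower_bound k, ?_⟩
  · intro V _ G _ s t T hG hT
    exact hT.exists_coveredBy hG
  · intro V _ G _ s t T _ hT hred hout hst Γ m hm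
    have : Nonempty V := ⟨s⟩
    rw [hT.numPStar_eq_zero hred hout hst, zero_add]
    exact hm.one_le
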